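/- Let $(\Omega,\theta,\mathbb P)$ be an invertible, measure-preserving, ergodic dynamical system with $\mathbb P$ a probability measure. Let $d\ge 1$ and let $\mathcal A$ be a finite set. Write $\mathcal B(\mathbb C^d)$ for the space of $d\times d$ complex matrices, $\|\cdot\|_1$ for the trace norm, $\|\cdot\|_{\mathrm{op},1}$ for the operator norm it induces on linear maps of $\mathcal B(\mathbb C^d)$, and $\mathbb S$ for the set of positive semidefinite matrices of trace $1$. A positive linear map on $\mathcal B(\mathbb C^d)$ is called positivity improving if it maps nonzero positive semidefinite matrices to positive definite ones, and $\phi$ is called irreducible if $(\mathrm{id}+\phi)^{d-1}$ is positivity improving. Let $\omega\mapsto(\psi_{\omega,a})_{a\in\mathcal A}$ be measurable, where for every $\omega\in\Omega$ the $\psi_{\omega,a}$ are completely positive maps on $\mathcal B(\mathbb C^d)$ whose sum $\varphi_\omega=\sum_{a\in\mathcal A}\psi_{\omega,a}$ is trace preserving and irreducible. For $\rho\in\mathbb S$, let $$p^{(n)}_{\omega,\rho}(a_1,\dots,a_n)=\operatorname{tr}\big[(\psi_{\theta^{n-1}\omega,a_n}\circ\cdots\circ\psi_{\omega,a_1})(\rho)\big],$$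 which is a probability measure on $\mathcal A^n$. For each $a\in\mathcal A$ let $\omega\mapsto f_\omega(a)\in\mathbb R$ be measurable, and put $F_\omega=\max_{a\in\mathcal A}|f_\omega(a)|$ and, for $\alpha\in\mathbb R$, $\varphi^{(\alpha)}_\omega=\sum_{a\in\mathcal A}e^{-\alpha f_\omega(a)}\psi_{\omega,a}$. Assume: (A1) with $v(\phi)=\inf\{\|\phi(X)\|_1: X\in\mathbb S\}$ and $\varphi_\omega^*$ the adjoint of $\varphi_\omega$ for the Hilbert--Schmidt inner product, $\omega\mapsto\log v(\varphi_\omega^*)$ belongs to $L^1(\Omega,\mathbb P)$; (A2) there is $N_0\in\mathbb N$ such that $\mathbb P\{\omega:\varphi_{\theta^{N_0-1}\omega}\circ\cdots\circ\varphi_{\theta\omega}\circ\varphi_\omega\text{ is positivity improving}\}>0$; (A3) $e^{\alpha F}\in L^1(\Omega,\mathbb P)$ for all $\alpha\in\mathbb R$. Then for every $\alpha\in\mathbb R$ there is a deterministic number $\lambda(\alpha)\in\mathbb R$ (the top Lyapunov exponent) such that, for $\mathbb P$-almost every $\omega$, $$\lambda(\alpha)=\lim_{n\to\infty}\frac1n\log\big\|\varphi^{(\alpha)}_{\theta^{n-1}\omega}\circ\cdots\circ\varphi^{(\alpha)}_{\theta\omega}\circ\varphi^{(\alpha)}_\omega\big\|_{\mathrm{op},1}.$$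 Moreover, with the Legendre transform $\lambda^*(s)=\sup_{\alpha\in\mathbb R}(s\alpha-\lambda(\alpha))$, for $\mathbb P$-almost every $\omega$, for every $\rho\in\mathbb S$ and every Borel set $E\subseteq\mathbb R$, $$-\inf_{s\in\operatorname{int}E}\lambda^*(-s)\le\liminf_{n\to\infty}\frac1n\log p^{(n)}_{\omega,\rho}\Big\{(a_1,\dots,a_n):\frac1n\sum_{j=1}^nf_{\theta^{j-1}\omega}(a_j)\in E\Big\}$$ $$\le\limsup_{n\to\infty}\frac1n\log p^{(n)}_{\omega,\rho}\Big\{(a_1,\dots,a_n):\frac1n\sum_{j=1}^nf_{\theta^{j-1}\omega}(a_j)\in E\Big\}\le-\inf_{s\in\operatorname{cl}E}\lambda^*(-s),$$ with the conventions $\log 0=-\infty$ and $\inf\emptyset=+\infty$. -/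

import Mathlib

open MeasureTheory Filter Topology
open scoped ComplexOrder Matrix Kronecker ENNReal

namespace QMP

/-- The space `B(ℂ^d)` of operators on the Hilbert space `ℂ^d`, as matrices. -/
abbrev Op (d : ℕ) : Type := Matrix (Fin d) (Fin d) ℂ

/-- Linear maps `B(ℂ^d) → B(ℂ^d)`. -/
abbrev SuperOp (d : ℕ) : Type := Op d →ₗ[ℂ] Op d

/-- The trace norm `‖X‖₁`: the sum of the singular values of `X`, i.e. of the square roots of the
eigenvalues of `Xᴴ X` (with multiplicity). -/
noncomputable def traceNorm {d : ℕ} (X : Op d) : ℝ :=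
  ∑ i, Real.sqrt ((Matrix.isHermitian_conjTranspose_mul_self X).eigenvalues i)

/-- The set `𝕊` of density matrices: positive semidefinite matrices with trace one. -/
def densityMatrices (d : ℕ) : Set (Op d) :=
  {X | X.PosSemidef ∧ X.trace = 1}

/-- The operator norm `‖φ‖_{op,1}` induced by the trace norm. -/
noncomputable def opNorm {d : ℕ} (φ : SuperOp d) : ℝ :=
  sSup {r : ℝ | ∃ X : Op d, traceNorm X ≤ 1 ∧ r = traceNorm (φ X)}

/-- `v(φ) = inf {‖φ(X)‖₁ : X ∈ 𝕊}`. -/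
noncomputable def v {d : ℕ} (φ : SuperOp d) : ℝ :=
  sInf {r : ℝ | ∃ X ∈ densityMatrices d, r = traceNorm (φ X)}

/-- The adjoint `φ^*` with respect to the Hilbert–Schmidt inner product `⟨X, Y⟩ = tr (Xᴴ Y)`,
given by its matrix entries `(φ^* Y)_{ij} = ⟨E_{ij}, φ^* Y⟩ = ⟨φ E_{ij}, Y⟩`; see
`trace_conjTranspose_mul_hsAdjoint` for the defining property. -/
noncomputable def hsAdjoint {d : ℕ} (φ : SuperOp d) : SuperOp d where
  toFun Y := Matrix.of fun i j => ((φ (Matrix.single i j 1))ᴴ * Y).trace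
  map_add' Y Z := by
    ext i j
    simp [Matrix.mul_add]
  map_smul' c Y := by
    ext i j
    simp

theorem trace_conjTranspose_mul_hsAdjoint {d : ℕ} (φ : SuperOp d) (X Y : Op d) :
    (Xᴴ * hsAdjoint φ Y).trace = ((φ X)ᴴ * Y).trace := by
  have h : φ X = ∑ i, ∑ j, X i j • φ (Matrix.single i j 1) := by
    conv_lhs => rw [Matrix.matrix_eq_sum_single X]
    simp only [map_sum]
    refine Finset.sum_congr rfl fun i _ => Finset.sum_congr rfl fun j _ => ?_
    rw [← map_smul, Matrix.smul_single, smul_eq_mul, mul_one]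
  rw [h]
  simp only [Matrix.conjTranspose_sum, Matrix.conjTranspose_smul, Finset.sum_mul,
    Matrix.trace_sum, Matrix.smul_mul, Matrix.trace_smul]
  simp only [Matrix.trace, Matrix.diag, Matrix.mul_apply, Matrix.conjTranspose_apply, hsAdjoint,
    LinearMap.coe_mk, AddHom.coe_mk, Matrix.of_apply, smul_eq_mul]
  rw [Finset.sum_comm]

/-- The ampliation `φ ⊗ id_{B(ℂ^m)}`, acting on `B(ℂ^d ⊗ ℂ^m)`: the map `φ` is applied to the
blocks `(M_{(i,k),(j,l)})_{i,j}` for fixed `k, l`; see `ampliation_kronecker`. -/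
def ampliation {d : ℕ} (φ : SuperOp d) (m : ℕ)
    (M : Matrix (Fin d × Fin m) (Fin d × Fin m) ℂ) :
    Matrix (Fin d × Fin m) (Fin d × Fin m) ℂ :=
  Matrix.of fun p q => φ (Matrix.of fun i j => M (i, p.2) (j, q.2)) p.1 q.1

theorem ampliation_kronecker {d : ℕ} (φ : SuperOp d) (m : ℕ) (A : Op d)
    (B : Matrix (Fin m) (Fin m) ℂ) : ampliation φ m (A ⊗ₖ B) = φ A ⊗ₖ B := by
  ext p q
  have h : (Matrix.of fun i j => (A ⊗ₖ B) (i, p.2) (j, q.2)) = B p.2 q.2 • A := by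
    ext i j
    simp [mul_comm]
  simp only [ampliation, Matrix.of_apply]
  rw [h]
  simp [mul_comm]

/-- Complete positivity: `φ ⊗ id_{B(ℂ^m)}` is positive for every `m`. -/
def IsCompletelyPositive {d : ℕ} (φ : SuperOp d) : Prop :=
  ∀ (m : ℕ) (M : Matrix (Fin d × Fin m) (Fin d × Fin m) ℂ),
    M.PosSemidef → (ampliation φ m M).PosSemidef

/-- `φ` maps density matrices to density matrices. -/
def IsTracePreserving {d : ℕ} (φ : SuperOp d) : Prop :=
  ∀ X ∈ densityMatrices d, φ X ∈ densityMatrices d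

/-- `φ` maps nonzero positive semidefinite matrices to positive definite matrices. -/
def IsPositivityImproving {d : ℕ} (φ : SuperOp d) : Prop :=
  ∀ X : Op d, X.PosSemidef → X ≠ 0 → (φ X).PosDef

/-- `φ` is irreducible: `(id + φ)^{d-1}` is positivity improving. -/
def IsIrreducible {d : ℕ} (φ : SuperOp d) : Prop :=
  IsPositivityImproving ((LinearMap.id + φ : Module.End ℂ (Op d)) ^ (d - 1))

/-- An irreducible quantum instrument on `ℂ^d` with outcomes in `𝒜`: a tuple of completely
positive maps whose sum is an irreducible CPTP map. -/
structure IsIrreducibleInstrument {d : ℕ} {𝒜 : Type*} [Fintype 𝒜] (ψ : 𝒜 → SuperOp d) : Prop where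
  completelyPositive : ∀ a, IsCompletelyPositive (ψ a)
  tracePreserving : IsTracePreserving (∑ a, ψ a)
  irreducible : IsIrreducible (∑ a, ψ a)

/-- The averaged channel `φ_ω = ∑ₐ ψ_{ω,a}`. -/
def channel {Ω 𝒜 : Type*} [Fintype 𝒜] {d : ℕ} (ψ : Ω → 𝒜 → SuperOp d) (ω : Ω) : SuperOp d :=
  ∑ a, ψ ω a

/-- The deformed channel `φ_ω^{(α)} = ∑ₐ exp (-α f_ω(a)) ψ_{ω,a}`. -/
noncomputable def deformedChannel {Ω 𝒜 : Type*} [Fintype 𝒜] {d : ℕ} (ψ : Ω → 𝒜 → SuperOp d)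
    (f : Ω → 𝒜 → ℝ) (α : ℝ) (ω : Ω) : SuperOp d :=
  ∑ a, (Real.exp (-α * f ω a) : ℂ) • ψ ω a

/-- The composition `φ_{θ^{n-1} ω} ∘ ⋯ ∘ φ_{θ ω} ∘ φ_ω`. -/
def cocycle {Ω : Type*} {d : ℕ} (θ : Ω → Ω) (φ : Ω → SuperOp d) : ℕ → Ω → SuperOp d
  | 0, _ => LinearMap.id
  | n + 1, ω => φ (θ^[n] ω) ∘ₗ cocycle θ φ n ω

/-- The composition `ψ_{θ^{n-1} ω, a_n} ∘ ⋯ ∘ ψ_{θ ω, a_2} ∘ ψ_{ω, a_1}` along a sequence of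
outcomes (indexed from `0`). -/
def trajectory {Ω 𝒜 : Type*} {d : ℕ} (θ : Ω → Ω) (ψ : Ω → 𝒜 → SuperOp d) (ω : Ω) :
    (n : ℕ) → (Fin n → 𝒜) → SuperOp d
  | 0, _ => LinearMap.id
  | n + 1, a => ψ (θ^[n] ω) (a (Fin.last n)) ∘ₗ trajectory θ ψ ω n (fun j => a j.castSucc)

/-- The probability `p^{(n)}_{ω,ρ}(a_1, …, a_n)` of the first `n` outcomes. The trace is a
nonnegative real number for completely positive maps. -/
noncomputable def outcomeProb {Ω 𝒜 : Type*} {d : ℕ} (θ : Ω → Ω) (ψ : Ω → 𝒜 → SuperOp d) (ω : Ω)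
    (ρ : Op d) (n : ℕ) (a : Fin n → 𝒜) : ℝ :=
  (trajectory θ ψ ω n a ρ).trace.re

/-- The probability `p^{(n)}_{ω,ρ}(S)` of a set `S` of sequences of `n` outcomes. -/
noncomputable def eventProb {Ω 𝒜 : Type*} [Fintype 𝒜] {d : ℕ} (θ : Ω → Ω)
    (ψ : Ω → 𝒜 → SuperOp d) (ω : Ω) (ρ : Op d) (n : ℕ) (S : Set (Fin n → 𝒜)) : ℝ≥0∞ :=
  ∑ a, S.indicator (fun a => ENNReal.ofReal (outcomeProb θ ψ ω ρ n a)) a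

/-- The Birkhoff-like average `(1/n) ∑_{j=1}^n f_{θ^{j-1} ω}(a_j)`. -/
noncomputable def birkhoffLikeAverage {Ω 𝒜 : Type*} (θ : Ω → Ω) (f : Ω → 𝒜 → ℝ) (ω : Ω) (n : ℕ)
    (a : Fin n → 𝒜) : ℝ :=
  (1 / (n : ℝ)) * ∑ j : Fin n, f (θ^[(j : ℕ)] ω) (a j)

/-- `(1/n) log p^{(n)}_{ω,ρ} {a : (1/n) ∑ f_{θ^{j-1} ω}(a_j) ∈ E}`, with `log 0 = -∞`. -/
noncomputable def scaledLogProb {Ω 𝒜 : Type*} [Fintype 𝒜] {d : ℕ} (θ : Ω → Ω)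
    (ψ : Ω → 𝒜 → SuperOp d) (f : Ω → 𝒜 → ℝ) (ω : Ω) (ρ : Op d) (E : Set ℝ) (n : ℕ) : EReal :=
  ((1 / (n : ℝ) : ℝ) : EReal) *
    ENNReal.log (eventProb θ ψ ω ρ n {a | birkhoffLikeAverage θ f ω n a ∈ E})

/-- The Legendre transform `λ^*(s) = sup_α (s α - λ(α))`, with values in `[-∞, ∞]`. -/
noncomputable def legendre (lam : ℝ → ℝ) (s : ℝ) : EReal :=
  ⨆ α : ℝ, ((s * α - lam α : ℝ) : EReal)

end QMP

/-! The argument is a quenched Gärtner–Ellis theorem. Expanding the deformed cocycle over outcome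
sequences shows that the moment generating function of the path sum at `t`, under `p^{(n)}_{ω,ρ}`,
is the trace of the deformed cocycle at `α = -t` applied to `ρ`. It remains to find the exponential
growth rate `λ(α)` of these traces, almost surely for all states and all `α` at once, and to prove
that `λ` is differentiable.

Growth rate. By (A2) some event of positive probability makes an `N`-step product of channels
uniformly positive, with the sum of `F` over those steps bounded. Ergodicity makes the orbit visit
it infinitely often, in the past and in the future. At each visit the deformed product is comparable
with `X ↦ (tr X) 1`, and so contracts relative errors in the positive semidefinite order by a fixed
factor, uniformly for `α` in a compact interval (`Near.map_pairBounds`). Hence products from the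
remote past have a limit direction `Z_ω(α)` (`pastDir`), which the deformed channel sends to a
multiple of `Z_{θω}(α)`. The adjoint products over the future give `W_ω(α)` (`futureDir`) with the
dual property. Both are continuous in `α`. The exponent is the integral of the logarithm of the
factor by which `Z` is multiplied. Birkhoff's theorem gives convergence along `Z`, and after one
visit every other state is comparable with `Z`. (A3) enters through the integrability of `F`.

Differentiability. Weighting outcome sequences by their pairing between `Z` and `W` gives a tilted
law under which the expected path sum is a Birkhoff sum (`pair_weightedCocycle`). Jensen's
inequality under this law shows that minus the integral of the tilted mean is a subgradient of `λ`
at `α` (`lyapunov_subgradient`). It is continuous in `α` by dominated convergence, and a continuous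
choice of subgradients is a derivative. -/

section Ergodic

/-! ### Recurrence and Birkhoff's pointwise ergodic theorem -/

section

variable {Ω : Type*} {T : Ω → Ω}

/-- The running maximum of the Birkhoff sums, starting from `0`. -/
noncomputable def birkhoffMax (T : Ω → Ω) (g : Ω → ℝ) : ℕ → Ω → ℝ
  | 0, _ => 0
  | n + 1, ω => max 0 (g ω + birkhoffMax T g n (T ω))

theorem birkhoffMax_nonneg (g : Ω → ℝ) (n : ℕ) (ω : Ω) : 0 ≤ birkhoffMax T g n ω := by
  cases n <;> simp [birkhoffMax]

theorem birkhoffMax_le_succ (g : Ω → ℝ) (n : ℕ) (ω : Ω) :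
    birkhoffMax T g n ω ≤ birkhoffMax T g (n + 1) ω := by
  induction n generalizing ω with
  | zero => exact birkhoffMax_nonneg g 1 ω
  | succ n ih => exact max_le_max le_rfl (add_le_add le_rfl (ih (T ω)))

theorem birkhoffSum_le_birkhoffMax (g : Ω → ℝ) (n : ℕ) (ω : Ω) :
    birkhoffSum T g n ω ≤ birkhoffMax T g n ω := by
  induction n generalizing ω with
  | zero => simp [birkhoffMax]
  | succ n ih =>
    rw [birkhoffSum_succ']
    exact le_max_of_le_right (add_le_add le_rfl (ih (T ω)))

end

variable {Ω : Type*} [MeasurableSpace Ω] {P : Measure Ω} {T : Ω → Ω}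

/-- The event of infinitely many visits is invariant, hence null or full. By Poincaré recurrence it
contains almost all of `G`, so it is not null. -/
theorem Ergodic.ae_frequently_mem [IsProbabilityMeasure P] (hT : Ergodic T P) {G : Set Ω}
    (hG : MeasurableSet G) (hpos : 0 < P G) : ∀ᵐ ω ∂P, ∃ᶠ n in atTop, T^[n] ω ∈ G := by
  set A : Set Ω := {ω | ∃ᶠ n in atTop, T^[n] ω ∈ G} with hA
  have hAm : MeasurableSet A := by
    have : A = limsup (fun n => (T^[n]) ⁻¹' G) atTop := by
      ext ω
      simp [hA, mem_limsup_iff_frequently_mem]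
    rw [this]
    exact MeasurableSet.measurableSet_limsup fun n => (hT.measurable.iterate n) hG
  have hinv : T ⁻¹' A = A := by
    ext ω
    simp only [hA, Set.mem_preimage, Set.mem_ofPred_eq, ← Function.iterate_succ_apply]
    conv_rhs => rw [← map_add_atTop_eq_nat 1, frequently_map]
  have hsub : ∀ᵐ ω ∂P, ω ∈ G → ω ∈ A :=
    hT.toMeasurePreserving.conservative.ae_mem_imp_frequently_image_mem hG.nullMeasurableSet
  rcases hT.toPreErgodic.ae_mem_or_ae_notMem hAm hinv with h | h
  · exact h
  · exfalso
    have : ∀ᵐ ω ∂P, ω ∉ G := by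
      filter_upwards [h, hsub] with ω h1 h2 h3 using h1 (h2 h3)
    exact hpos.ne' (by simpa [ae_iff] using this)

theorem integrable_birkhoffMax (hT : MeasurePreserving T P P) {g : Ω → ℝ} (hg : Integrable g P)
    (n : ℕ) : Integrable (birkhoffMax T g n) P := by
  induction n with
  | zero => exact integrable_zero _ _ _
  | succ n ih =>
    exact (integrable_zero Ω ℝ P).sup (hg.add (hT.integrable_comp_of_integrable ih))

/-- Divergence of the running maxima `M_n` is an invariant event. If it had full measure, `M_{n+1} -
M_n ∘ T = max(g, -M_n ∘ T)` would converge to `g`, dominated by `|g|`. Its integral equals that of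
`M_{n+1} - M_n ≥ 0`, which would force `∫ g ≥ 0`. -/
theorem Ergodic.ae_bddAbove_birkhoffMax [IsProbabilityMeasure P] (hT : Ergodic T P) {g : Ω → ℝ}
    (hgm : Measurable g) (hg : Integrable g P) (hneg : ∫ ω, g ω ∂P < 0) :
    ∀ᵐ ω ∂P, ∃ C, ∀ n, birkhoffMax T g n ω ≤ C := by
  have hmeas : ∀ n, Measurable (birkhoffMax T g n) := by
    intro n
    induction n with
    | zero => exact measurable_const
    | succ n ih => exact measurable_const.max (hgm.add (ih.comp hT.measurable))
  set A : Set Ω := {ω | Tendsto (fun n => birkhoffMax T g n ω) atTop atTop} with hA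
  have hmono : ∀ ω, Monotone fun n => birkhoffMax T g n ω := fun ω =>
    monotone_nat_of_le_succ fun n => birkhoffMax_le_succ g n ω
  have hiff : ∀ ω, ω ∈ A ↔ ∀ C : ℕ, ∃ n, (C : ℝ) ≤ birkhoffMax T g n ω := by
    intro ω
    constructor
    · intro h C
      exact (h.eventually_ge_atTop (C : ℝ)).exists
    · intro h
      refine tendsto_atTop_atTop_of_monotone (hmono ω) fun b => ?_
      obtain ⟨C, hC⟩ := exists_nat_ge b
      obtain ⟨n, hn⟩ := h C
      exact ⟨n, hC.trans hn⟩
  have hAm : MeasurableSet A := by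
    have : A = ⋂ C : ℕ, ⋃ n, {ω | (C : ℝ) ≤ birkhoffMax T g n ω} := by
      ext ω
      simp [hiff]
    rw [this]
    exact MeasurableSet.iInter fun C => MeasurableSet.iUnion fun n =>
      measurableSet_le measurable_const (hmeas n)
  have hinv : T ⁻¹' A = A := by
    ext ω
    simp only [Set.mem_preimage, hiff]
    constructor
    · intro h C
      obtain ⟨C', hC'⟩ := exists_nat_ge ((C : ℝ) - g ω)
      obtain ⟨n, hn⟩ := h C'
      exact ⟨n + 1, le_max_of_le_right (by linarith)⟩
    · intro h C
      -- `C'` is positive, so a running maximum that reaches it is attained neither at `n = 0` nor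
      -- by the entry `0`.
      obtain ⟨C', hC'⟩ := exists_nat_gt (max 0 ((C : ℝ) + g ω))
      obtain ⟨n, hn⟩ := h C'
      have h1 := lt_of_le_of_lt (le_max_left _ _) hC'
      have h2 := lt_of_le_of_lt (le_max_right _ _) hC'
      cases n with
      | zero => simp only [birkhoffMax] at hn; linarith
      | succ n =>
        rcases le_max_iff.1 hn with h3 | h3
        · linarith
        · exact ⟨n, by linarith⟩
  rcases hT.toPreErgodic.ae_mem_or_ae_notMem hAm hinv with h | h
  · exfalso
    have hTA : ∀ᵐ ω ∂P, T ω ∈ A := hT.toMeasurePreserving.quasiMeasurePreserving.ae h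
    have key : ∀ n, 0 ≤ ∫ ω, max (g ω) (-birkhoffMax T g n (T ω)) ∂P := by
      intro n
      have h1 : ∫ ω, max (g ω) (-birkhoffMax T g n (T ω)) ∂P
          = ∫ ω, birkhoffMax T g (n + 1) ω ∂P - ∫ ω, birkhoffMax T g n ω ∂P := by
        have h2 : ∫ ω, birkhoffMax T g n ω ∂P = ∫ ω, birkhoffMax T g n (T ω) ∂P := by
          conv_lhs => rw [← hT.toMeasurePreserving.map_eq]
          exact integral_map hT.measurable.aemeasurable (hmeas n).aestronglyMeasurable
        have h3 : Integrable (fun ω => birkhoffMax T g n (T ω)) P :=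
          hT.toMeasurePreserving.integrable_comp_of_integrable
            (integrable_birkhoffMax hT.toMeasurePreserving hg n)
        rw [h2, ← integral_sub (integrable_birkhoffMax hT.toMeasurePreserving hg _) h3]
        refine integral_congr_ae (Eventually.of_forall fun ω => ?_)
        simp only [birkhoffMax]
        rw [← max_sub_sub_right]
        rw [max_comm]
        congr 1 <;> simp
      rw [h1, sub_nonneg]
      exact integral_mono (integrable_birkhoffMax hT.toMeasurePreserving hg _)
        (integrable_birkhoffMax hT.toMeasurePreserving hg _) (birkhoffMax_le_succ g n)
    have hlim : Tendsto (fun n => ∫ ω, max (g ω) (-birkhoffMax T g n (T ω)) ∂P) atTop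
        (𝓝 (∫ ω, g ω ∂P)) := by
      refine tendsto_integral_of_dominated_convergence (fun ω => |g ω|)
        (fun n => (hgm.max ((hmeas n).comp hT.measurable).neg).aestronglyMeasurable)
        hg.abs (fun n => Eventually.of_forall fun ω => ?_) ?_
      · rw [Real.norm_eq_abs, abs_le]
        have := birkhoffMax_nonneg (T := T) g n (T ω)
        exact ⟨(neg_abs_le _).trans (le_max_left _ _),
          max_le (le_abs_self _) ((neg_nonpos.2 this).trans (abs_nonneg _))⟩
      · filter_upwards [hTA] with ω hω
        refine tendsto_const_nhds.congr' ?_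
        filter_upwards [hω.eventually_ge_atTop (-g ω)] with n hn
        rw [max_eq_left (by linarith)]
    exact absurd (ge_of_tendsto' hlim key) (not_le.2 hneg)
  · filter_upwards [h] with ω hω
    rw [hiff] at hω
    push Not at hω
    obtain ⟨C, hC⟩ := hω
    exact ⟨C, fun n => (hC n).le⟩

/-- For `∫ g < c' < c` the maxima of `g - c'` are bounded, so the Birkhoff sum is at most `n c' +
C`, and `n (c - c')` eventually absorbs `C`. -/
theorem Ergodic.ae_eventually_birkhoffSum_le [IsProbabilityMeasure P] (hT : Ergodic T P)
    {g : Ω → ℝ} (hgm : Measurable g) (hg : Integrable g P) {c : ℝ} (hc : ∫ ω, g ω ∂P < c) :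
    ∀ᵐ ω ∂P, ∀ᶠ n : ℕ in atTop, 1 / (n : ℝ) * birkhoffSum T g n ω ≤ c := by
  obtain ⟨c', h1, h2⟩ := exists_between hc
  have h3 : ∫ ω, (g ω - c') ∂P < 0 := by
    rw [integral_sub hg (integrable_const _)]
    simpa using h1
  filter_upwards [hT.ae_bddAbove_birkhoffMax (hgm.sub measurable_const)
    (hg.sub (integrable_const c')) h3] with ω ⟨C, hC⟩
  have h4 : ∀ n : ℕ, birkhoffSum T g n ω - n * c' ≤ C := by
    intro n
    refine le_trans (le_of_eq ?_) ((birkhoffSum_le_birkhoffMax _ n ω).trans (hC n))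
    simp [birkhoffSum, Finset.sum_sub_distrib]
  obtain ⟨N, hN⟩ := exists_nat_gt (C / (c - c'))
  filter_upwards [eventually_ge_atTop (max N 1)] with n hn
  have hn1 : (1 : ℝ) ≤ n := by exact_mod_cast (le_max_right _ _).trans hn
  have hnN : (N : ℝ) ≤ n := by exact_mod_cast (le_max_left _ _).trans hn
  have h5 : C ≤ n * (c - c') := by
    rw [div_lt_iff₀ (by linarith)] at hN
    nlinarith
  rw [one_div, inv_mul_le_iff₀ (by linarith)]
  linarith [h4 n]

theorem Ergodic.ae_tendsto_birkhoffSum_of_measurable [IsProbabilityMeasure P] (hT : Ergodic T P)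
    {g : Ω → ℝ} (hgm : Measurable g) (hg : Integrable g P) :
    ∀ᵐ ω ∂P, Tendsto (fun n : ℕ => 1 / (n : ℝ) * birkhoffSum T g n ω) atTop
      (𝓝 (∫ ω, g ω ∂P)) := by
  have h1 : ∀ᵐ ω ∂P, ∀ k : ℕ, ∀ᶠ n : ℕ in atTop,
      1 / (n : ℝ) * birkhoffSum T g n ω ≤ ∫ ω, g ω ∂P + 1 / ((k : ℝ) + 1) :=
    ae_all_iff.2 fun k => hT.ae_eventually_birkhoffSum_le hgm hg
      (lt_add_of_pos_right _ (by positivity))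
  have h2 : ∀ᵐ ω ∂P, ∀ k : ℕ, ∀ᶠ n : ℕ in atTop,
      1 / (n : ℝ) * birkhoffSum T (-g) n ω ≤ -∫ ω, g ω ∂P + 1 / ((k : ℝ) + 1) :=
    ae_all_iff.2 fun k => hT.ae_eventually_birkhoffSum_le hgm.neg hg.neg (by
      rw [Pi.neg_def, integral_neg]
      exact lt_add_of_pos_right _ (by positivity))
  filter_upwards [h1, h2] with ω h1 h2
  rw [Metric.tendsto_atTop']
  intro ε hε
  obtain ⟨k, hk⟩ := exists_nat_one_div_lt hε
  obtain ⟨N, hN⟩ := eventually_atTop.1 ((h1 k).and (h2 k))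
  refine ⟨N, fun n hn => ?_⟩
  obtain ⟨h3, h4⟩ := hN n hn.le
  have h5 : birkhoffSum T (-g) n ω = -birkhoffSum T g n ω := by
    simp [birkhoffSum]
  rw [h5, mul_neg] at h4
  rw [Real.dist_eq, abs_lt]
  constructor <;> linarith

/-- **Birkhoff's pointwise ergodic theorem** for ergodic transformations. -/
theorem Ergodic.ae_tendsto_birkhoffSum [IsProbabilityMeasure P] (hT : Ergodic T P)
    {g : Ω → ℝ} (hg : Integrable g P) :
    ∀ᵐ ω ∂P, Tendsto (fun n : ℕ => 1 / (n : ℝ) * birkhoffSum T g n ω) atTop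
      (𝓝 (∫ ω, g ω ∂P)) := by
  set g' := hg.1.mk g with hg'
  have hae : g =ᵐ[P] g' := hg.1.ae_eq_mk
  have h1 := hT.ae_tendsto_birkhoffSum_of_measurable hg.1.stronglyMeasurable_mk.measurable
    (hg.congr hae)
  have h2 : ∀ᵐ ω ∂P, ∀ n : ℕ, g (T^[n] ω) = g' (T^[n] ω) := ae_all_iff.2 fun n =>
    (hT.toMeasurePreserving.iterate n).quasiMeasurePreserving.ae hae
  filter_upwards [h1, h2] with ω h1 h2
  rw [integral_congr_ae hae]
  refine h1.congr fun n => ?_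
  congr 1
  exact Finset.sum_congr rfl fun k _ => (h2 k).symm

end Ergodic

/-! ### Gärtner–Ellis bounds for weights on finite sets -/

section GartnerEllis

variable {A : ℕ → Type*} [∀ n, Fintype (A n)]

open Classical in
/-- The mass of `{a | Y n a ∈ E}` under the weights `p n a * exp (t * n * Y n a)`. -/
noncomputable def tiltedMass (p Y : ∀ n, A n → ℝ) (n : ℕ) (t : ℝ) (E : Set ℝ) : ℝ :=
  ∑ a, if Y n a ∈ E then p n a * Real.exp (t * (n * Y n a)) else 0

variable {p Y : ∀ n, A n → ℝ}

theorem tiltedMass_mono (hp : ∀ n a, 0 ≤ p n a) (n : ℕ) (t : ℝ) {E F : Set ℝ}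
    (h : ∀ a, Y n a ∈ E → Y n a ∈ F) : tiltedMass p Y n t E ≤ tiltedMass p Y n t F := by
  refine Finset.sum_le_sum fun a _ => ?_
  have := mul_nonneg (hp n a) (Real.exp_pos (t * (n * Y n a))).le
  split_ifs with h1 h2 h2
  · exact le_rfl
  · exact absurd (h a h1) h2
  · exact this
  · exact le_rfl

theorem tiltedMass_union_le (hp : ∀ n a, 0 ≤ p n a) (n : ℕ) (t : ℝ) (E F : Set ℝ) :
    tiltedMass p Y n t (E ∪ F) ≤ tiltedMass p Y n t E + tiltedMass p Y n t F := by
  rw [tiltedMass, tiltedMass, tiltedMass, ← Finset.sum_add_distrib]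
  refine Finset.sum_le_sum fun a _ => ?_
  have := mul_nonneg (hp n a) (Real.exp_pos (t * (n * Y n a))).le
  by_cases h1 : Y n a ∈ E <;> by_cases h2 : Y n a ∈ F <;> simp [h1, h2, this]

/-- Exponential Chebyshev: on `E` the factor `exp (n (η y - c))` is at least one. -/
theorem tiltedMass_le_exp_mul (hp : ∀ n a, 0 ≤ p n a) (n : ℕ) (t η c : ℝ) {E : Set ℝ}
    (h : ∀ y ∈ E, c ≤ η * y) :
    tiltedMass p Y n t E ≤ Real.exp (-(n * c)) * tiltedMass p Y n (t + η) Set.univ := by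
  rw [tiltedMass, tiltedMass, Finset.mul_sum]
  refine Finset.sum_le_sum fun a _ => ?_
  have h0 := hp n a
  split_ifs with h1 h2 h2
  · rw [mul_left_comm (Real.exp _), ← Real.exp_add]
    refine mul_le_mul_of_nonneg_left (Real.exp_le_exp.2 ?_) h0
    have := mul_le_mul_of_nonneg_left (h _ h1) (Nat.cast_nonneg (α := ℝ) n)
    nlinarith
  · exact absurd (Set.mem_univ _) h2
  · positivity
  · exact absurd (Set.mem_univ _) h2

theorem eventually_exp_le_of_tendsto {u : ℕ → ℝ} (hu : ∀ n, 0 < u n) {l c : ℝ}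
    (h : Tendsto (fun n : ℕ => 1 / (n : ℝ) * Real.log (u n)) atTop (𝓝 l)) (hc : c < l) :
    ∀ᶠ n : ℕ in atTop, Real.exp (n * c) ≤ u n := by
  filter_upwards [h.eventually_const_le hc, eventually_gt_atTop 0] with n h1 h2
  have : (0 : ℝ) < n := by exact_mod_cast h2
  rw [one_div, ← div_eq_inv_mul, le_div_iff₀ this] at h1
  rw [← Real.le_log_iff_exp_le (hu n)]
  linarith

theorem eventually_le_exp_of_tendsto {u : ℕ → ℝ} (hu : ∀ n, 0 < u n) {l c : ℝ}
    (h : Tendsto (fun n : ℕ => 1 / (n : ℝ) * Real.log (u n)) atTop (𝓝 l)) (hc : l < c) :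
    ∀ᶠ n : ℕ in atTop, u n ≤ Real.exp (n * c) := by
  filter_upwards [h.eventually_le_const hc, eventually_gt_atTop 0] with n h1 h2
  have : (0 : ℝ) < n := by exact_mod_cast h2
  rw [one_div, ← div_eq_inv_mul, div_le_iff₀ this] at h1
  rw [← Real.log_le_iff_le_exp (hu n)]
  linarith

theorem eventually_mul_exp_le_exp (K : ℝ) {c c' : ℝ} (hc : c < c') :
    ∀ᶠ n : ℕ in atTop, K * Real.exp (n * c) ≤ Real.exp (n * c') := by
  have h : Tendsto (fun n : ℕ => Real.exp (n * (c' - c))) atTop atTop :=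
    Real.tendsto_exp_atTop.comp
      (tendsto_natCast_atTop_atTop.atTop_mul_const (sub_pos.2 hc))
  filter_upwards [h.eventually_ge_atTop K] with n hn
  calc K * Real.exp (n * c) ≤ Real.exp (n * (c' - c)) * Real.exp (n * c) :=
        mul_le_mul_of_nonneg_right hn (Real.exp_pos _).le
    _ = Real.exp (n * c') := by rw [← Real.exp_add]; ring_nf

variable {L L' : ℝ → ℝ}

/-- Upper bound of the Gärtner–Ellis theorem for bounded variables. -/
theorem eventually_tiltedMass_le (hp : ∀ n a, 0 ≤ p n a)
    (hpos : ∀ n t, 0 < tiltedMass p Y n t Set.univ)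
    (hL : ∀ t, Tendsto (fun n : ℕ => 1 / (n : ℝ) * Real.log (tiltedMass p Y n t Set.univ)) atTop
      (𝓝 (L t))) {C : ℝ} (hY : ∀ n, 0 < n → ∀ a, |Y n a| ≤ C) {E : Set ℝ} {x x' : ℝ} (hx : x' < x)
    (hE : ∀ s ∈ closure E, ∃ t, x < t * s - L t) :
    ∀ᶠ n : ℕ in atTop, tiltedMass p Y n 0 E ≤ Real.exp (-(n * x')) := by
  have hK : IsCompact (closure E ∩ Set.Icc (-C) C) :=
    isCompact_Icc.inter_left isClosed_closure
  -- The induction on the compact set carries all rates `x' < x`, because each union costs a factor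
  -- 2 that is paid for by lowering the rate.
  have key : ∀ x' < x, ∀ᶠ n : ℕ in atTop,
      tiltedMass p Y n 0 (closure E ∩ Set.Icc (-C) C) ≤ Real.exp (-(n * x')) := by
    refine hK.induction_on (p := fun S => ∀ x' < x, ∀ᶠ n : ℕ in atTop,
      tiltedMass p Y n 0 S ≤ Real.exp (-(n * x'))) ?_ ?_ ?_ ?_
    · intro x' _
      refine Eventually.of_forall fun n => ?_
      simp only [tiltedMass, Set.mem_empty_iff_false, if_false, Finset.sum_const_zero]
      exact (Real.exp_pos _).le
    · intro S T hST hT x' hx'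
      filter_upwards [hT x' hx'] with n hn
      exact (tiltedMass_mono hp n 0 fun a ha => hST ha).trans hn
    · intro S T hS hT x' hx'
      obtain ⟨x'', h1, h2⟩ := exists_between hx'
      filter_upwards [hS x'' h2, hT x'' h2,
        eventually_mul_exp_le_exp 2 (neg_lt_neg h1)] with n h3 h4 h5
      simp only [mul_neg] at h5
      linarith [tiltedMass_union_le (Y := Y) hp n 0 S T]
    · intro s hs
      obtain ⟨t, ht⟩ := hE s hs.1
      -- Near `s` the single tilt `t` already beats the rate `x`, so one use of Chebyshev covers
      -- this neighbourhood.
      refine ⟨{y | x < t * y - L t}, mem_nhdsWithin_of_mem_nhds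
        (IsOpen.mem_nhds (isOpen_lt continuous_const (by fun_prop)) ht), fun x' hx' => ?_⟩
      filter_upwards [eventually_le_exp_of_tendsto (fun n => hpos n t) (hL t)
        (show L t < L t + (x - x') by linarith)] with n hn
      refine (tiltedMass_le_exp_mul hp n 0 t (x + L t) (E := {y | x < t * y - L t}) ?_).trans ?_
      · intro y hy
        have : x < t * y - L t := hy
        linarith
      · rw [zero_add]
        refine (mul_le_mul_of_nonneg_left hn (Real.exp_pos _).le).trans ?_
        rw [← Real.exp_add]
        exact Real.exp_le_exp.2 (le_of_eq (by ring))
  filter_upwards [key x' hx, eventually_gt_atTop 0] with n hn h0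
  have hsub : ∀ a, Y n a ∈ E → Y n a ∈ closure E ∩ Set.Icc (-C) C := fun a ha =>
    ⟨subset_closure ha, abs_le.1 (hY n h0 a)⟩
  exact (tiltedMass_mono hp n 0 hsub).trans hn

/-- Maximise `u s - L u - δ u² / 2`. At the maximiser `L' t = s - δ t`. Comparison with `u = 0`
gives `δ t² / 2 ≤ x + L 0`, so `δ t` is small with `δ`, and the Legendre cost at slope `L' t` is
that at `s` lowered by `δ t²`. This handles slopes `s` that are not derivatives of `L`. -/
theorem exists_deriv_near_of_legendre_le (hd : ∀ t, HasDerivAt L (L' t) t) {s x ε : ℝ}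
    (hε : 0 < ε) (hs : ∀ t, t * s - L t ≤ x) :
    ∃ t, |L' t - s| < ε ∧ t * L' t - L t ≤ x := by
  have hx0 : 0 ≤ x + L 0 := by linarith [hs 0]
  -- Chosen because `(δ t)² ≤ 2 δ (x + L 0)` at the maximiser.
  obtain ⟨δ, hδ, hδε⟩ : ∃ δ > 0, 2 * δ * (x + L 0) < ε ^ 2 := by
    refine ⟨ε ^ 2 / (2 * (x + L 0) + 1) / 2, by positivity, ?_⟩
    have h1 : 0 < 2 * (x + L 0) + 1 := by linarith
    have : 2 * (ε ^ 2 / (2 * (x + L 0) + 1) / 2) * (x + L 0)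
        = ε ^ 2 * ((x + L 0) / (2 * (x + L 0) + 1)) := by ring
    rw [this]
    refine mul_lt_of_lt_one_right (by positivity) ?_
    rw [div_lt_one h1]
    linarith
  have hLc : Continuous L := continuous_iff_continuousAt.2 fun t => (hd t).continuousAt
  obtain ⟨t, ht⟩ : ∃ t, ∀ u, u * s - L u - δ * u ^ 2 / 2 ≤ t * s - L t - δ * t ^ 2 / 2 := by
    refine Continuous.exists_forall_ge (f := fun u => u * s - L u - δ * u ^ 2 / 2)
      (by fun_prop) ?_
    refine tendsto_atBot_mono (f := fun u => x - δ / 2 * |u| ^ 2) (fun u => ?_) ?_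
    · rw [sq_abs]
      linarith [hs u]
    · refine tendsto_atBot_add_const_left _ x (tendsto_neg_atTop_atBot.comp ?_)
      exact ((tendsto_pow_atTop two_ne_zero).comp
        (tendsto_norm_cocompact_atTop (E := ℝ))).const_mul_atTop (half_pos hδ)
  have hder : HasDerivAt (fun u => u * s - L u - δ * u ^ 2 / 2) (s - L' t - δ * t) t := by
    have := (((hasDerivAt_id t).mul_const s).sub (hd t)).sub
      ((((hasDerivAt_id t).pow 2).const_mul δ).div_const 2)
    refine this.congr_deriv ?_
    simp only [id, one_mul]
    norm_num
    ring
  have h0 : s - L' t - δ * t = 0 :=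
    IsLocalMax.hasDerivAt_eq_zero (Eventually.of_forall ht) hder
  have h1 := ht 0
  simp only [zero_mul, ne_eq, OfNat.ofNat_ne_zero, not_false_eq_true, zero_pow, mul_zero,
    zero_div] at h1
  have hL't : L' t = s - δ * t := by linarith
  refine ⟨t, ?_, ?_⟩
  · rw [hL't]
    refine abs_lt_of_sq_lt_sq ?_ hε.le
    have : δ * t ^ 2 / 2 ≤ x + L 0 := by linarith [hs t]
    nlinarith
  · rw [hL't]
    nlinarith [hs t, mul_nonneg hδ.le (sq_nonneg t)]

theorem exists_pos_lt_of_hasDerivAt {g : ℝ → ℝ} {g' t ε : ℝ} (hg : HasDerivAt g g' t)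
    (hε : 0 < ε) :
    ∃ η > 0, g (t + η) - g t - η * g' < η * ε ∧ g (t - η) - g t + η * g' < η * ε := by
  have h := (hasDerivAt_iff_isLittleO_nhds_zero.1 hg).def (half_pos hε)
  obtain ⟨r, hr, hr'⟩ := Metric.eventually_nhds_iff.1 h
  have h1 := hr' (y := r / 2) (by simp [abs_of_pos hr, hr])
  have h2 := hr' (y := -(r / 2)) (by simp [abs_of_pos hr, hr])
  simp only [Real.norm_eq_abs, smul_eq_mul, abs_neg, abs_of_pos (half_pos hr)] at h1 h2
  refine ⟨r / 2, half_pos hr, ?_, ?_⟩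
  · have := (le_abs_self _).trans h1
    nlinarith
  · have := (le_abs_self _).trans h2
    rw [sub_eq_add_neg t]
    nlinarith

/-- A further tilt by `η` bounds the rate of the mass of `E` by `L (t + η) - c < L t`, so it is
negligible against the total. With a quarter for each of the two tails, half of the mass stays in
the middle. -/
theorem eventually_tiltedMass_le_quarter (hp : ∀ n a, 0 ≤ p n a)
    (hpos : ∀ n t, 0 < tiltedMass p Y n t Set.univ)
    (hL : ∀ t, Tendsto (fun n : ℕ => 1 / (n : ℝ) * Real.log (tiltedMass p Y n t Set.univ)) atTop
      (𝓝 (L t))) {t η c : ℝ} (hc : L (t + η) - L t < c) {E : Set ℝ} (hE : ∀ y ∈ E, c ≤ η * y) :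
    ∀ᶠ n : ℕ in atTop, 4 * tiltedMass p Y n t E ≤ tiltedMass p Y n t Set.univ := by
  set e := (c - (L (t + η) - L t)) / 3 with he
  have he0 : 0 < e := by rw [he]; linarith
  filter_upwards [eventually_le_exp_of_tendsto (fun n => hpos n (t + η)) (hL (t + η))
    (lt_add_of_pos_right _ he0), eventually_exp_le_of_tendsto (fun n => hpos n t) (hL t)
    (sub_lt_self _ he0), eventually_mul_exp_le_exp 4
    (show -c + (L (t + η) + e) < L t - e by linarith)] with n h1 h2 h3
  have h4 := tiltedMass_le_exp_mul (Y := Y) hp n t η c hE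
  have h5 := mul_le_mul_of_nonneg_left h1 (Real.exp_pos (-(n * c))).le
  rw [← Real.exp_add] at h5
  have h6 : -(n * c) + n * (L (t + η) + e) = n * (-c + (L (t + η) + e)) := by ring
  rw [h6] at h5
  linarith

/-- Lower bound of the Gärtner–Ellis theorem for a differentiable limit. -/
theorem eventually_le_tiltedMass (hp : ∀ n a, 0 ≤ p n a)
    (hpos : ∀ n t, 0 < tiltedMass p Y n t Set.univ)
    (hL : ∀ t, Tendsto (fun n : ℕ => 1 / (n : ℝ) * Real.log (tiltedMass p Y n t Set.univ)) atTop
      (𝓝 (L t))) (hd : ∀ t, HasDerivAt L (L' t) t) {E : Set ℝ} {s x x' : ℝ} (hx : x < x')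
    (hsE : s ∈ interior E) (hs : ∀ t, t * s - L t ≤ x) :
    ∀ᶠ n : ℕ in atTop, Real.exp (-(n * x')) ≤ tiltedMass p Y n 0 E := by
  obtain ⟨r, hr, hrE⟩ := Metric.mem_nhds_iff.1 (mem_interior_iff_mem_nhds.1 hsE)
  obtain ⟨t, ht1, ht2⟩ := exists_deriv_near_of_legendre_le hd (half_pos hr) hs
  -- One third of the slack pays for removing the tilt, one third for the total mass, and the rest
  -- absorbs the factor 2.
  set e := (x' - x) / 3 with he
  have he0 : 0 < e := by rw [he]; linarith
  obtain ⟨ε, hε, hεr, hεt⟩ : ∃ ε > 0, ε ≤ r / 2 ∧ |t| * ε ≤ e := by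
    refine ⟨min (r / 2) (e / (|t| + 1)), by positivity, min_le_left _ _, ?_⟩
    refine (mul_le_mul_of_nonneg_left (min_le_right _ _) (abs_nonneg t)).trans ?_
    rw [mul_div_assoc', div_le_iff₀ (by positivity)]
    nlinarith [abs_nonneg t]
  obtain ⟨η, hη, h1, h2⟩ := exists_pos_lt_of_hasDerivAt (hd t) hε
  -- Under the tilt `t` the mass concentrates at the slope `L' t`: both tails beyond distance `ε`
  -- are negligible by differentiability.
  have hup := eventually_tiltedMass_le_quarter (Y := Y) hp hpos hL (t := t) (η := η)
    (c := η * (L' t + ε)) (E := Set.Ici (L' t + ε)) (by linarith)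
    fun y hy => mul_le_mul_of_nonneg_left hy hη.le
  have hlo := eventually_tiltedMass_le_quarter (Y := Y) hp hpos hL (t := t) (η := -η)
    (c := -η * (L' t - ε)) (E := Set.Iic (L' t - ε))
    (by rw [← sub_eq_add_neg]; linarith)
    fun y hy => mul_le_mul_of_nonpos_left hy (neg_nonpos.2 hη.le)
  filter_upwards [hup, hlo, eventually_exp_le_of_tendsto (fun n => hpos n t) (hL t)
    (sub_lt_self _ he0), eventually_mul_exp_le_exp 2
    (show -x' < -(t * L' t + |t| * ε) + (L t - e) by linarith)] with n h3 h4 h5 h6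
  have h7 : tiltedMass p Y n t Set.univ ≤ tiltedMass p Y n t (Set.Ioo (L' t - ε) (L' t + ε))
      + tiltedMass p Y n t (Set.Ici (L' t + ε)) + tiltedMass p Y n t (Set.Iic (L' t - ε)) := by
    refine le_trans ?_ ((tiltedMass_union_le hp n t _ _).trans
      (add_le_add (tiltedMass_union_le hp n t _ _) le_rfl))
    refine tiltedMass_mono hp n t fun a _ => ?_
    by_cases h8 : Y n a ≤ L' t - ε
    · exact Or.inr h8
    · by_cases h9 : L' t + ε ≤ Y n a
      · exact Or.inl (Or.inr h9)
      · exact Or.inl (Or.inl ⟨not_le.1 h8, not_le.1 h9⟩)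
  -- On the window, which lies in `E`, removing the tilt costs at most `exp (n (t L' t + |t| ε))`.
  have h8 : tiltedMass p Y n t (Set.Ioo (L' t - ε) (L' t + ε))
      ≤ Real.exp (n * (t * L' t + |t| * ε)) * tiltedMass p Y n 0 E := by
    rw [tiltedMass, tiltedMass, Finset.mul_sum]
    refine Finset.sum_le_sum fun a _ => ?_
    have h0 := hp n a
    by_cases h9 : Y n a ∈ Set.Ioo (L' t - ε) (L' t + ε)
    · have h10 : Y n a ∈ E := by
        refine hrE ?_
        rw [Metric.mem_ball, Real.dist_eq, abs_lt]
        have := abs_lt.1 ht1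
        constructor <;> linarith [h9.1, h9.2]
      rw [if_pos h9, if_pos h10, zero_mul, Real.exp_zero, mul_one, mul_comm]
      refine mul_le_mul_of_nonneg_right (Real.exp_le_exp.2 ?_) h0
      have h11 : t * (Y n a - L' t) ≤ |t| * ε := by
        refine (le_abs_self _).trans ?_
        rw [abs_mul]
        refine mul_le_mul_of_nonneg_left (abs_le.2 ⟨?_, ?_⟩) (abs_nonneg t) <;>
          linarith [h9.1, h9.2]
      have := mul_le_mul_of_nonneg_left h11 (Nat.cast_nonneg (α := ℝ) n)
      nlinarith
    · rw [if_neg h9]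
      split_ifs
      · positivity
      · simp
  have h9 : Real.exp (n * (L t - e)) ≤
      2 * (Real.exp (n * (t * L' t + |t| * ε)) * tiltedMass p Y n 0 E) := by linarith
  have h10 : Real.exp (n * (-(t * L' t + |t| * ε) + (L t - e)))
      = Real.exp (-(n * (t * L' t + |t| * ε))) * Real.exp (n * (L t - e)) := by
    rw [← Real.exp_add]
    ring_nf
  have h11 := mul_le_mul_of_nonneg_left h9 (Real.exp_pos (-(n * (t * L' t + |t| * ε)))).le
  rw [← h10] at h11
  have h12 : Real.exp (-(n * (t * L' t + |t| * ε))) * (2 * (Real.exp (n * (t * L' t + |t| * ε))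
      * tiltedMass p Y n 0 E)) = 2 * tiltedMass p Y n 0 E := by
    have : Real.exp (-(n * (t * L' t + |t| * ε))) * Real.exp (n * (t * L' t + |t| * ε)) = 1 := by
      rw [← Real.exp_add]
      simp
    linear_combination (2 * tiltedMass p Y n 0 E) * this
  rw [h12] at h11
  rw [← mul_neg]
  linarith

end GartnerEllis

/-! ### The positive semidefinite order and the real trace pairing -/

open scoped MatrixOrder

namespace QMP

variable {d : ℕ}

/-- The real part of the trace. -/
noncomputable def reTrace (X : Op d) : ℝ := X.trace.re

/-- The real pairing `Re tr (Y X)`. -/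
noncomputable def pair (Y X : Op d) : ℝ := (Y * X).trace.re

@[simp] theorem reTrace_add (X Y : Op d) : reTrace (X + Y) = reTrace X + reTrace Y := by
  simp [reTrace]

@[simp] theorem reTrace_sub (X Y : Op d) : reTrace (X - Y) = reTrace X - reTrace Y := by
  simp [reTrace]

@[simp] theorem reTrace_smul (c : ℝ) (X : Op d) : reTrace (c • X) = c * reTrace X := by
  simp [reTrace]

@[simp] theorem reTrace_zero : reTrace (0 : Op d) = 0 := by simp [reTrace]

@[simp] theorem reTrace_one : reTrace (1 : Op d) = d := by simp [reTrace]

theorem reTrace_sum {ι : Type*} (s : Finset ι) (X : ι → Op d) :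
    reTrace (∑ i ∈ s, X i) = ∑ i ∈ s, reTrace (X i) := by
  simp [reTrace, Matrix.trace_sum]

@[simp] theorem pair_add (Y X X' : Op d) : pair Y (X + X') = pair Y X + pair Y X' := by
  simp [pair, Matrix.mul_add]

@[simp] theorem pair_sub (Y X X' : Op d) : pair Y (X - X') = pair Y X - pair Y X' := by
  simp [pair, Matrix.mul_sub]

@[simp] theorem pair_smul (c : ℝ) (Y X : Op d) : pair Y (c • X) = c * pair Y X := by
  simp [pair]

theorem pair_sum {ι : Type*} (s : Finset ι) (Y : Op d) (X : ι → Op d) :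
    pair Y (∑ i ∈ s, X i) = ∑ i ∈ s, pair Y (X i) := by
  simp [pair, Matrix.mul_sum, Matrix.trace_sum]

theorem pair_comm (Y X : Op d) : pair Y X = pair X Y := by
  rw [pair, pair, Matrix.trace_mul_comm]

@[simp] theorem pair_one_right (Y : Op d) : pair Y 1 = reTrace Y := by simp [pair, reTrace]

@[simp] theorem pair_one_left (Y : Op d) : pair 1 Y = reTrace Y := by simp [pair, reTrace]

@[simp] theorem smul_pair (c : ℝ) (Y X : Op d) : pair (c • Y) X = c * pair Y X := by
  rw [pair_comm, pair_smul, pair_comm]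

theorem posSemidef_of_nonneg {X : Op d} (hX : 0 ≤ X) : X.PosSemidef :=
  Matrix.nonneg_iff_posSemidef.1 hX

theorem exists_isHermitian_mul_self {X : Op d} (hX : 0 ≤ X) :
    ∃ B : Op d, B.IsHermitian ∧ B * B = X :=
  ⟨CFC.sqrt X, (posSemidef_of_nonneg (CFC.sqrt_nonneg X)).isHermitian, CFC.sqrt_mul_sqrt_self X hX⟩

/-- With `Y = B²` and `B` Hermitian, `tr (Y X) = tr (B X B)`. -/
theorem pair_nonneg {X Y : Op d} (hY : 0 ≤ Y) (hX : 0 ≤ X) : 0 ≤ pair Y X := by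
  obtain ⟨B, hB, rfl⟩ := exists_isHermitian_mul_self hY
  rw [pair, Matrix.mul_assoc, Matrix.trace_mul_comm]
  have h := ((posSemidef_of_nonneg hX).mul_mul_conjTranspose_same B).trace_nonneg
  rw [hB.eq] at h
  exact (Complex.nonneg_iff.1 h).1

theorem reTrace_nonneg {X : Op d} (hX : 0 ≤ X) : 0 ≤ reTrace X :=
  (Complex.nonneg_iff.1 (posSemidef_of_nonneg hX).trace_nonneg).1

theorem trace_eq_reTrace {X : Op d} (hX : 0 ≤ X) : X.trace = (reTrace X : ℂ) := by
  apply Complex.ext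
  · simp [reTrace]
  · simpa using (Complex.nonneg_iff.1 (posSemidef_of_nonneg hX).trace_nonneg).2.symm

theorem reTrace_pos {X : Op d} (hX : 0 ≤ X) (h0 : X ≠ 0) : 0 < reTrace X := by
  refine lt_of_le_of_ne (reTrace_nonneg hX) fun h => h0 ?_
  rw [← (posSemidef_of_nonneg hX).trace_eq_zero_iff, trace_eq_reTrace hX, ← h]
  simp

theorem reTrace_mono {X Y : Op d} (h : X ≤ Y) : reTrace X ≤ reTrace Y := by
  have := reTrace_nonneg (sub_nonneg.2 h)
  rw [reTrace_sub] at this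
  linarith

theorem pair_mono {X X' Y : Op d} (hY : 0 ≤ Y) (h : X ≤ X') : pair Y X ≤ pair Y X' := by
  have := pair_nonneg hY (sub_nonneg.2 h)
  rw [pair_sub] at this
  linarith

theorem mem_densityMatrices {X : Op d} : X ∈ densityMatrices d ↔ 0 ≤ X ∧ reTrace X = 1 := by
  rw [densityMatrices, Set.mem_ofPred_eq, Matrix.nonneg_iff_posSemidef]
  constructor
  · rintro ⟨h1, h2⟩
    exact ⟨h1, by simp [reTrace, h2]⟩
  · rintro ⟨h1, h2⟩
    exact ⟨h1, by rw [trace_eq_reTrace h1.nonneg, h2]; simp⟩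

theorem ne_zero_of_mem_densityMatrices {X : Op d} (hX : X ∈ densityMatrices d) : X ≠ 0 := by
  rintro rfl
  have := (mem_densityMatrices.1 hX).2
  simp at this

theorem inv_reTrace_smul_mem {X : Op d} (hX : 0 ≤ X) (h0 : X ≠ 0) :
    (reTrace X)⁻¹ • X ∈ densityMatrices d := by
  have := reTrace_pos hX h0
  exact mem_densityMatrices.2 ⟨smul_nonneg (inv_nonneg.2 this.le) hX, by
    rw [reTrace_smul, inv_mul_cancel₀ this.ne']⟩

theorem one_nonneg' : (0 : Op d) ≤ 1 := Matrix.PosSemidef.one.nonneg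

/-- The eigenvalues are nonnegative and sum to the trace, so each is at most the trace. -/
theorem le_reTrace_smul_one {X : Op d} (hX : 0 ≤ X) : X ≤ reTrace X • (1 : Op d) := by
  have hH := (posSemidef_of_nonneg hX).isHermitian
  rw [← Algebra.algebraMap_eq_smul_one, le_algebraMap_iff_spectrum_le (a := X) hH.isSelfAdjoint,
    hH.spectrum_real_eq_range_eigenvalues]
  rintro _ ⟨i, rfl⟩
  have h : reTrace X = ∑ i, hH.eigenvalues i := by
    rw [reTrace, hH.trace_eq_sum_eigenvalues]
    simp
  rw [h]
  exact Finset.single_le_sum (f := hH.eigenvalues)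
    (fun j _ => (posSemidef_of_nonneg hX).eigenvalues_nonneg j) (Finset.mem_univ i)

theorem exists_smul_one_le {M : Op d} (hM : M.PosDef) : ∃ ε : ℝ, 0 < ε ∧ ε • (1 : Op d) ≤ M := by
  have hH := hM.isHermitian
  have key : ∃ ε : ℝ, 0 < ε ∧ ∀ i, ε ≤ hH.eigenvalues i := by
    rcases isEmpty_or_nonempty (Fin d) with h | h
    · exact ⟨1, one_pos, fun i => h.elim i⟩
    · obtain ⟨i, hi⟩ := Finite.exists_min hH.eigenvalues
      exact ⟨_, hM.eigenvalues_pos i, hi⟩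
  obtain ⟨ε, hε, h⟩ := key
  refine ⟨ε, hε, ?_⟩
  rw [← Algebra.algebraMap_eq_smul_one, algebraMap_le_iff_le_spectrum (a := M) hH.isSelfAdjoint,
    hH.spectrum_real_eq_range_eigenvalues]
  rintro _ ⟨i, rfl⟩
  exact h i

theorem pair_pos {M Y : Op d} (hM : M.PosDef) (hY : 0 ≤ Y) (h0 : Y ≠ 0) : 0 < pair Y M := by
  obtain ⟨ε, hε, h⟩ := exists_smul_one_le hM
  have := pair_mono hY h
  rw [pair_smul, pair_one_right] at this
  exact lt_of_lt_of_le (mul_pos hε (reTrace_pos hY h0)) this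

theorem reTrace_conjTranspose_mul_self (X : Op d) :
    reTrace (Xᴴ * X) = ∑ j, ∑ i, ‖X i j‖ ^ 2 := by
  simp [reTrace, Matrix.trace, Matrix.mul_apply, ← Complex.normSq_eq_norm_sq, Complex.normSq_apply]

theorem norm_apply_sq_le (X : Op d) (i j : Fin d) : ‖X i j‖ ^ 2 ≤ reTrace (Xᴴ * X) := by
  rw [reTrace_conjTranspose_mul_self]
  refine le_trans ?_ (Finset.single_le_sum (f := fun j => ∑ i, ‖X i j‖ ^ 2)
    (fun j _ => Finset.sum_nonneg fun i _ => sq_nonneg _) (Finset.mem_univ j))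
  exact Finset.single_le_sum (f := fun i => ‖X i j‖ ^ 2) (fun i _ => sq_nonneg _)
    (Finset.mem_univ i)

theorem reTrace_conjTranspose_mul_self_le {X : Op d} (hX : 0 ≤ X) :
    reTrace (Xᴴ * X) ≤ reTrace X ^ 2 := by
  have h := pair_mono hX (le_reTrace_smul_one hX)
  rw [(posSemidef_of_nonneg hX).isHermitian.eq, sq]
  simpa [pair, reTrace] using h

theorem norm_apply_le {X : Op d} (hX : 0 ≤ X) (i j : Fin d) : ‖X i j‖ ≤ reTrace X :=
  (sq_le_sq₀ (norm_nonneg _) (reTrace_nonneg hX)).1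
    ((norm_apply_sq_le X i j).trans (reTrace_conjTranspose_mul_self_le hX))

/-- Over `ℂ` a real quadratic form forces Hermitian symmetry, so none is assumed. This serves to
show that the adjoint of a positive map is positive. -/
theorem posSemidef_of_quadraticForm_nonneg {M : Op d} (h : ∀ x, 0 ≤ star x ⬝ᵥ (M *ᵥ x)) :
    M.PosSemidef := by
  rw [← Matrix.isPositive_toEuclideanLin_iff, LinearMap.isPositive_iff_complex]
  intro x
  have h1 := h x.ofLp
  have h2 : inner ℂ (Matrix.toEuclideanLin M x) x = star (star x.ofLp ⬝ᵥ (M *ᵥ x.ofLp)) := by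
    rw [← inner_conj_symm]
    simp [EuclideanSpace.inner_eq_star_dotProduct, dotProduct_comm]
  rw [Complex.nonneg_iff] at h1
  rw [h2]
  refine ⟨?_, by simpa using h1.1⟩
  apply Complex.ext
  · simp
  · simpa using h1.2.symm

theorem trace_vecMulVec_mul (x : Fin d → ℂ) (M : Op d) :
    (Matrix.vecMulVec x (star x) * M).trace = star x ⬝ᵥ (M *ᵥ x) := by
  rw [Matrix.trace_mul_comm, Matrix.mul_vecMulVec, Matrix.trace_vecMulVec, dotProduct_comm]

/-- The positive cone is self-dual: testing against the rank-one matrices `x xᴴ` recovers the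
quadratic form. -/
theorem le_of_pair_le {X X' : Op d} (hX : X.IsHermitian) (hX' : X'.IsHermitian)
    (h : ∀ Y, 0 ≤ Y → pair Y X ≤ pair Y X') : X ≤ X' := by
  have hH : (X' - X).IsHermitian := hX'.sub hX
  rw [Matrix.le_iff]
  refine Matrix.PosSemidef.of_dotProduct_mulVec_nonneg hH fun x => ?_
  have h1 := h _ (Matrix.posSemidef_vecMulVec_self_star x).nonneg
  rw [← sub_nonneg, ← pair_sub, pair, trace_vecMulVec_mul] at h1
  rw [Complex.nonneg_iff]
  refine ⟨h1, ?_⟩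
  have := hH.im_star_dotProduct_mulVec_self x
  simpa using this.symm

theorem isClosed_densityMatrices : IsClosed (densityMatrices d) := by
  have : densityMatrices d = {X | Xᴴ = X} ∩ (⋂ x, {X | 0 ≤ (star x ⬝ᵥ (X *ᵥ x)).re})
      ∩ {X | X.trace = 1} := by
    ext X
    simp only [densityMatrices, Set.mem_ofPred_eq, Set.mem_inter_iff, Set.mem_iInter,
      Matrix.posSemidef_iff_dotProduct_mulVec]
    refine and_congr_left fun _ => and_congr_right fun hH => forall_congr' fun x => ?_
    rw [Complex.nonneg_iff]
    have := Matrix.IsHermitian.im_star_dotProduct_mulVec_self (A := X) hH x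
    simp only [RCLike.im_to_complex] at this
    simp [this]
  rw [this]
  refine ((isClosed_eq (by fun_prop) continuous_id).inter
    (isClosed_iInter fun x => isClosed_le continuous_const ?_)).inter
    (isClosed_eq (by fun_prop) continuous_const)
  exact Complex.continuous_re.comp
    (continuous_const.dotProduct (continuous_id.matrix_mulVec continuous_const))

theorem isCompact_densityMatrices : IsCompact (densityMatrices d) := by
  refine IsCompact.of_isClosed_subset
    ((isCompact_closedBall (0 : ℂ) 1).matrix (m := Fin d) (n := Fin d))
    isClosed_densityMatrices fun X hX => ?_
  rw [mem_densityMatrices] at hX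
  intro i j
  simpa [hX.2] using norm_apply_le hX.1 i j

theorem continuous_pair : Continuous fun q : Op d × Op d => pair q.1 q.2 :=
  Complex.continuous_re.comp (Continuous.matrix_trace (continuous_fst.matrix_mul continuous_snd))

/-- Positivity of a linear map on matrices. -/
def IsPos (A : SuperOp d) : Prop := ∀ X, 0 ≤ X → 0 ≤ A X

theorem IsPos.mono {A : SuperOp d} (hA : IsPos A) {X Y : Op d} (h : X ≤ Y) : A X ≤ A Y := by
  have := hA _ (sub_nonneg.2 h)
  rwa [map_sub, sub_nonneg] at this

theorem IsPos.comp {A B : SuperOp d} (hA : IsPos A) (hB : IsPos B) : IsPos (A ∘ₗ B) :=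
  fun X hX => hA _ (hB X hX)

theorem isPos_id : IsPos (LinearMap.id : SuperOp d) := fun _ hX => hX

theorem IsPos.sum {ι : Type*} (s : Finset ι) {A : ι → SuperOp d} (h : ∀ i, IsPos (A i)) :
    IsPos (∑ i ∈ s, A i) := fun X hX => by
  rw [LinearMap.sum_apply]
  exact Finset.sum_nonneg fun i _ => h i X hX

theorem map_real_smul (A : SuperOp d) (c : ℝ) (X : Op d) : A (c • X) = c • A X :=
  LinearMap.map_smul_of_tower A c X

theorem IsCompletelyPositive.isPos {A : SuperOp d} (hA : IsCompletelyPositive A) : IsPos A := by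
  intro X hX
  have h := hA 1 (X ⊗ₖ 1) ((posSemidef_of_nonneg hX).kronecker Matrix.PosSemidef.one)
  rw [ampliation_kronecker] at h
  have h2 := h.submatrix (fun i : Fin d => (i, (0 : Fin 1)))
  rw [Matrix.nonneg_iff_posSemidef]
  have h3 : (A X ⊗ₖ (1 : Matrix (Fin 1) (Fin 1) ℂ)).submatrix (fun i : Fin d => (i, (0 : Fin 1)))
      (fun i : Fin d => (i, (0 : Fin 1))) = A X := by
    ext i j
    simp
  rwa [h3] at h2

theorem IsPos.hsAdjoint {A : SuperOp d} (hA : IsPos A) : IsPos (hsAdjoint A) := by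
  intro Y hY
  refine (posSemidef_of_quadraticForm_nonneg fun x => ?_).nonneg
  rw [← trace_vecMulVec_mul]
  have hx := Matrix.posSemidef_vecMulVec_self_star x
  have h := trace_conjTranspose_mul_hsAdjoint A (Matrix.vecMulVec x (star x)) Y
  rw [hx.isHermitian.eq, (posSemidef_of_nonneg (hA _ hx.nonneg)).isHermitian.eq] at h
  rw [h]
  obtain ⟨B, hB, h2⟩ := exists_isHermitian_mul_self hY
  rw [← h2, ← Matrix.mul_assoc, Matrix.trace_mul_comm, ← Matrix.mul_assoc]
  have h3 := ((posSemidef_of_nonneg (hA _ hx.nonneg)).mul_mul_conjTranspose_same B).trace_nonneg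
  rwa [hB.eq] at h3

theorem pair_hsAdjoint {A : SuperOp d} (hA : IsPos A) {X : Op d} (hX : 0 ≤ X) (Y : Op d) :
    pair X (hsAdjoint A Y) = pair Y (A X) := by
  have h := trace_conjTranspose_mul_hsAdjoint A X Y
  rw [(posSemidef_of_nonneg hX).isHermitian.eq,
    (posSemidef_of_nonneg (hA X hX)).isHermitian.eq] at h
  rw [pair, h, pair_comm Y, pair]

end QMP

/-! ### Contraction by uniformly positive maps and limit directions -/

namespace QMP

variable {d : ℕ}

/-- `Y` and `X` are proportional up to a relative error `δ` in the positive semidefinite order. -/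
def Near (δ : ℝ) (X Y : Op d) : Prop :=
  ∃ m : ℝ, 0 < m ∧ m • Y ≤ X ∧ X ≤ (m * (1 + δ)) • Y

/-- Two-sided comparison of a positive map with the map `X ↦ (tr X) 1`. -/
def PairBounds (A : SuperOp d) (a b : ℝ) : Prop :=
  ∀ X Y : Op d, 0 ≤ X → 0 ≤ Y →
    a * reTrace X * reTrace Y ≤ pair Y (A X) ∧ pair Y (A X) ≤ b * reTrace X * reTrace Y

/-- A positive map that does not kill nonzero positive semidefinite matrices. -/
structure IsNondegenerate (A : SuperOp d) : Prop where
  pos : IsPos A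
  ne_zero : ∀ X, 0 ≤ X → X ≠ 0 → A X ≠ 0

theorem isHermitian_of_nonneg {X : Op d} (hX : 0 ≤ X) : X.IsHermitian :=
  (posSemidef_of_nonneg hX).isHermitian

theorem isHermitian_smul_one (c : ℝ) : (c • (1 : Op d)).IsHermitian := by
  rw [Matrix.IsHermitian, Matrix.conjTranspose_smul]
  simp

theorem PairBounds.le {A : SuperOp d} {a b : ℝ} (h : PairBounds A a b) (hA : IsPos A) {X : Op d}
    (hX : 0 ≤ X) : (a * reTrace X) • (1 : Op d) ≤ A X ∧ A X ≤ (b * reTrace X) • (1 : Op d) := by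
  have hH := isHermitian_of_nonneg (hA X hX)
  constructor
  · refine le_of_pair_le (isHermitian_smul_one _) hH fun Y hY => ?_
    simpa using (h X Y hX hY).1
  · refine le_of_pair_le hH (isHermitian_smul_one _) fun Y hY => ?_
    simpa using (h X Y hX hY).2

theorem PairBounds.hsAdjoint {A : SuperOp d} {a b : ℝ} (h : PairBounds A a b) (hA : IsPos A) :
    PairBounds (hsAdjoint A) a b := by
  intro X Y hX hY
  rw [pair_hsAdjoint hA hY]
  have := h Y X hY hX
  constructor <;> linarith [this.1, this.2]

theorem Near.mono {δ δ' : ℝ} {X Y : Op d} (h : Near δ X Y) (hY : 0 ≤ Y) (hδ : δ ≤ δ') :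
    Near δ' X Y := by
  obtain ⟨m, hm, h1, h2⟩ := h
  exact ⟨m, hm, h1, h2.trans (smul_le_smul_of_nonneg_right
    (mul_le_mul_of_nonneg_left (by linarith) hm.le) hY)⟩

theorem Near.map {δ : ℝ} {X Y : Op d} (h : Near δ X Y) {A : SuperOp d} (hA : IsPos A) :
    Near δ (A X) (A Y) := by
  obtain ⟨m, hm, h1, h2⟩ := h
  refine ⟨m, hm, ?_, ?_⟩
  · simpa only [map_real_smul] using hA.mono h1
  · simpa only [map_real_smul] using hA.mono h2

theorem Near.smul {δ : ℝ} {X Y : Op d} (h : Near δ X Y) {c c' : ℝ} (hc : 0 < c) (hc' : 0 < c') :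
    Near δ (c • X) (c' • Y) := by
  obtain ⟨m, hm, h1, h2⟩ := h
  refine ⟨c * m / c', by positivity, ?_, ?_⟩
  · have := smul_le_smul_of_nonneg_left h1 hc.le
    rw [smul_smul] at this ⊢
    rwa [div_mul_cancel₀ _ hc'.ne']
  · have := smul_le_smul_of_nonneg_left h2 hc.le
    rw [smul_smul] at this ⊢
    convert this using 2
    field_simp

/-- A Birkhoff–Hopf type contraction. The gaps `X - m Y` and `m (1 + δ) Y - X` are positive
semidefinite, and the image of any such `D` dominates `(a / b) (tr D / tr Y) A Y`. Both bounds on `A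
X` therefore move inwards. The traces of the two gaps add up to `m δ tr Y`, so the width shrinks by
the factor `1 - a / b`, while the lower coefficient does not decrease. -/
theorem Near.map_pairBounds {δ a b : ℝ} {X Y : Op d} (h : Near δ X Y) (hδ : 0 ≤ δ) (hY : 0 ≤ Y)
    (hY0 : Y ≠ 0) {A : SuperOp d} (hA : IsPos A) (hab : PairBounds A a b) (ha : 0 < a)
    (hle : a ≤ b) : Near ((1 - a / b) * δ) (A X) (A Y) := by
  obtain ⟨m, hm, h1, h2⟩ := h
  have hb : 0 < b := ha.trans_le hle
  have htY := reTrace_pos hY hY0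
  set r := reTrace X / reTrace Y with hr
  have hrX : reTrace X = r * reTrace Y := by rw [hr, div_mul_cancel₀ _ htY.ne']
  have hAY : 0 ≤ A Y := hA Y hY
  have key : ∀ D : Op d, 0 ≤ D → (a / b * (reTrace D / reTrace Y)) • A Y ≤ A D := by
    intro D hD
    refine le_trans ?_ (hab.le hA hD).1
    have := smul_le_smul_of_nonneg_left (hab.le hA hY).2
      (show 0 ≤ a / b * (reTrace D / reTrace Y) by
        have := reTrace_nonneg hD
        positivity)
    refine this.trans (le_of_eq ?_)
    rw [smul_smul]
    congr 1
    field_simp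
  have hmr : m ≤ r := by
    have := reTrace_mono h1
    rw [reTrace_smul, hrX] at this
    exact le_of_mul_le_mul_right this htY
  have hd1 : reTrace (X - m • Y) / reTrace Y = r - m := by
    rw [reTrace_sub, reTrace_smul, hrX]
    field_simp
  have hd2 : reTrace ((m * (1 + δ)) • Y - X) / reTrace Y = m * (1 + δ) - r := by
    rw [reTrace_sub, reTrace_smul, hrX]
    field_simp
  have k1 := key _ (sub_nonneg.2 h1)
  have k2 := key _ (sub_nonneg.2 h2)
  rw [hd1, map_sub, map_real_smul, le_sub_iff_add_le, ← add_smul] at k1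
  rw [hd2, map_sub, map_real_smul, le_sub_comm, ← sub_smul] at k2
  have hab0 : 0 < a / b := by positivity
  have hab1 : a / b ≤ 1 := (div_le_one hb).2 hle
  refine ⟨a / b * (r - m) + m, by nlinarith, k1, k2.trans
    (smul_le_smul_of_nonneg_right ?_ hAY)⟩
  have h3 : 0 ≤ a / b * (r - m) * ((1 - a / b) * δ) :=
    mul_nonneg (mul_nonneg hab0.le (by linarith)) (mul_nonneg (by linarith) hδ)
  nlinarith

/-- Both images lie between multiples of `1` with ratio `b / a`, hence the square. This gives a
finite initial width for arbitrary inputs. -/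
theorem near_of_pairBounds {a b : ℝ} {X Y : Op d} (hX : 0 ≤ X) (hX0 : X ≠ 0) (hY : 0 ≤ Y)
    (hY0 : Y ≠ 0) {A : SuperOp d} (hA : IsPos A) (hab : PairBounds A a b) (ha : 0 < a)
    (hb : 0 < b) : Near ((b / a) ^ 2 - 1) (A X) (A Y) := by
  have htX := reTrace_pos hX hX0
  have htY := reTrace_pos hY hY0
  obtain ⟨x1, x2⟩ := hab.le hA hX
  obtain ⟨y1, y2⟩ := hab.le hA hY
  refine ⟨a / b * (reTrace X / reTrace Y), by positivity, ?_, ?_⟩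
  · refine (smul_le_smul_of_nonneg_left y2 (by positivity)).trans (le_trans (le_of_eq ?_) x1)
    rw [smul_smul]
    congr 1
    field_simp
  · refine x2.trans (le_trans (le_of_eq ?_) (smul_le_smul_of_nonneg_left y1 (by
      rw [add_sub_cancel]
      positivity)))
    rw [smul_smul]
    congr 1
    field_simp
    ring

/-- Comparing traces gives `m ≤ 1`, so `(1 + δ) Y - X` is positive semidefinite of trace `δ`, and
its entries are at most `δ`. -/
theorem Near.norm_sub_le {δ : ℝ} {X Y : Op d} (h : Near δ X Y) (hX : X ∈ densityMatrices d)
    (hY : Y ∈ densityMatrices d) (i j : Fin d) : ‖X i j - Y i j‖ ≤ 2 * δ := by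
  obtain ⟨m, hm, h1, h2⟩ := h
  rw [mem_densityMatrices] at hX hY
  have t1 := reTrace_mono h1
  have t2 := reTrace_mono h2
  rw [reTrace_smul, hX.2, hY.2, mul_one] at t1 t2
  have hδ : 0 ≤ δ := by
    by_contra hneg
    nlinarith
  have h3 : X ≤ (1 + δ) • Y :=
    h2.trans (smul_le_smul_of_nonneg_right (by nlinarith) hY.1)
  have h4 := norm_apply_le (sub_nonneg.2 h3) i j
  rw [reTrace_sub, reTrace_smul, hX.2, hY.2] at h4
  have h5 := norm_apply_le hY.1 i j
  rw [hY.2] at h5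
  have h6 : X i j - Y i j = (δ : ℂ) * Y i j - ((1 + δ) • Y - X) i j := by
    simp
    ring
  rw [h6]
  refine (_root_.norm_sub_le _ _).trans ?_
  rw [norm_mul, Complex.norm_real, Real.norm_eq_abs, abs_of_nonneg hδ]
  nlinarith

theorem isNondegenerate_id : IsNondegenerate (LinearMap.id : SuperOp d) :=
  ⟨isPos_id, fun _ _ h => h⟩

theorem IsNondegenerate.comp {A B : SuperOp d} (hA : IsNondegenerate A) (hB : IsNondegenerate B) :
    IsNondegenerate (A ∘ₗ B) :=
  ⟨hA.pos.comp hB.pos, fun X hX h0 => hA.ne_zero _ (hB.pos X hX) (hB.ne_zero X hX h0)⟩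

/-- The composition `B m ∘ B (m + 1) ∘ ⋯ ∘ B (m + k - 1)`. -/
def backComp (B : ℕ → SuperOp d) (m : ℕ) : ℕ → SuperOp d
  | 0 => LinearMap.id
  | k + 1 => backComp B m k ∘ₗ B (m + k)

theorem backComp_add (B : ℕ → SuperOp d) (m k l : ℕ) :
    backComp B m (k + l) = backComp B m k ∘ₗ backComp B (m + k) l := by
  induction l with
  | zero => rfl
  | succ l ih =>
    rw [← add_assoc, backComp, ih, backComp, LinearMap.comp_assoc, add_assoc]

theorem backComp_shift (B : ℕ → SuperOp d) (m k : ℕ) :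
    backComp (fun n => B (n + 1)) m k = backComp B (m + 1) k := by
  induction k with
  | zero => rfl
  | succ k ih => rw [backComp, ih, backComp, add_right_comm]

theorem backComp_succ' (B : ℕ → SuperOp d) (k : ℕ) :
    backComp B 0 (k + 1) = B 0 ∘ₗ backComp (fun n => B (n + 1)) 0 k := by
  rw [backComp_shift, add_comm, backComp_add]
  rfl

theorem IsNondegenerate.backComp {B : ℕ → SuperOp d} (hB : ∀ k, IsNondegenerate (B k)) (m k : ℕ) :
    IsNondegenerate (backComp B m k) := by
  induction k with
  | zero => exact isNondegenerate_id
  | succ k ih => exact ih.comp (hB _)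

/-- The product `backComp B 0 n` maps the cone into a set of relative width `δ`. -/
def ContractsBy (B : ℕ → SuperOp d) (n : ℕ) (δ : ℝ) : Prop :=
  ∀ X Y, 0 ≤ X → X ≠ 0 → 0 ≤ Y → Y ≠ 0 → Near δ (backComp B 0 n X) (backComp B 0 n Y)

/-- The innermost good block makes the relative width finite, each further one multiplies it by `1 -
a / b`, and the maps in between do not increase it. The good blocks sit at the same places for every
index `i`, so `n` is uniform in `i`; later `i` is the deformation parameter. -/
theorem exists_contractsBy_of_pairBounds {ι : Type*} {B : ι → ℕ → SuperOp d}
    (hB : ∀ i k, IsNondegenerate (B i k)) {a b : ℝ} (ha : 0 < a) (hab : a ≤ b) {N : ℕ}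
    (h : ∀ m, ∃ j ≥ m, ∀ i, PairBounds (backComp (B i) j N) a b) {δ : ℝ} (hδ : 0 < δ) :
    ∃ n, ∀ i, ContractsBy (B i) n δ := by
  have hb : 0 < b := ha.trans_le hab
  have hκ0 : 0 ≤ 1 - a / b := by
    have := (div_le_one hb).2 hab
    linarith
  have hκ1 : 1 - a / b < 1 := by
    have : 0 < a / b := by positivity
    linarith
  have hC : 0 ≤ (b / a) ^ 2 - 1 := by
    have : 1 ≤ b / a := (one_le_div ha).2 hab
    nlinarith
  have key : ∀ k m, ∃ n, ∀ i X Y, 0 ≤ X → X ≠ 0 → 0 ≤ Y → Y ≠ 0 →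
      Near ((1 - a / b) ^ k * ((b / a) ^ 2 - 1)) (backComp (B i) m n X) (backComp (B i) m n Y) := by
    intro k
    induction k with
    | zero =>
      intro m
      obtain ⟨j, hj, hj'⟩ := h m
      refine ⟨j - m + N, fun i X Y hX hX0 hY hY0 => ?_⟩
      rw [backComp_add, Nat.add_sub_cancel' hj, pow_zero, one_mul]
      exact (near_of_pairBounds hX hX0 hY hY0 (IsNondegenerate.backComp (hB i) _ _).pos (hj' i)
        ha hb).map (IsNondegenerate.backComp (hB i) _ _).pos
    | succ k ih =>
      intro m
      obtain ⟨j, hj, hj'⟩ := h m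
      obtain ⟨n, hn⟩ := ih (j + N)
      refine ⟨j - m + (N + n), fun i X Y hX hX0 hY hY0 => ?_⟩
      rw [backComp_add, Nat.add_sub_cancel' hj, backComp_add, pow_succ', mul_assoc]
      have hnd := IsNondegenerate.backComp (hB i) (j + N) n
      exact ((hn i X Y hX hX0 hY hY0).map_pairBounds (mul_nonneg (pow_nonneg hκ0 k) hC)
        (hnd.pos Y hY) (hnd.ne_zero Y hY hY0) (IsNondegenerate.backComp (hB i) _ _).pos
        (hj' i) ha hab).map (IsNondegenerate.backComp (hB i) _ _).pos
  have hlim : Tendsto (fun k => (1 - a / b) ^ k * ((b / a) ^ 2 - 1)) atTop (𝓝 0) := by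
    simpa using (tendsto_pow_atTop_nhds_zero_of_lt_one hκ0 hκ1).mul_const ((b / a) ^ 2 - 1)
  obtain ⟨k, hk⟩ := (hlim.eventually_le_const hδ).exists
  obtain ⟨n, hn⟩ := key k 0
  exact ⟨n, fun i X Y hX hX0 hY hY0 => (hn i X Y hX hX0 hY hY0).mono
    ((IsNondegenerate.backComp (hB i) _ _).pos Y hY) hk⟩

/-- Normalization by the trace. -/
noncomputable def normalize (X : Op d) : Op d := (reTrace X)⁻¹ • X

theorem normalize_mem {X : Op d} (hX : 0 ≤ X) (h0 : X ≠ 0) : normalize X ∈ densityMatrices d :=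
  inv_reTrace_smul_mem hX h0

theorem normalize_smul {c : ℝ} (hc : c ≠ 0) (X : Op d) : normalize (c • X) = normalize X := by
  rw [normalize, normalize, reTrace_smul, smul_smul, mul_inv, mul_right_comm,
    inv_mul_cancel₀ hc, one_mul]

theorem reTrace_smul_normalize {X : Op d} (hX : 0 ≤ X) (h0 : X ≠ 0) :
    reTrace X • normalize X = X := by
  rw [normalize, smul_smul, mul_inv_cancel₀ (reTrace_pos hX h0).ne', one_smul]

theorem continuous_reTrace : Continuous (reTrace : Op d → ℝ) :=
  Complex.continuous_re.comp (Continuous.matrix_trace continuous_id)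

theorem continuousAt_normalize {X : Op d} (hX : reTrace X ≠ 0) : ContinuousAt normalize X :=
  (continuous_reTrace.continuousAt.inv₀ hX).smul continuousAt_id

/-- The limit direction of the products `backComp B 0 n`. -/
noncomputable def limDir (B : ℕ → SuperOp d) : Op d :=
  Matrix.of fun i j => limUnder atTop fun n => normalize (backComp B 0 n 1) i j

section Limit

variable {B : ℕ → SuperOp d}

/-- Longer products have images inside the image of the first `n` maps. This gives the Cauchy
property and independence of the starting matrix. -/
theorem ContractsBy.norm_sub_le {n : ℕ} {δ : ℝ} (h : ContractsBy B n δ)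
    (hB : ∀ k, IsNondegenerate (B k)) {X Y : Op d} (hX : 0 ≤ X) (hX0 : X ≠ 0) (hY : 0 ≤ Y)
    (hY0 : Y ≠ 0) (k l : ℕ) (i j : Fin d) :
    ‖normalize (backComp B 0 (n + k) X) i j - normalize (backComp B 0 (n + l) Y) i j‖ ≤ 2 * δ := by
  have hk := IsNondegenerate.backComp hB (0 + n) k
  have hl := IsNondegenerate.backComp hB (0 + n) l
  have hn := IsNondegenerate.backComp hB 0 n
  have hk1 := hk.pos X hX
  have hk2 := hk.ne_zero X hX hX0
  have hl1 := hl.pos Y hY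
  have hl2 := hl.ne_zero Y hY hY0
  rw [backComp_add, backComp_add, LinearMap.comp_apply, LinearMap.comp_apply]
  exact ((h _ _ hk1 hk2 hl1 hl2).smul
    (inv_pos.2 (reTrace_pos (hn.pos _ hk1) (hn.ne_zero _ hk1 hk2)))
    (inv_pos.2 (reTrace_pos (hn.pos _ hl1) (hn.ne_zero _ hl1 hl2)))).norm_sub_le
    (normalize_mem (hn.pos _ hk1) (hn.ne_zero _ hk1 hk2))
    (normalize_mem (hn.pos _ hl1) (hn.ne_zero _ hl1 hl2)) i j

variable [NeZero d]

theorem tendsto_limDir (hB : ∀ k, IsNondegenerate (B k)) (hc : ∀ δ > 0, ∃ n, ContractsBy B n δ) :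
    Tendsto (fun n => normalize (backComp B 0 n 1)) atTop (𝓝 (limDir B)) := by
  refine tendsto_pi_nhds.2 fun i => tendsto_pi_nhds.2 fun j => ?_
  refine CauchySeq.tendsto_limUnder (Metric.cauchySeq_iff'.2 fun ε hε => ?_)
  obtain ⟨n, hn⟩ := hc (ε / 3) (by positivity)
  refine ⟨n, fun m hm => ?_⟩
  obtain ⟨k, rfl⟩ := Nat.exists_eq_add_of_le hm
  have := hn.norm_sub_le hB one_nonneg' one_ne_zero one_nonneg' one_ne_zero k 0 i j
  rw [dist_eq_norm]
  exact this.trans_lt (by linarith)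

theorem limDir_mem (hB : ∀ k, IsNondegenerate (B k)) (hc : ∀ δ > 0, ∃ n, ContractsBy B n δ) :
    limDir B ∈ densityMatrices d :=
  isClosed_densityMatrices.mem_of_tendsto (tendsto_limDir hB hc) (Eventually.of_forall fun n =>
    normalize_mem ((IsNondegenerate.backComp hB 0 n).pos _ one_nonneg')
      ((IsNondegenerate.backComp hB 0 n).ne_zero _ one_nonneg' one_ne_zero))

theorem ContractsBy.norm_sub_limDir_le {n : ℕ} {δ : ℝ} (h : ContractsBy B n δ)
    (hB : ∀ k, IsNondegenerate (B k)) (hc : ∀ δ > 0, ∃ n, ContractsBy B n δ) (i j : Fin d) :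
    ‖normalize (backComp B 0 n 1) i j - limDir B i j‖ ≤ 2 * δ := by
  have h1 := tendsto_pi_nhds.1 (tendsto_pi_nhds.1 (tendsto_limDir hB hc) i) j
  refine le_of_tendsto (tendsto_const_nhds.sub h1).norm ?_
  filter_upwards [eventually_ge_atTop n] with m hm
  obtain ⟨k, rfl⟩ := Nat.exists_eq_add_of_le hm
  exact h.norm_sub_le hB one_nonneg' one_ne_zero one_nonneg' one_ne_zero 0 k i j

/-- Equivariance of the limit direction under removing the first map. -/
theorem apply_limDir_shift (hB : ∀ k, IsNondegenerate (B k))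
    (hc : ∀ δ > 0, ∃ n, ContractsBy B n δ)
    (hc' : ∀ δ > 0, ∃ n, ContractsBy (fun k => B (k + 1)) n δ) :
    B 0 (limDir fun k => B (k + 1)) =
      reTrace (B 0 (limDir fun k => B (k + 1))) • limDir B := by
  have hB' : ∀ k, IsNondegenerate (B (k + 1)) := fun k => hB _
  have hZ := limDir_mem hB' hc'
  have hZ0 := ne_zero_of_mem_densityMatrices hZ
  have hZ1 := (mem_densityMatrices.1 hZ).1
  have h1 := (hB 0).pos _ hZ1
  have h2 := (hB 0).ne_zero _ hZ1 hZ0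
  have hcont : Continuous (B 0) := LinearMap.continuous_of_finiteDimensional _
  have h3 : Tendsto (fun n => normalize (B 0 (normalize (backComp (fun k => B (k + 1)) 0 n 1))))
      atTop
      (𝓝 (normalize (B 0 (limDir fun k => B (k + 1))))) :=
    (continuousAt_normalize (reTrace_pos h1 h2).ne').tendsto.comp
      ((hcont.tendsto _).comp (tendsto_limDir hB' hc'))
  have h4 : Tendsto (fun n => normalize (backComp B 0 (n + 1) 1)) atTop (𝓝 (limDir B)) :=
    (tendsto_add_atTop_iff_nat 1).2 (tendsto_limDir hB hc)
  have h5 : ∀ n, normalize (B 0 (normalize (backComp (fun k => B (k + 1)) 0 n 1)))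
      = normalize (backComp B 0 (n + 1) 1) := by
    intro n
    have hn := IsNondegenerate.backComp hB' 0 n
    rw [backComp_succ', LinearMap.comp_apply, normalize.eq_1 (backComp _ 0 n 1), map_real_smul]
    exact normalize_smul (inv_pos.2 (reTrace_pos (hn.pos _ one_nonneg')
      (hn.ne_zero _ one_nonneg' one_ne_zero))).ne' _
  rw [← tendsto_nhds_unique (h3.congr h5) h4, reTrace_smul_normalize h1 h2]

end Limit

end QMP

/-! ### Adjoints, channels, cocycles and their deformations -/

namespace QMP

variable {d : ℕ}

theorem coe_smul_op (r : ℝ) (X : Op d) : (r : ℂ) • X = r • X := by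
  ext i j
  simp

theorem hsAdjoint_id : hsAdjoint (LinearMap.id : SuperOp d) = LinearMap.id := by
  refine LinearMap.ext fun Y => Matrix.ext_iff_trace_mul_left.2 fun X => ?_
  have := trace_conjTranspose_mul_hsAdjoint (LinearMap.id : SuperOp d) Xᴴ Y
  simpa using this

theorem hsAdjoint_comp (A B : SuperOp d) : hsAdjoint (A ∘ₗ B) = hsAdjoint B ∘ₗ hsAdjoint A := by
  refine LinearMap.ext fun Y => Matrix.ext_iff_trace_mul_left.2 fun X => ?_
  have h1 := trace_conjTranspose_mul_hsAdjoint (A ∘ₗ B) Xᴴ Y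
  have h2 := trace_conjTranspose_mul_hsAdjoint B Xᴴ (hsAdjoint A Y)
  have h3 := trace_conjTranspose_mul_hsAdjoint A (B Xᴴ) Y
  rw [Matrix.conjTranspose_conjTranspose] at h1 h2
  rw [h1, LinearMap.comp_apply, LinearMap.comp_apply, h2, h3]

section Channel

variable {φ : SuperOp d}

theorem IsTracePreserving.reTrace_apply (h : IsTracePreserving φ) {X : Op d} (hX : 0 ≤ X) :
    reTrace (φ X) = reTrace X := by
  by_cases h0 : X = 0
  · simp [h0]
  · have h1 := (mem_densityMatrices.1 (h _ (inv_reTrace_smul_mem hX h0))).2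
    rw [map_real_smul, reTrace_smul] at h1
    have h2 := (reTrace_pos hX h0).ne'
    field_simp at h1
    exact h1

theorem IsTracePreserving.isNondegenerate (h : IsTracePreserving φ) (hp : IsPos φ) :
    IsNondegenerate φ := by
  refine ⟨hp, fun X hX h0 h1 => ?_⟩
  have h2 := h.reTrace_apply hX
  rw [h1, reTrace_zero] at h2
  exact (reTrace_pos hX h0).ne h2

/-- An irreducible channel maps the identity to a positive definite matrix. -/
theorem IsIrreducible.posDef_apply_one [NeZero d] (hi : IsIrreducible φ) (hp : IsPos φ)
    (ht : IsTracePreserving φ) : (φ 1).PosDef := by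
  have h1 : 0 ≤ φ 1 := hp _ one_nonneg'
  refine Matrix.PosDef.of_dotProduct_mulVec_pos (isHermitian_of_nonneg h1) fun x hx => ?_
  refine lt_of_le_of_ne ((posSemidef_of_nonneg h1).dotProduct_mulVec_nonneg x) fun h0 => ?_
  -- Since `X ≤ (tr X) 1`, a null vector `x` of the form of `φ 1` is null for the whole range on the
  -- cone. Hence it is null for every `(id + φ)^k (φ 1)`, contradicting irreducibility.
  have hker : ∀ X, 0 ≤ X → star x ⬝ᵥ (φ X *ᵥ x) = 0 := by
    intro X hX
    have h2 := hp.mono (le_reTrace_smul_one hX)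
    rw [map_real_smul] at h2
    have h3 := (posSemidef_of_nonneg (sub_nonneg.2 h2)).dotProduct_mulVec_nonneg x
    rw [Matrix.sub_mulVec, dotProduct_sub, Matrix.smul_mulVec, dotProduct_smul, ← h0, smul_zero,
      zero_sub] at h3
    exact le_antisymm (neg_nonneg.1 h3)
      ((posSemidef_of_nonneg (hp X hX)).dotProduct_mulVec_nonneg x)
  have hpow : ∀ k : ℕ, 0 ≤ ((LinearMap.id + φ : Module.End ℂ (Op d)) ^ k) (φ 1) ∧
      star x ⬝ᵥ (((LinearMap.id + φ : Module.End ℂ (Op d)) ^ k) (φ 1) *ᵥ x) = 0 := by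
    intro k
    induction k with
    | zero => exact ⟨by simpa using h1, by simpa using h0.symm⟩
    | succ k ih =>
      rw [pow_succ', Module.End.mul_apply, LinearMap.add_apply, LinearMap.id_apply]
      refine ⟨add_nonneg ih.1 (hp _ ih.1), ?_⟩
      rw [Matrix.add_mulVec, dotProduct_add, ih.2, hker _ ih.1, add_zero]
  have h2 := hi (φ 1) (posSemidef_of_nonneg h1)
    ((ht.isNondegenerate hp).ne_zero 1 one_nonneg' one_ne_zero)
  exact (h2.dotProduct_mulVec_pos hx).ne' (hpow (d - 1)).2

end Channel

section Cocycle

variable {Ω : Type*} {θ : Ω → Ω} {φ : Ω → SuperOp d}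

theorem cocycle_add (m n : ℕ) (ω : Ω) :
    cocycle θ φ (m + n) ω = cocycle θ φ n (θ^[m] ω) ∘ₗ cocycle θ φ m ω := by
  induction n with
  | zero => rfl
  | succ n ih =>
    rw [← add_assoc, cocycle, ih, cocycle, LinearMap.comp_assoc, ← Function.iterate_add_apply,
      add_comm n m]

theorem cocycle_succ' (n : ℕ) (ω : Ω) :
    cocycle θ φ (n + 1) ω = cocycle θ φ n (θ ω) ∘ₗ φ ω := by
  rw [add_comm, cocycle_add]
  rfl

/-- Taking adjoints reverses composition, so products over the future acquire the shape of products
over the past, and one limit theory serves both. -/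
theorem backComp_hsAdjoint (m k : ℕ) (ω : Ω) :
    backComp (fun n => hsAdjoint (φ (θ^[n] ω))) m k = hsAdjoint (cocycle θ φ k (θ^[m] ω)) := by
  induction k with
  | zero => exact hsAdjoint_id.symm
  | succ k ih =>
    rw [backComp, ih, cocycle, hsAdjoint_comp, ← Function.iterate_add_apply, add_comm k m]

theorem backComp_symm [MeasurableSpace Ω] {θ : Ω ≃ᵐ Ω} (m k : ℕ) (ω : Ω) :
    backComp (fun n => φ (θ.symm^[n + 1] ω)) m k = cocycle θ φ k (θ.symm^[m + k] ω) := by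
  induction k with
  | zero => rfl
  | succ k ih =>
    rw [backComp, ih, cocycle_succ', ← add_assoc, Function.iterate_succ_apply',
      MeasurableEquiv.apply_symm_apply]

theorem isNondegenerate_cocycle (h : ∀ ω, IsNondegenerate (φ ω)) (n : ℕ) (ω : Ω) :
    IsNondegenerate (cocycle θ φ n ω) := by
  induction n with
  | zero => exact isNondegenerate_id
  | succ n ih => exact (h _).comp ih

end Cocycle

section Deformed

variable {Ω 𝒜 : Type*} {θ : Ω → Ω} {ψ : Ω → 𝒜 → SuperOp d} {f : Ω → 𝒜 → ℝ}

/-- The maximum of `|f ω a|` over the outcomes `a`. -/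
noncomputable def supAbs (f : Ω → 𝒜 → ℝ) (ω : Ω) : ℝ := ⨆ a, |f ω a|

theorem supAbs_nonneg (f : Ω → 𝒜 → ℝ) (ω : Ω) : 0 ≤ supAbs f ω :=
  Real.iSup_nonneg fun _ => abs_nonneg _

theorem birkhoffSum_supAbs_nonneg (n : ℕ) (ω : Ω) : 0 ≤ birkhoffSum θ (supAbs f) n ω :=
  Finset.sum_nonneg fun _ _ => supAbs_nonneg f _

variable [Fintype 𝒜]

theorem abs_le_supAbs (f : Ω → 𝒜 → ℝ) (ω : Ω) (a : 𝒜) : |f ω a| ≤ supAbs f ω :=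
  le_ciSup (f := fun a => |f ω a|) (Set.finite_range _).bddAbove a

theorem channel_apply (ω : Ω) (X : Op d) : channel ψ ω X = ∑ a, ψ ω a X := by
  rw [channel, LinearMap.sum_apply]

theorem deformedChannel_apply (α : ℝ) (ω : Ω) (X : Op d) :
    deformedChannel ψ f α ω X = ∑ a, Real.exp (-α * f ω a) • ψ ω a X := by
  rw [deformedChannel, LinearMap.sum_apply]
  exact Finset.sum_congr rfl fun a _ => by rw [LinearMap.smul_apply, coe_smul_op]

theorem abs_mul_le_supAbs (α : ℝ) (ω : Ω) (a : 𝒜) : |-α * f ω a| ≤ |α| * supAbs f ω := by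
  rw [abs_mul, abs_neg]
  exact mul_le_mul_of_nonneg_left (abs_le_supAbs f ω a) (abs_nonneg α)

variable (hψ : ∀ ω, IsIrreducibleInstrument (ψ ω))
include hψ

theorem isPos_outcome (ω : Ω) (a : 𝒜) : IsPos (ψ ω a) := ((hψ ω).completelyPositive a).isPos

theorem isPos_channel (ω : Ω) : IsPos (channel ψ ω) := IsPos.sum _ (isPos_outcome hψ ω)

theorem isNondegenerate_channel (ω : Ω) : IsNondegenerate (channel ψ ω) :=
  IsTracePreserving.isNondegenerate (hψ ω).tracePreserving (isPos_channel hψ ω)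

/-- Every weight lies between `exp (∓ |α| F)`. Growth bounds and nondegeneracy thus pass from the
trace-preserving channel to its deformation. -/
theorem le_deformedChannel (α : ℝ) (ω : Ω) {X : Op d} (hX : 0 ≤ X) :
    Real.exp (-(|α| * supAbs f ω)) • channel ψ ω X ≤ deformedChannel ψ f α ω X := by
  rw [channel_apply, deformedChannel_apply, Finset.smul_sum]
  exact Finset.sum_le_sum fun a _ => smul_le_smul_of_nonneg_right
    (Real.exp_le_exp.2 (neg_le_of_abs_le (abs_mul_le_supAbs α ω a))) (isPos_outcome hψ ω a X hX)

theorem deformedChannel_le (α : ℝ) (ω : Ω) {X : Op d} (hX : 0 ≤ X) :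
    deformedChannel ψ f α ω X ≤ Real.exp (|α| * supAbs f ω) • channel ψ ω X := by
  rw [channel_apply, deformedChannel_apply, Finset.smul_sum]
  exact Finset.sum_le_sum fun a _ => smul_le_smul_of_nonneg_right
    (Real.exp_le_exp.2 (le_of_abs_le (abs_mul_le_supAbs α ω a))) (isPos_outcome hψ ω a X hX)

theorem isPos_deformedChannel (α : ℝ) (ω : Ω) : IsPos (deformedChannel ψ f α ω) := fun X hX =>
  (smul_nonneg (Real.exp_pos _).le (isPos_channel hψ ω X hX)).trans (le_deformedChannel hψ α ω hX)

theorem reTrace_cocycle_channel (n : ℕ) (ω : Ω) {X : Op d} (hX : 0 ≤ X) :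
    reTrace (cocycle θ (channel ψ) n ω X) = reTrace X := by
  induction n with
  | zero => rfl
  | succ n ih =>
    rw [cocycle, LinearMap.comp_apply, ← ih]
    exact IsTracePreserving.reTrace_apply (hψ _).tracePreserving
      ((isNondegenerate_cocycle (isNondegenerate_channel hψ) n ω).pos X hX)

theorem reTrace_channel (ω : Ω) {X : Op d} (hX : 0 ≤ X) :
    reTrace (channel ψ ω X) = reTrace X :=
  IsTracePreserving.reTrace_apply (hψ ω).tracePreserving hX

theorem le_reTrace_deformedChannel (α : ℝ) (ω : Ω) {X : Op d} (hX : 0 ≤ X) :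
    Real.exp (-(|α| * supAbs f ω)) * reTrace X ≤ reTrace (deformedChannel ψ f α ω X) := by
  have h := reTrace_mono (le_deformedChannel (f := f) hψ α ω hX)
  rwa [reTrace_smul, reTrace_channel hψ ω hX] at h

theorem reTrace_deformedChannel_le (α : ℝ) (ω : Ω) {X : Op d} (hX : 0 ≤ X) :
    reTrace (deformedChannel ψ f α ω X) ≤ Real.exp (|α| * supAbs f ω) * reTrace X := by
  have h := reTrace_mono (deformedChannel_le (f := f) hψ α ω hX)
  rwa [reTrace_smul, reTrace_channel hψ ω hX] at h

theorem isNondegenerate_deformedChannel (α : ℝ) (ω : Ω) :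
    IsNondegenerate (deformedChannel ψ f α ω) := by
  refine ⟨isPos_deformedChannel hψ α ω, fun X hX h0 h1 => ?_⟩
  have h2 := le_reTrace_deformedChannel (f := f) hψ α ω hX
  rw [h1, reTrace_zero] at h2
  have := mul_pos (Real.exp_pos (-(|α| * supAbs f ω))) (reTrace_pos hX h0)
  linarith

/-- The trace of the adjoint image of `Y` is the pairing of `Y` with the image of `1`, which
dominates a positive multiple of the positive definite matrix `φ_ω(1)`. Irreducibility is used here.
-/
theorem isNondegenerate_hsAdjoint_deformedChannel [NeZero d] (α : ℝ) (ω : Ω) :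
    IsNondegenerate (hsAdjoint (deformedChannel ψ f α ω)) := by
  have hp := isPos_deformedChannel (f := f) hψ α ω
  refine ⟨hp.hsAdjoint, fun Y hY h0 h1 => ?_⟩
  have h2 : pair Y (deformedChannel ψ f α ω 1) = 0 := by
    rw [← pair_hsAdjoint hp one_nonneg', h1]
    simp [pair]
  have h3 := pair_mono hY (le_deformedChannel (f := f) hψ α ω one_nonneg')
  rw [h2, pair_smul] at h3
  have h4 := pair_pos (IsIrreducible.posDef_apply_one (hψ ω).irreducible (isPos_channel hψ ω)
    (hψ ω).tracePreserving) hY h0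
  have := mul_pos (Real.exp_pos (-(|α| * supAbs f ω))) h4
  exact absurd h3 (not_le.2 this)

theorem cocycle_deformedChannel_bounds (α : ℝ) (n : ℕ) (ω : Ω) {X : Op d} (hX : 0 ≤ X) :
    Real.exp (-(|α| * birkhoffSum θ (supAbs f) n ω)) • cocycle θ (channel ψ) n ω X ≤
      cocycle θ (deformedChannel ψ f α) n ω X ∧
    cocycle θ (deformedChannel ψ f α) n ω X ≤
      Real.exp (|α| * birkhoffSum θ (supAbs f) n ω) • cocycle θ (channel ψ) n ω X := by
  induction n with
  | zero => simp [cocycle]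
  | succ n ih =>
    have h0 := (isNondegenerate_cocycle (θ := θ)
      (isNondegenerate_deformedChannel (f := f) hψ α) n ω).pos X hX
    have hc := isPos_channel hψ (θ^[n] ω)
    have h1 := hc.mono ih.1
    have h2 := hc.mono ih.2
    rw [map_real_smul] at h1 h2
    have h3 := (smul_le_smul_of_nonneg_left h1
      (Real.exp_pos (-(|α| * supAbs f (θ^[n] ω)))).le).trans (le_deformedChannel hψ α _ h0)
    have h4 := (deformedChannel_le hψ α _ h0).trans (smul_le_smul_of_nonneg_left h2
      (Real.exp_pos (|α| * supAbs f (θ^[n] ω))).le)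
    rw [smul_smul, ← Real.exp_add] at h3 h4
    have e1 : -(|α| * supAbs f (θ^[n] ω)) + -(|α| * birkhoffSum θ (supAbs f) n ω)
        = -(|α| * birkhoffSum θ (supAbs f) (n + 1) ω) := by
      rw [birkhoffSum_succ]
      ring
    have e2 : |α| * supAbs f (θ^[n] ω) + |α| * birkhoffSum θ (supAbs f) n ω
        = |α| * birkhoffSum θ (supAbs f) (n + 1) ω := by
      rw [birkhoffSum_succ]
      ring
    rw [e1] at h3
    rw [e2] at h4
    exact ⟨h3, h4⟩

theorem reTrace_cocycle_deformedChannel_bounds (α : ℝ) (n : ℕ) (ω : Ω) {X : Op d} (hX : 0 ≤ X) :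
    Real.exp (-(|α| * birkhoffSum θ (supAbs f) n ω)) * reTrace X ≤
      reTrace (cocycle θ (deformedChannel ψ f α) n ω X) ∧
    reTrace (cocycle θ (deformedChannel ψ f α) n ω X) ≤
      Real.exp (|α| * birkhoffSum θ (supAbs f) n ω) * reTrace X := by
  have h := cocycle_deformedChannel_bounds (θ := θ) (f := f) hψ α n ω hX
  have h1 := reTrace_mono h.1
  have h2 := reTrace_mono h.2
  rw [reTrace_smul, reTrace_cocycle_channel hψ n ω hX] at h1 h2
  exact ⟨h1, h2⟩

/-- The constants depend on `α` only through `|α| ≤ A`, which later makes the limit directions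
continuous in `α`. The upper bound comes from trace preservation, the lower one from homogeneity of
the bound on states. -/
theorem pairBounds_cocycle_deformedChannel {ε R A : ℝ} {N : ℕ} {ω : Ω}
    (h : ∀ X ∈ densityMatrices d, ∀ Y ∈ densityMatrices d,
      ε ≤ pair Y (cocycle θ (channel ψ) N ω X))
    (hR : birkhoffSum θ (supAbs f) N ω ≤ R) {α : ℝ} (hα : |α| ≤ A) :
    PairBounds (cocycle θ (deformedChannel ψ f α) N ω) (Real.exp (-(A * R)) * ε)
      (Real.exp (A * R)) := by
  intro X Y hX hY
  have hS := birkhoffSum_supAbs_nonneg (θ := θ) (f := f) N ω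
  have hAR : |α| * birkhoffSum θ (supAbs f) N ω ≤ A * R :=
    mul_le_mul hα hR hS ((abs_nonneg α).trans hα)
  have hΦ := (isNondegenerate_cocycle (θ := θ) (isNondegenerate_channel hψ) N ω).pos X hX
  obtain ⟨b1, b2⟩ := cocycle_deformedChannel_bounds (θ := θ) (f := f) hψ α N ω hX
  have b1' := pair_mono hY b1
  have b2' := pair_mono hY b2
  rw [pair_smul] at b1' b2'
  have hp0 := pair_nonneg hY hΦ
  have hup : pair Y (cocycle θ (channel ψ) N ω X) ≤ reTrace X * reTrace Y := by
    have := pair_mono hY (le_reTrace_smul_one hΦ)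
    rwa [pair_smul, pair_one_right, reTrace_cocycle_channel hψ N ω hX] at this
  have hlow : ε * (reTrace X * reTrace Y) ≤ pair Y (cocycle θ (channel ψ) N ω X) := by
    by_cases hX0 : X = 0
    · simpa [hX0] using hp0
    by_cases hY0 : Y = 0
    · simpa [hY0] using hp0
    have h1 := h _ (inv_reTrace_smul_mem hX hX0) _ (inv_reTrace_smul_mem hY hY0)
    rw [map_real_smul, pair_smul, smul_pair] at h1
    have tX := reTrace_pos hX hX0
    have tY := reTrace_pos hY hY0
    have h2 := mul_le_mul_of_nonneg_right h1 (mul_pos tX tY).le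
    refine h2.trans (le_of_eq ?_)
    field_simp
  constructor
  · calc Real.exp (-(A * R)) * ε * reTrace X * reTrace Y
        = Real.exp (-(A * R)) * (ε * (reTrace X * reTrace Y)) := by ring
      _ ≤ Real.exp (-(A * R)) * pair Y (cocycle θ (channel ψ) N ω X) :=
        mul_le_mul_of_nonneg_left hlow (Real.exp_pos _).le
      _ ≤ Real.exp (-(|α| * birkhoffSum θ (supAbs f) N ω)) *
          pair Y (cocycle θ (channel ψ) N ω X) :=
        mul_le_mul_of_nonneg_right (Real.exp_le_exp.2 (neg_le_neg hAR)) hp0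
      _ ≤ _ := b1'
  · calc pair Y (cocycle θ (deformedChannel ψ f α) N ω X)
        ≤ Real.exp (|α| * birkhoffSum θ (supAbs f) N ω) *
          pair Y (cocycle θ (channel ψ) N ω X) := b2'
      _ ≤ Real.exp (A * R) * (reTrace X * reTrace Y) :=
        mul_le_mul (Real.exp_le_exp.2 hAR) hup hp0 (Real.exp_pos _).le
      _ = _ := by ring

end Deformed

end QMP

/-! ### Continuity and measurability of the limit directions -/

namespace QMP

variable {d : ℕ}

section Continuity

/-- The finite products are continuous in `α` and approximate the limit uniformly on compact
intervals. -/
theorem continuous_limDir [NeZero d] {B : ℝ → ℕ → SuperOp d} (hB : ∀ α k, IsNondegenerate (B α k))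
    (hcont : ∀ k (X : ℝ → Op d), Continuous X → Continuous fun α => B α k (X α))
    (hc : ∀ A : ℝ, ∀ δ > 0, ∃ n, ∀ α : Set.Icc (-A) A, ContractsBy (B α) n δ) :
    Continuous fun α => limDir (B α) := by
  have hc1 : ∀ α, ∀ δ > 0, ∃ n, ContractsBy (B α) n δ := fun α δ hδ => by
    obtain ⟨n, hn⟩ := hc |α| δ hδ
    exact ⟨n, hn ⟨α, neg_abs_le α, le_abs_self α⟩⟩
  have hX : ∀ n (X : ℝ → Op d), Continuous X → Continuous fun α => backComp (B α) 0 n (X α) := by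
    intro n
    induction n with
    | zero => exact fun X hX => hX
    | succ n ih => exact fun X hX => ih _ (hcont _ X hX)
  have hnorm : ∀ n, Continuous fun α => normalize (backComp (B α) 0 n 1) := by
    intro n
    refine continuous_iff_continuousAt.2 fun α => ?_
    have hn := IsNondegenerate.backComp (hB α) 0 n
    have h1 : ContinuousAt (fun α => backComp (B α) 0 n 1) α :=
      (hX n (fun _ => 1) continuous_const).continuousAt
    exact ContinuousAt.comp (f := fun α => backComp (B α) 0 n 1) (continuousAt_normalize
      (reTrace_pos (hn.pos _ one_nonneg') (hn.ne_zero _ one_nonneg' one_ne_zero)).ne') h1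
  refine continuous_pi fun i => continuous_pi fun j => continuous_iff_continuousAt.2 fun α => ?_
  refine continuousAt_of_locally_uniform_approx_of_continuousAt fun u hu => ?_
  obtain ⟨ε, hε, hεu⟩ := Metric.mem_uniformity_dist.1 hu
  obtain ⟨n, hn⟩ := hc (|α| + 1) (ε / 3) (by positivity)
  refine ⟨Set.Icc (-(|α| + 1)) (|α| + 1), Icc_mem_nhds ?_ ?_,
    fun α => normalize (backComp (B α) 0 n 1) i j,
    ((continuous_apply j).comp ((continuous_apply i).comp (hnorm n))).continuousAt,
    fun β hβ => hεu ?_⟩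
  · linarith [neg_abs_le α]
  · linarith [le_abs_self α]
  · rw [dist_comm, dist_eq_norm]
    exact ((hn ⟨β, hβ⟩).norm_sub_limDir_le (hB β) (hc1 β) i j).trans_lt (by linarith)

end Continuity

section Measurability

variable {Ω : Type*} [MeasurableSpace Ω]

/-- Measurability of a random linear map on matrices. -/
def MeasurableEntries (Φ : Ω → SuperOp d) : Prop := ∀ X i j, Measurable fun ω => Φ ω X i j

theorem apply_eq_sum (A : SuperOp d) (X : Op d) (i j : Fin d) :
    A X i j = ∑ k, ∑ l, X k l * A (Matrix.single k l 1) i j := by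
  conv_lhs => rw [Matrix.matrix_eq_sum_single X]
  simp only [map_sum, Matrix.sum_apply]
  refine Finset.sum_congr rfl fun k _ => Finset.sum_congr rfl fun l _ => ?_
  rw [← mul_one (X k l), ← smul_eq_mul, ← Matrix.smul_single, map_smul, Matrix.smul_apply,
    smul_eq_mul, smul_eq_mul, mul_one]

theorem MeasurableEntries.apply {Φ : Ω → SuperOp d} (hΦ : MeasurableEntries Φ) {X : Ω → Op d}
    (hX : ∀ i j, Measurable fun ω => X ω i j) (i j : Fin d) :
    Measurable fun ω => Φ ω (X ω) i j := by
  simp only [fun ω => apply_eq_sum (Φ ω) (X ω)]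
  exact Finset.measurable_sum _ fun k _ => Finset.measurable_sum _ fun l _ =>
    (hX k l).mul (hΦ _ i j)

theorem MeasurableEntries.comp {Φ Ψ : Ω → SuperOp d} (hΦ : MeasurableEntries Φ)
    (hΨ : MeasurableEntries Ψ) : MeasurableEntries fun ω => Φ ω ∘ₗ Ψ ω := fun X i j =>
  hΦ.apply (fun i j => hΨ X i j) i j

theorem MeasurableEntries.backComp {B : Ω → ℕ → SuperOp d}
    (hB : ∀ k, MeasurableEntries fun ω => B ω k) (m n : ℕ) :
    MeasurableEntries fun ω => backComp (B ω) m n := by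
  induction n with
  | zero => exact fun X i j => measurable_const
  | succ n ih => exact ih.comp (hB _)

theorem measurable_reTrace {X : Ω → Op d} (hX : ∀ i j, Measurable fun ω => X ω i j) :
    Measurable fun ω => reTrace (X ω) :=
  Complex.measurable_re.comp (Finset.measurable_sum _ fun i _ => hX i i)

theorem measurable_pair {X Y : Ω → Op d} (hX : ∀ i j, Measurable fun ω => X ω i j)
    (hY : ∀ i j, Measurable fun ω => Y ω i j) : Measurable fun ω => pair (Y ω) (X ω) := by
  refine Complex.measurable_re.comp (Finset.measurable_sum _ fun i _ => ?_)
  simp only [Matrix.diag, Matrix.mul_apply]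
  exact Finset.measurable_sum _ fun j _ => (hY i j).mul (hX j i)

theorem MeasurableEntries.hsAdjoint {Φ : Ω → SuperOp d} (hΦ : MeasurableEntries Φ) :
    MeasurableEntries fun ω => hsAdjoint (Φ ω) := by
  intro Y i j
  simp only [QMP.hsAdjoint, LinearMap.coe_mk, AddHom.coe_mk, Matrix.of_apply, Matrix.trace,
    Matrix.diag, Matrix.mul_apply, Matrix.conjTranspose_apply]
  exact Finset.measurable_sum _ fun k _ => Finset.measurable_sum _ fun l _ =>
    (Complex.continuous_conj.measurable.comp (hΦ _ l k)).mul measurable_const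

theorem measurable_limDir {B : Ω → ℕ → SuperOp d} (hB : ∀ k, MeasurableEntries fun ω => B ω k)
    (i j : Fin d) : Measurable fun ω => limDir (B ω) i j := by
  refine (StronglyMeasurable.limUnder fun n => Measurable.stronglyMeasurable ?_).measurable
  have h := MeasurableEntries.backComp hB 0 n 1
  simp only [normalize, Matrix.smul_apply, Complex.real_smul]
  exact (Complex.measurable_ofReal.comp (measurable_reTrace h).inv).mul (h i j)

/-- The intersection over pairs of states is uncountable, but it is the preimage of a closed set
under the measurable vector of matrix entries of `Φ ω`. -/
theorem measurableSet_pair_ge {Φ : Ω → SuperOp d} (hΦ : MeasurableEntries Φ) (ε : ℝ) :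
    MeasurableSet {ω | ∀ X ∈ densityMatrices d, ∀ Y ∈ densityMatrices d, ε ≤ pair Y (Φ ω X)} := by
  let q : Op d → Op d → (Fin d × Fin d × Fin d × Fin d → ℂ) → ℝ := fun X Y T =>
    (∑ i, ∑ j, Y i j * ∑ k, ∑ l, X k l * T (k, l, j, i)).re
  have hq : ∀ X Y, Continuous (q X Y) := fun X Y => by fun_prop
  have hC : IsClosed {T | ∀ X ∈ densityMatrices d, ∀ Y ∈ densityMatrices d, ε ≤ q X Y T} := by
    simp only [Set.ofPred_forall]
    exact isClosed_iInter fun X => isClosed_iInter fun _ => isClosed_iInter fun Y =>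
      isClosed_iInter fun _ => isClosed_le continuous_const (hq X Y)
  have hm : Measurable fun ω => fun t : Fin d × Fin d × Fin d × Fin d =>
      Φ ω (Matrix.single t.1 t.2.1 1) t.2.2.1 t.2.2.2 :=
    measurable_pi_iff.2 fun t => hΦ _ _ _
  have heq : ∀ X Y ω, q X Y (fun t : Fin d × Fin d × Fin d × Fin d =>
      Φ ω (Matrix.single t.1 t.2.1 1) t.2.2.1 t.2.2.2) = pair Y (Φ ω X) := by
    intro X Y ω
    simp only [q, pair, Matrix.trace, Matrix.diag, Matrix.mul_apply]
    simp only [fun i j => apply_eq_sum (Φ ω) X i j]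
  refine (congrArg MeasurableSet ?_).mp (hm hC.measurableSet)
  ext ω
  simp only [Set.mem_preimage, Set.mem_ofPred_eq, heq]

end Measurability

/-- A continuous positive function on the compact set of pairs of states attains its minimum. -/
theorem exists_pair_ge_of_isPositivityImproving [NeZero d] {A : SuperOp d}
    (hA : IsPositivityImproving A) :
    ∃ ε : ℝ, 0 < ε ∧ ∀ X ∈ densityMatrices d, ∀ Y ∈ densityMatrices d, ε ≤ pair Y (A X) := by
  have hc : Continuous A := LinearMap.continuous_of_finiteDimensional _
  have hne : (densityMatrices d).Nonempty :=
    ⟨_, inv_reTrace_smul_mem one_nonneg' (one_ne_zero (α := Op d))⟩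
  obtain ⟨q, hq, hmin⟩ := (isCompact_densityMatrices.prod isCompact_densityMatrices).exists_isMinOn
    (hne.prod hne) (f := fun q : Op d × Op d => pair q.2 (A q.1))
    (continuous_pair.comp (continuous_snd.prodMk (hc.comp continuous_fst))).continuousOn
  refine ⟨pair q.2 (A q.1), ?_, fun X hX Y hY => hmin (Set.mk_mem_prod hX hY)⟩
  have h1 := mem_densityMatrices.1 hq.1
  have h2 := mem_densityMatrices.1 hq.2
  exact pair_pos (hA _ (posSemidef_of_nonneg h1.1) (ne_zero_of_mem_densityMatrices hq.1)) h2.1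
    (ne_zero_of_mem_densityMatrices hq.2)

end QMP

/-! ### Recurrent environments and equivariant directions -/

namespace QMP

variable {d : ℕ} {Ω 𝒜 : Type*} [Fintype 𝒜] [MeasurableSpace Ω]

/-- The environments for which the first `N` channels compose to a uniformly positive map, with
controlled deformation weights. -/
def regularSet (θ : Ω → Ω) (ψ : Ω → 𝒜 → SuperOp d) (f : Ω → 𝒜 → ℝ) (N : ℕ) (ε R : ℝ) : Set Ω :=
  {ω | (∀ X ∈ densityMatrices d, ∀ Y ∈ densityMatrices d,
    ε ≤ pair Y (cocycle θ (channel ψ) N ω X)) ∧ birkhoffSum θ (supAbs f) N ω ≤ R}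

/-- The orbit of `ω` visits the regular set infinitely often in the past and in the future. -/
structure IsRecurrent (θ : Ω ≃ᵐ Ω) (G : Set Ω) (ω : Ω) : Prop where
  past : ∃ᶠ n in atTop, θ.symm^[n] ω ∈ G
  future : ∃ᶠ n in atTop, θ^[n] ω ∈ G

theorem IsRecurrent.apply {θ : Ω ≃ᵐ Ω} {G : Set Ω} {ω : Ω} (h : IsRecurrent θ G ω) :
    IsRecurrent θ G (θ ω) := by
  constructor
  · rw [← map_add_atTop_eq_nat 1, frequently_map]
    refine h.past.mono fun n hn => ?_
    rwa [Function.iterate_succ_apply, MeasurableEquiv.symm_apply_apply]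
  · have := h.future
    rw [← map_add_atTop_eq_nat 1, frequently_map] at this
    exact this

theorem IsRecurrent.iterate {θ : Ω ≃ᵐ Ω} {G : Set Ω} {ω : Ω} (h : IsRecurrent θ G ω) (n : ℕ) :
    IsRecurrent θ G (θ^[n] ω) := by
  induction n with
  | zero => exact h
  | succ n ih =>
    rw [Function.iterate_succ_apply']
    exact ih.apply

theorem measurableEntries_cocycle {θ : Ω → Ω} (hθ : Measurable θ) {φ : Ω → SuperOp d}
    (hφ : MeasurableEntries φ) (n : ℕ) : MeasurableEntries (cocycle θ φ n) := by
  induction n with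
  | zero => exact fun X i j => measurable_const
  | succ n ih =>
    exact MeasurableEntries.comp (fun X i j => (hφ X i j).comp (hθ.iterate n)) ih

theorem measurable_supAbs {f : Ω → 𝒜 → ℝ} (hf : ∀ a, Measurable fun ω => f ω a) :
    Measurable (supAbs f) :=
  Measurable.iSup fun a => (hf a).abs

theorem measurableEntries_deformedChannel {ψ : Ω → 𝒜 → SuperOp d}
    (hψm : ∀ (a : 𝒜) (X : Op d) (i j : Fin d), Measurable fun ω => ψ ω a X i j) {f : Ω → 𝒜 → ℝ}
    (hf : ∀ a, Measurable fun ω => f ω a) (α : ℝ) : MeasurableEntries (deformedChannel ψ f α) := by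
  intro X i j
  simp only [deformedChannel_apply, Matrix.sum_apply, Matrix.smul_apply, Complex.real_smul]
  exact Finset.measurable_sum _ fun a _ => (Complex.measurable_ofReal.comp
    (Real.measurable_exp.comp ((hf a).const_mul _))).mul (hψm a X i j)

theorem measurableEntries_channel {ψ : Ω → 𝒜 → SuperOp d}
    (hψm : ∀ (a : 𝒜) (X : Op d) (i j : Fin d), Measurable fun ω => ψ ω a X i j) :
    MeasurableEntries (channel ψ) := by
  intro X i j
  simp only [channel_apply, Matrix.sum_apply]
  exact Finset.measurable_sum _ fun a _ => hψm a X i j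

/-- The event in (A2) is covered by countably many regular sets, so one of them has positive
measure; recurrence is applied to it under `θ` and under its inverse. Only the regular sets need to
be measurable. -/
theorem exists_ae_isRecurrent [NeZero d] {P : Measure Ω} [IsProbabilityMeasure P] {θ : Ω ≃ᵐ Ω}
    (hθ : Ergodic θ P) {ψ : Ω → 𝒜 → SuperOp d}
    (hψm : ∀ (a : 𝒜) (X : Op d) (i j : Fin d), Measurable fun ω => ψ ω a X i j) {f : Ω → 𝒜 → ℝ}
    (hf : ∀ a, Measurable fun ω => f ω a) (hA2 : ∃ N₀ : ℕ, 0 < P {ω | IsPositivityImproving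
      (cocycle θ (channel ψ) N₀ ω)}) :
    ∃ N ε R, 0 < ε ∧ ∀ᵐ ω ∂P, IsRecurrent θ (regularSet θ ψ f N ε R) ω := by
  obtain ⟨N, hN⟩ := hA2
  have hsub : {ω | IsPositivityImproving (cocycle θ (channel ψ) N ω)} ⊆
      ⋃ k : ℕ, regularSet θ ψ f N (1 / ((k : ℝ) + 1)) k := by
    intro ω hω
    obtain ⟨ε, hε, h⟩ := exists_pair_ge_of_isPositivityImproving hω
    obtain ⟨k, hk⟩ := exists_nat_one_div_lt hε
    obtain ⟨l, hl⟩ := exists_nat_ge (birkhoffSum θ (supAbs f) N ω)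
    refine Set.mem_iUnion.2 ⟨max k l, fun X hX Y hY => le_trans ?_ (h X hX Y hY), hl.trans ?_⟩
    · refine le_trans (one_div_le_one_div_of_le (by positivity) ?_) hk.le
      gcongr
      exact le_max_left _ _
    · exact_mod_cast le_max_right _ _
  obtain ⟨k, hk⟩ : ∃ k : ℕ, 0 < P (regularSet θ ψ f N (1 / ((k : ℝ) + 1)) k) := by
    by_contra! h
    exact hN.ne' (measure_mono_null hsub (measure_iUnion_null fun k => le_antisymm (h k) zero_le))
  refine ⟨N, 1 / ((k : ℝ) + 1), k, by positivity, ?_⟩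
  have hm : MeasurableSet (regularSet θ ψ f N (1 / ((k : ℝ) + 1)) k) := by
    refine (measurableSet_pair_ge (measurableEntries_cocycle θ.measurable
      (measurableEntries_channel hψm) N) _).inter
      (measurableSet_le (f := birkhoffSum θ (supAbs f) N) ?_ measurable_const)
    exact Finset.measurable_sum _ fun j _ => (measurable_supAbs hf).comp (θ.measurable.iterate j)
  filter_upwards [hθ.ae_frequently_mem hm hk, hθ.symm.ae_frequently_mem hm hk] with ω h1 h2
  exact ⟨h2, h1⟩

theorem PairBounds.le_const [NeZero d] {A : SuperOp d} {a b : ℝ} (h : PairBounds A a b) :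
    a ≤ b := by
  have h1 := h 1 1 one_nonneg' one_nonneg'
  have h2 : (0 : ℝ) < d := by exact_mod_cast NeZero.pos d
  have h3 := h1.1.trans h1.2
  rw [reTrace_one, mul_assoc, mul_assoc] at h3
  exact le_of_mul_le_mul_right h3 (by positivity)

/-- The deformed channels in the past of `ω`. -/
noncomputable def pastSeq (θ : Ω ≃ᵐ Ω) (ψ : Ω → 𝒜 → SuperOp d) (f : Ω → 𝒜 → ℝ) (ω : Ω) (α : ℝ)
    (k : ℕ) : SuperOp d := deformedChannel ψ f α (θ.symm^[k + 1] ω)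

/-- The adjoints of the deformed channels in the future of `ω`. -/
noncomputable def futureSeq (θ : Ω ≃ᵐ Ω) (ψ : Ω → 𝒜 → SuperOp d) (f : Ω → 𝒜 → ℝ) (ω : Ω) (α : ℝ)
    (k : ℕ) : SuperOp d := hsAdjoint (deformedChannel ψ f α (θ^[k] ω))

/-- The equivariant state determined by the past. -/
noncomputable def pastDir (θ : Ω ≃ᵐ Ω) (ψ : Ω → 𝒜 → SuperOp d) (f : Ω → 𝒜 → ℝ) (ω : Ω) (α : ℝ) :
    Op d := limDir (pastSeq θ ψ f ω α)

/-- The equivariant dual state determined by the future. -/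
noncomputable def futureDir (θ : Ω ≃ᵐ Ω) (ψ : Ω → 𝒜 → SuperOp d) (f : Ω → 𝒜 → ℝ) (ω : Ω) (α : ℝ) :
    Op d := limDir (futureSeq θ ψ f ω α)

omit [MeasurableSpace Ω] in
theorem continuous_deformedChannel_apply (ψ : Ω → 𝒜 → SuperOp d) (f : Ω → 𝒜 → ℝ) (ω : Ω)
    {X : ℝ → Op d} (hX : Continuous X) : Continuous fun α => deformedChannel ψ f α ω (X α) := by
  simp only [deformedChannel_apply]
  refine continuous_finsetSum _ fun a _ => ?_
  have h1 : Continuous fun α : ℝ => Real.exp (-α * f ω a) := by fun_prop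
  exact h1.smul ((LinearMap.continuous_of_finiteDimensional (ψ ω a)).comp hX)

omit [MeasurableSpace Ω] in
theorem continuous_hsAdjoint_deformedChannel_apply (ψ : Ω → 𝒜 → SuperOp d) (f : Ω → 𝒜 → ℝ) (ω : Ω)
    {X : ℝ → Op d} (hX : Continuous X) :
    Continuous fun α => hsAdjoint (deformedChannel ψ f α ω) (X α) := by
  refine continuous_pi fun i => continuous_pi fun j => ?_
  simp only [hsAdjoint, LinearMap.coe_mk, AddHom.coe_mk, Matrix.of_apply]
  exact Continuous.matrix_trace ((Continuous.matrix_conjTranspose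
    (continuous_deformedChannel_apply ψ f ω continuous_const)).matrix_mul hX)

section Recurrent

variable {θ : Ω ≃ᵐ Ω} {ψ : Ω → 𝒜 → SuperOp d} {f : Ω → 𝒜 → ℝ}
  (hψ : ∀ ω, IsIrreducibleInstrument (ψ ω)) {N : ℕ} {ε R : ℝ} (hε : 0 < ε) {ω : Ω}
  (hω : IsRecurrent θ (regularSet θ ψ f N ε R) ω)
include hψ

theorem isNondegenerate_pastSeq (ω : Ω) (α : ℝ) (k : ℕ) :
    IsNondegenerate (pastSeq θ ψ f ω α k) := isNondegenerate_deformedChannel hψ α _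

theorem isNondegenerate_futureSeq [NeZero d] (ω : Ω) (α : ℝ) (k : ℕ) :
    IsNondegenerate (futureSeq θ ψ f ω α k) := isNondegenerate_hsAdjoint_deformedChannel hψ α _

include hε hω

theorem contractsBy_pastSeq [NeZero d] (A δ : ℝ) (hδ : δ > 0) :
    ∃ n, ∀ α : Set.Icc (-A) A, ContractsBy (pastSeq θ ψ f ω α) n δ := by
  rcases isEmpty_or_nonempty (Set.Icc (-A) A) with h | ⟨⟨α₀⟩⟩
  · exact ⟨0, fun α => h.elim α⟩
  have key : ∀ m, ∃ j ≥ m, ∀ α : Set.Icc (-A) A,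
      PairBounds (backComp (pastSeq θ ψ f ω α) j N) (Real.exp (-(A * R)) * ε)
        (Real.exp (A * R)) := by
    intro m
    obtain ⟨n, hn, hnG⟩ := hω.past.forall_exists_of_atTop (m + N)
    -- The `N` steps starting at `θ^{-n} ω` have the indices `n - N, …, n - 1` in the past sequence.
    refine ⟨n - N, by omega, fun α => ?_⟩
    have := backComp_symm (φ := deformedChannel ψ f α) (θ := θ) (n - N) N ω
    rw [Nat.sub_add_cancel (by omega)] at this
    unfold pastSeq
    rw [this]
    exact pairBounds_cocycle_deformedChannel hψ hnG.1 hnG.2 (abs_le.2 α.2)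
  refine exists_contractsBy_of_pairBounds
    (fun α : Set.Icc (-A) A => isNondegenerate_pastSeq hψ ω α)
    (by positivity) ?_ key hδ
  obtain ⟨j, -, hj⟩ := key 0
  exact (hj α₀).le_const

theorem contractsBy_futureSeq [NeZero d] (A δ : ℝ) (hδ : δ > 0) :
    ∃ n, ∀ α : Set.Icc (-A) A, ContractsBy (futureSeq θ ψ f ω α) n δ := by
  rcases isEmpty_or_nonempty (Set.Icc (-A) A) with h | ⟨⟨α₀⟩⟩
  · exact ⟨0, fun α => h.elim α⟩
  have key : ∀ m, ∃ j ≥ m, ∀ α : Set.Icc (-A) A,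
      PairBounds (backComp (futureSeq θ ψ f ω α) j N) (Real.exp (-(A * R)) * ε)
        (Real.exp (A * R)) := by
    intro m
    obtain ⟨n, hn, hnG⟩ := hω.future.forall_exists_of_atTop m
    refine ⟨n, hn, fun α => ?_⟩
    unfold futureSeq
    rw [backComp_hsAdjoint (φ := deformedChannel ψ f α) (θ := θ) n N ω]
    exact (pairBounds_cocycle_deformedChannel hψ hnG.1 hnG.2 (abs_le.2 α.2)).hsAdjoint
      (isNondegenerate_cocycle (isNondegenerate_deformedChannel hψ _) _ _).pos
  refine exists_contractsBy_of_pairBounds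
    (fun α : Set.Icc (-A) A => isNondegenerate_futureSeq hψ ω α)
    (by positivity) ?_ key hδ
  obtain ⟨j, -, hj⟩ := key 0
  exact (hj α₀).le_const

theorem contractsBy_pastSeq' [NeZero d] (α δ : ℝ) (hδ : δ > 0) :
    ∃ n, ContractsBy (pastSeq θ ψ f ω α) n δ := by
  obtain ⟨n, hn⟩ := contractsBy_pastSeq hψ hε hω |α| δ hδ
  exact ⟨n, hn ⟨α, neg_abs_le α, le_abs_self α⟩⟩

theorem contractsBy_futureSeq' [NeZero d] (α δ : ℝ) (hδ : δ > 0) :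
    ∃ n, ContractsBy (futureSeq θ ψ f ω α) n δ := by
  obtain ⟨n, hn⟩ := contractsBy_futureSeq hψ hε hω |α| δ hδ
  exact ⟨n, hn ⟨α, neg_abs_le α, le_abs_self α⟩⟩

theorem pastDir_mem [NeZero d] (α : ℝ) : pastDir θ ψ f ω α ∈ densityMatrices d :=
  limDir_mem (isNondegenerate_pastSeq hψ ω α) (contractsBy_pastSeq' hψ hε hω α)

theorem futureDir_mem [NeZero d] (α : ℝ) : futureDir θ ψ f ω α ∈ densityMatrices d :=
  limDir_mem (isNondegenerate_futureSeq hψ ω α) (contractsBy_futureSeq' hψ hε hω α)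

theorem continuous_pastDir [NeZero d] : Continuous (pastDir θ ψ f ω) :=
  continuous_limDir (fun α => isNondegenerate_pastSeq hψ ω α)
    (fun _ _ hX => continuous_deformedChannel_apply ψ f _ hX) (contractsBy_pastSeq hψ hε hω)

theorem continuous_futureDir [NeZero d] : Continuous (futureDir θ ψ f ω) :=
  continuous_limDir (fun α => isNondegenerate_futureSeq hψ ω α)
    (fun _ _ hX => continuous_hsAdjoint_deformedChannel_apply ψ f _ hX)
    (contractsBy_futureSeq hψ hε hω)

/-- The past of `θ ω` is the past of `ω` with the map at `ω` added in front. -/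
theorem deformedChannel_pastDir [NeZero d] (α : ℝ) :
    deformedChannel ψ f α ω (pastDir θ ψ f ω α) =
      reTrace (deformedChannel ψ f α ω (pastDir θ ψ f ω α)) • pastDir θ ψ f (θ ω) α := by
  have h0 : pastSeq θ ψ f (θ ω) α 0 = deformedChannel ψ f α ω := by
    simp [pastSeq]
  have h1 : (fun k => pastSeq θ ψ f (θ ω) α (k + 1)) = pastSeq θ ψ f ω α := by
    funext k
    simp [pastSeq]
  have := apply_limDir_shift (isNondegenerate_pastSeq (f := f) (θ := θ) hψ (θ ω) α)
    (contractsBy_pastSeq' hψ hε hω.apply α) (by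
      rw [h1]
      exact contractsBy_pastSeq' hψ hε hω α)
  rwa [h0, h1] at this

/-- The future of `ω` is the map at `ω` followed by the future of `θ ω`. -/
theorem hsAdjoint_futureDir [NeZero d] (α : ℝ) :
    hsAdjoint (deformedChannel ψ f α ω) (futureDir θ ψ f (θ ω) α) =
      reTrace (hsAdjoint (deformedChannel ψ f α ω) (futureDir θ ψ f (θ ω) α)) •
        futureDir θ ψ f ω α := by
  have h0 : futureSeq θ ψ f ω α 0 = hsAdjoint (deformedChannel ψ f α ω) := rfl
  have h1 : (fun k => futureSeq θ ψ f ω α (k + 1)) = futureSeq θ ψ f (θ ω) α := rfl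
  have := apply_limDir_shift (isNondegenerate_futureSeq (f := f) (θ := θ) hψ ω α)
    (contractsBy_futureSeq' hψ hε hω α) (by
      rw [h1]
      exact contractsBy_futureSeq' hψ hε hω.apply α)
  rwa [h0, h1] at this

end Recurrent

end QMP

/-! ### The induced trace norm is comparable with the trace of the image of `1` -/

namespace QMP

variable {d : ℕ}

section TraceNorm

theorem sum_eigenvalues_conjTranspose_mul_self (X : Op d) :
    ∑ i, (Matrix.isHermitian_conjTranspose_mul_self X).eigenvalues i = reTrace (Xᴴ * X) := by
  rw [reTrace, (Matrix.isHermitian_conjTranspose_mul_self X).trace_eq_sum_eigenvalues]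
  simp

/-- Each singular value is at most the Hilbert–Schmidt norm, hence at most `d m`. Constants
depending on `d` are harmless for exponential rates, so they are left crude here and below. -/
theorem traceNorm_le {X : Op d} {m : ℝ} (hm : 0 ≤ m) (h : ∀ i j, ‖X i j‖ ≤ m) :
    traceNorm X ≤ d * (d * m) := by
  have h1 : reTrace (Xᴴ * X) ≤ (d * m) ^ 2 := by
    rw [reTrace_conjTranspose_mul_self]
    refine (Finset.sum_le_sum fun j _ => Finset.sum_le_sum fun i _ =>
      pow_le_pow_left₀ (norm_nonneg _) (h i j) 2).trans (le_of_eq ?_)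
    simp
    ring
  have h2 : ∀ i, Real.sqrt ((Matrix.isHermitian_conjTranspose_mul_self X).eigenvalues i)
      ≤ d * m := by
    intro i
    rw [Real.sqrt_le_left (by positivity)]
    refine le_trans ?_ h1
    rw [← sum_eigenvalues_conjTranspose_mul_self]
    exact Finset.single_le_sum (f := (Matrix.isHermitian_conjTranspose_mul_self X).eigenvalues)
      (fun j _ => Matrix.eigenvalues_conjTranspose_mul_self_nonneg X j) (Finset.mem_univ i)
  refine (Finset.sum_le_sum fun i _ => h2 i).trans (le_of_eq ?_)
  simp

theorem norm_apply_le_traceNorm (X : Op d) (i j : Fin d) : ‖X i j‖ ≤ traceNorm X := by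
  have h0 : ∀ i, 0 ≤ Real.sqrt ((Matrix.isHermitian_conjTranspose_mul_self X).eigenvalues i) :=
    fun i => Real.sqrt_nonneg _
  refine (sq_le_sq₀ (norm_nonneg _) (Finset.sum_nonneg fun i _ => h0 i)).1
    ((norm_apply_sq_le X i j).trans ?_)
  rw [← sum_eigenvalues_conjTranspose_mul_self]
  refine le_trans (le_of_eq (Finset.sum_congr rfl fun i _ => ?_))
    (Finset.sum_sq_le_sq_sum_of_nonneg fun i _ => h0 i)
  rw [Real.sq_sqrt (Matrix.eigenvalues_conjTranspose_mul_self_nonneg X i)]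

theorem abs_pair_le {X Y : Op d} (hY : 0 ≤ Y) (h : ∀ i j, ‖X i j‖ ≤ 1) :
    |pair Y X| ≤ d ^ 2 * reTrace Y := by
  refine (Complex.abs_re_le_norm _).trans ?_
  simp only [Matrix.trace, Matrix.diag, Matrix.mul_apply]
  have h1 : ∀ i j, ‖Y i j * X j i‖ ≤ reTrace Y := by
    intro i j
    rw [norm_mul]
    exact (mul_le_of_le_one_right (norm_nonneg _) (h j i)).trans (norm_apply_le hY i j)
  refine (norm_sum_le _ _).trans ((Finset.sum_le_sum fun i _ => (norm_sum_le _ _).trans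
    (Finset.sum_le_sum fun j _ => h1 i j)).trans (le_of_eq ?_))
  simp
  ring

/-- From `-d² 1 ≤ X ≤ d² 1` the matrix `A X + d² A 1` is positive semidefinite of trace at most `2
d² tr (A 1)`. Subtracting `d² A 1` again brings the constant to 3. -/
theorem IsPos.norm_apply_le_of_isHermitian {A : SuperOp d} (hA : IsPos A) {X : Op d}
    (hX : X.IsHermitian) (h : ∀ i j, ‖X i j‖ ≤ 1) (i j : Fin d) :
    ‖A X i j‖ ≤ 3 * d ^ 2 * reTrace (A 1) := by
  have h1 : X ≤ (d ^ 2 : ℝ) • (1 : Op d) := le_of_pair_le hX (isHermitian_smul_one _)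
    fun Y hY => by simpa using (abs_le.1 (abs_pair_le hY h)).2
  have h2 : -((d ^ 2 : ℝ) • (1 : Op d)) ≤ X := by
    rw [← neg_smul]
    exact le_of_pair_le (isHermitian_smul_one _) hX
      fun Y hY => by
        rw [pair_smul, pair_one_right, neg_mul]
        exact (abs_le.1 (abs_pair_le hY h)).1
  have h3 : 0 ≤ A X + (d ^ 2 : ℝ) • A 1 := by
    rw [← map_real_smul, ← map_add]
    refine hA _ ?_
    rwa [neg_le_iff_add_nonneg] at h2
  have h4 : A X ≤ (d ^ 2 : ℝ) • A 1 := by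
    rw [← map_real_smul]
    exact hA.mono h1
  have hA1 := hA 1 one_nonneg'
  have h5 := norm_apply_le h3 i j
  have h6 := norm_apply_le hA1 i j
  have h7 := reTrace_mono h4
  rw [reTrace_add, reTrace_smul] at h5
  rw [reTrace_smul] at h7
  have h8 : A X i j = (A X + (d ^ 2 : ℝ) • A 1) i j - ((d ^ 2 : ℝ) : ℂ) * A 1 i j := by simp
  rw [h8]
  refine (_root_.norm_sub_le _ _).trans ?_
  rw [norm_mul, Complex.norm_real, Real.norm_eq_abs, abs_of_nonneg (by positivity)]
  have h9 := mul_le_mul_of_nonneg_left h6 (show (0 : ℝ) ≤ d ^ 2 by positivity)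
  linarith

/-- Splitting into Hermitian and skew-Hermitian parts doubles the constant. -/
theorem IsPos.norm_apply_le {A : SuperOp d} (hA : IsPos A) {X : Op d}
    (h : ∀ i j, ‖X i j‖ ≤ 1) (i j : Fin d) : ‖A X i j‖ ≤ 6 * d ^ 2 * reTrace (A 1) := by
  set H : Op d := (2⁻¹ : ℂ) • (X + Xᴴ) with hH
  set K : Op d := (Complex.I / 2) • (Xᴴ - X) with hK
  have hXHK : X = H + Complex.I • K := by
    rw [hH, hK, smul_smul]
    ext i j
    simp only [Matrix.add_apply, Matrix.smul_apply, Matrix.sub_apply, smul_eq_mul]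
    linear_combination (-(1 / 2) * (Xᴴ i j - X i j)) * Complex.I_sq
  have hHh : H.IsHermitian := by
    rw [Matrix.IsHermitian, hH, Matrix.conjTranspose_smul, Matrix.conjTranspose_add,
      Matrix.conjTranspose_conjTranspose, add_comm]
    simp
  have hKh : K.IsHermitian := by
    rw [Matrix.IsHermitian, hK, Matrix.conjTranspose_smul, Matrix.conjTranspose_sub,
      Matrix.conjTranspose_conjTranspose, ← neg_sub, smul_neg, ← neg_smul]
    simp [neg_div]
  have hHn : ∀ i j, ‖H i j‖ ≤ 1 := by
    intro i j
    have h1 := (norm_add_le (X i j) (Xᴴ i j)).trans (add_le_add (h i j)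
      ((norm_star (X j i)).le.trans (h j i)))
    simp only [hH, Matrix.smul_apply, Matrix.add_apply, smul_eq_mul, norm_mul, norm_inv,
      Complex.norm_ofNat]
    linarith
  have hKn : ∀ i j, ‖K i j‖ ≤ 1 := by
    intro i j
    have h1 := (_root_.norm_sub_le (Xᴴ i j) (X i j)).trans (add_le_add
      ((norm_star (X j i)).le.trans (h j i)) (h i j))
    simp only [hK, Matrix.smul_apply, Matrix.sub_apply, smul_eq_mul, norm_mul, norm_div,
      Complex.norm_ofNat, Complex.norm_I]
    linarith
  clear_value H K
  have e : A X i j = A H i j + Complex.I * A K i j := by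
    conv_lhs => rw [hXHK, map_add, map_smul]
    simp
  rw [e]
  refine (norm_add_le _ _).trans ?_
  rw [norm_mul, Complex.norm_I, one_mul]
  linarith [hA.norm_apply_le_of_isHermitian hHh hHn i j,
    hA.norm_apply_le_of_isHermitian hKh hKn i j]

theorem IsPos.traceNorm_apply_le {A : SuperOp d} (hA : IsPos A) {X : Op d} (hX : traceNorm X ≤ 1) :
    traceNorm (A X) ≤ 6 * d ^ 4 * reTrace (A 1) := by
  have h := reTrace_nonneg (hA 1 one_nonneg')
  refine (traceNorm_le (by positivity) fun i j => hA.norm_apply_le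
    (fun i j => (norm_apply_le_traceNorm X i j).trans hX) i j).trans (le_of_eq ?_)
  ring

theorem traceNorm_zero : traceNorm (0 : Op d) ≤ 0 := by
  simpa using traceNorm_le (X := (0 : Op d)) le_rfl (by simp)

theorem IsPos.opNorm_le {A : SuperOp d} (hA : IsPos A) :
    opNorm A ≤ 6 * d ^ 4 * reTrace (A 1) := by
  refine csSup_le ⟨_, 0, traceNorm_zero.trans zero_le_one, rfl⟩ ?_
  rintro _ ⟨X, hX, rfl⟩
  exact hA.traceNorm_apply_le hX

theorem IsPos.reTrace_apply_one_le [NeZero d] {A : SuperOp d} (hA : IsPos A) :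
    reTrace (A 1) ≤ d ^ 3 * opNorm A := by
  have hd : (0 : ℝ) < d := by exact_mod_cast NeZero.pos d
  -- The factor `d⁻²` is what the crude bound `d (d m)` needs for the scaled identity to be an
  -- admissible test matrix.
  have h1 : traceNorm (((d : ℝ) ^ 2)⁻¹ • (1 : Op d)) ≤ 1 := by
    refine (traceNorm_le (m := ((d : ℝ) ^ 2)⁻¹) (by positivity) fun i j => ?_).trans (le_of_eq ?_)
    · rw [Matrix.smul_apply, norm_smul, Real.norm_eq_abs, abs_of_pos (by positivity)]
      refine mul_le_of_le_one_right (by positivity) ?_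
      rw [Matrix.one_apply]
      split_ifs <;> simp
    · field_simp
  have h2 : traceNorm (A (((d : ℝ) ^ 2)⁻¹ • 1)) ≤ opNorm A := by
    refine le_csSup ⟨6 * d ^ 4 * reTrace (A 1), ?_⟩ ⟨_, h1, rfl⟩
    rintro _ ⟨X, hX, rfl⟩
    exact hA.traceNorm_apply_le hX
  have h3 : reTrace (A (((d : ℝ) ^ 2)⁻¹ • 1)) ≤ d * traceNorm (A (((d : ℝ) ^ 2)⁻¹ • 1)) := by
    refine (Complex.abs_re_le_norm _).trans' (le_abs_self _) |>.trans ?_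
    refine (norm_sum_le _ _).trans ((Finset.sum_le_sum fun i _ =>
      norm_apply_le_traceNorm _ i i).trans (le_of_eq ?_))
    simp
  rw [map_real_smul, reTrace_smul] at h3
  rw [map_real_smul] at h2
  have h4 := h3.trans (mul_le_mul_of_nonneg_left h2 hd.le)
  rw [inv_mul_le_iff₀ (by positivity)] at h4
  linarith

end TraceNorm

theorem tendsto_log_of_comparable {u w : ℕ → ℝ} {l C : ℝ} (hu : ∀ n, 0 < u n)
    (hw : ∀ᶠ n in atTop, 0 < w n) (hC : 0 < C) (h1 : ∀ᶠ n in atTop, u n ≤ C * w n)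
    (h2 : ∀ᶠ n in atTop, w n ≤ C * u n)
    (h : Tendsto (fun n : ℕ => 1 / (n : ℝ) * Real.log (u n)) atTop (𝓝 l)) :
    Tendsto (fun n : ℕ => 1 / (n : ℝ) * Real.log (w n)) atTop (𝓝 l) := by
  have hz : Tendsto (fun n : ℕ => 1 / (n : ℝ) * Real.log C) atTop (𝓝 0) := by
    simpa using tendsto_one_div_atTop_nhds_zero_nat.mul_const (Real.log C)
  have hlo := h.sub hz
  have hup := h.add hz
  rw [sub_zero] at hlo
  rw [add_zero] at hup
  refine tendsto_of_tendsto_of_tendsto_of_le_of_le' hlo hup ?_ ?_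
  · filter_upwards [hw, h1] with n hn h3
    rw [← mul_sub]
    refine mul_le_mul_of_nonneg_left ?_ (by positivity)
    have := Real.log_le_log (hu n) h3
    rw [Real.log_mul hC.ne' hn.ne'] at this
    linarith
  · filter_upwards [hw, h2] with n hn h3
    rw [← mul_add]
    refine mul_le_mul_of_nonneg_left ?_ (by positivity)
    have := Real.log_le_log hn h3
    rw [Real.log_mul hC.ne' (hu n).ne'] at this
    linarith

end QMP

/-! ### The Lyapunov exponent -/

namespace QMP

variable {d : ℕ} {Ω 𝒜 : Type*} [Fintype 𝒜] [MeasurableSpace Ω]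

/-- The one-step logarithmic growth rate along the equivariant state. -/
noncomputable def growth (θ : Ω ≃ᵐ Ω) (ψ : Ω → 𝒜 → SuperOp d) (f : Ω → 𝒜 → ℝ) (α : ℝ) (ω : Ω) : ℝ :=
  Real.log (reTrace (deformedChannel ψ f α ω (pastDir θ ψ f ω α)))

/-- The top Lyapunov exponent of the deformed cocycle. -/
noncomputable def lyapunov (P : Measure Ω) (θ : Ω ≃ᵐ Ω) (ψ : Ω → 𝒜 → SuperOp d) (f : Ω → 𝒜 → ℝ)
    (α : ℝ) : ℝ := ∫ ω, growth θ ψ f α ω ∂P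

section Recurrent

variable {θ : Ω ≃ᵐ Ω} {ψ : Ω → 𝒜 → SuperOp d} {f : Ω → 𝒜 → ℝ}
  (hψ : ∀ ω, IsIrreducibleInstrument (ψ ω)) {N : ℕ} {ε R : ℝ} (hε : 0 < ε) {ω : Ω}
  (hω : IsRecurrent θ (regularSet θ ψ f N ε R) ω)
include hψ hε hω

theorem reTrace_deformedChannel_pastDir_bounds [NeZero d] (α : ℝ) :
    Real.exp (-(|α| * supAbs f ω)) ≤ reTrace (deformedChannel ψ f α ω (pastDir θ ψ f ω α)) ∧
      reTrace (deformedChannel ψ f α ω (pastDir θ ψ f ω α)) ≤ Real.exp (|α| * supAbs f ω) := by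
  have hZ := mem_densityMatrices.1 (pastDir_mem hψ hε hω α)
  have h1 := le_reTrace_deformedChannel (f := f) hψ α ω hZ.1
  have h2 := reTrace_deformedChannel_le (f := f) hψ α ω hZ.1
  rw [hZ.2, mul_one] at h1 h2
  exact ⟨h1, h2⟩

theorem abs_growth_le [NeZero d] (α : ℝ) : |growth θ ψ f α ω| ≤ |α| * supAbs f ω := by
  obtain ⟨h1, h2⟩ := reTrace_deformedChannel_pastDir_bounds hψ hε hω α
  have h0 := (Real.exp_pos _).trans_le h1
  rw [growth, abs_le]
  exact ⟨(Real.le_log_iff_exp_le h0).2 h1, (Real.log_le_iff_le_exp h0).2 h2⟩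

theorem cocycle_pastDir [NeZero d] (α : ℝ) (n : ℕ) :
    cocycle θ (deformedChannel ψ f α) n ω (pastDir θ ψ f ω α) =
      Real.exp (birkhoffSum θ (growth θ ψ f α) n ω) • pastDir θ ψ f (θ^[n] ω) α := by
  induction n with
  | zero => simp [cocycle]
  | succ n ih =>
    have hn := hω.iterate n
    have h0 := (Real.exp_pos _).trans_le (reTrace_deformedChannel_pastDir_bounds hψ hε hn α).1
    rw [cocycle, LinearMap.comp_apply, ih, map_real_smul, deformedChannel_pastDir hψ hε hn α,
      smul_smul, birkhoffSum_succ, Real.exp_add, growth, Real.exp_log h0,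
      Function.iterate_succ_apply']

theorem reTrace_cocycle_pastDir [NeZero d] (α : ℝ) (n : ℕ) :
    reTrace (cocycle θ (deformedChannel ψ f α) n ω (pastDir θ ψ f ω α)) =
      Real.exp (birkhoffSum θ (growth θ ψ f α) n ω) := by
  rw [cocycle_pastDir hψ hε hω, reTrace_smul,
    (mem_densityMatrices.1 (pastDir_mem hψ hε (hω.iterate n) α)).2, mul_one]

/-- After the first good block the images of both states lie between fixed multiples of `1`, and the
later maps preserve the order. So `K` depends on `ω` and `α`, but not on `n` or the states. -/
theorem exists_reTrace_cocycle_le (α : ℝ) : ∃ K > 0, ∃ n₀, ∀ n ≥ n₀,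
    ∀ ρ ∈ densityMatrices d, ∀ ρ' ∈ densityMatrices d,
      reTrace (cocycle θ (deformedChannel ψ f α) n ω ρ) ≤
        K * reTrace (cocycle θ (deformedChannel ψ f α) n ω ρ') := by
  obtain ⟨j, -, hj⟩ := hω.future.forall_exists_of_atTop 0
  have hb := pairBounds_cocycle_deformedChannel hψ hj.1 hj.2 (le_refl |α|)
  set a := Real.exp (-(|α| * R)) * ε with ha
  have ha0 : 0 < a := by positivity
  set b := Real.exp (|α| * R) with hb'
  set s := |α| * birkhoffSum θ (supAbs f) j ω with hs
  have hnd := isNondegenerate_cocycle (θ := θ) (isNondegenerate_deformedChannel (f := f) hψ α)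
  refine ⟨b * Real.exp s / (a * Real.exp (-s)), by positivity, j + N,
    fun n hn ρ hρ ρ' hρ' => ?_⟩
  obtain ⟨k, rfl⟩ := Nat.exists_eq_add_of_le hn
  rw [mem_densityMatrices] at hρ hρ'
  have t := (reTrace_cocycle_deformedChannel_bounds (θ := θ) (f := f) hψ α j ω hρ.1).2
  have t' := (reTrace_cocycle_deformedChannel_bounds (θ := θ) (f := f) hψ α j ω hρ'.1).1
  rw [hρ.2, mul_one] at t
  rw [hρ'.2, mul_one] at t'
  have u := (hb.le (hnd _ _).pos ((hnd j ω).pos _ hρ.1)).2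
  have u' := (hb.le (hnd _ _).pos ((hnd j ω).pos _ hρ'.1)).1
  have v : cocycle θ (deformedChannel ψ f α) N (θ^[j] ω)
      (cocycle θ (deformedChannel ψ f α) j ω ρ) ≤ (b * Real.exp s) • (1 : Op d) :=
    u.trans (smul_le_smul_of_nonneg_right
      (mul_le_mul_of_nonneg_left t (Real.exp_pos _).le) one_nonneg')
  have v' : (a * Real.exp (-s)) • (1 : Op d) ≤ cocycle θ (deformedChannel ψ f α) N (θ^[j] ω)
      (cocycle θ (deformedChannel ψ f α) j ω ρ') :=
    (smul_le_smul_of_nonneg_right (mul_le_mul_of_nonneg_left t' ha0.le) one_nonneg').trans u'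
  have w := reTrace_mono ((hnd k (θ^[j + N] ω)).pos.mono v)
  have w' := reTrace_mono ((hnd k (θ^[j + N] ω)).pos.mono v')
  rw [map_real_smul, reTrace_smul] at w w'
  rw [cocycle_add (j + N) k, cocycle_add j N]
  simp only [LinearMap.comp_apply]
  refine w.trans ?_
  have w'' := mul_le_mul_of_nonneg_left w'
    (show 0 ≤ b * Real.exp s / (a * Real.exp (-s)) by positivity)
  refine le_trans (le_of_eq ?_) w''
  have : a * Real.exp (-s) ≠ 0 := by positivity
  rw [← mul_assoc, div_mul_cancel₀ _ this]

theorem exists_hsAdjoint_cocycle_futureDir [NeZero d] (α : ℝ) (n : ℕ) : ∃ C : ℝ, 0 < C ∧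
    hsAdjoint (cocycle θ (deformedChannel ψ f α) n ω) (futureDir θ ψ f (θ^[n] ω) α) =
      C • futureDir θ ψ f ω α := by
  induction n with
  | zero => exact ⟨1, one_pos, by simp [cocycle, hsAdjoint_id]⟩
  | succ n ih =>
    obtain ⟨C, hC, h⟩ := ih
    have hn := hω.iterate n
    have hW := futureDir_mem hψ hε hn.apply α
    have hnd := isNondegenerate_hsAdjoint_deformedChannel (f := f) hψ α (θ^[n] ω)
    have h1 := hsAdjoint_futureDir hψ hε hn α
    have h2 := reTrace_pos (hnd.pos _ (mem_densityMatrices.1 hW).1)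
      (hnd.ne_zero _ (mem_densityMatrices.1 hW).1 (ne_zero_of_mem_densityMatrices hW))
    generalize reTrace (hsAdjoint (deformedChannel ψ f α (θ^[n] ω))
      (futureDir θ ψ f (θ (θ^[n] ω)) α)) = c at h1 h2
    refine ⟨c * C, mul_pos h2 hC, ?_⟩
    rw [cocycle, hsAdjoint_comp, LinearMap.comp_apply, Function.iterate_succ_apply', h1,
      map_real_smul, h, smul_smul]

/-- Pulling `W` back from time `j + N`, the pairing is a positive multiple of the pairing of `W` at
that time with the evolved `Z`, whose last `N` steps form a uniformly positive block. -/
theorem pair_futureDir_pastDir_pos [NeZero d] (α : ℝ) :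
    0 < pair (futureDir θ ψ f ω α) (pastDir θ ψ f ω α) := by
  obtain ⟨j, -, hj⟩ := hω.future.forall_exists_of_atTop 0
  have hb := pairBounds_cocycle_deformedChannel hψ hj.1 hj.2 (le_refl |α|)
  have hnd := isNondegenerate_cocycle (θ := θ) (isNondegenerate_deformedChannel (f := f) hψ α)
  obtain ⟨C, hC, h⟩ := exists_hsAdjoint_cocycle_futureDir hψ hε hω α (j + N)
  have hZ := pastDir_mem hψ hε hω α
  have hZ1 := (mem_densityMatrices.1 hZ).1
  have hW := mem_densityMatrices.1 (futureDir_mem hψ hε (hω.iterate (j + N)) α)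
  have h1 := pair_hsAdjoint (hnd (j + N) ω).pos hZ1 (futureDir θ ψ f (θ^[j + N] ω) α)
  rw [h, pair_smul, cocycle_add, LinearMap.comp_apply, pair_comm] at h1
  have h2 := (hb _ _ ((hnd j ω).pos _ hZ1) hW.1).1
  rw [hW.2, mul_one] at h2
  have h3 := reTrace_pos ((hnd j ω).pos _ hZ1)
    ((hnd j ω).ne_zero _ hZ1 (ne_zero_of_mem_densityMatrices hZ))
  have h4 : 0 < C * pair (futureDir θ ψ f ω α) (pastDir θ ψ f ω α) := by
    rw [h1]
    exact lt_of_lt_of_le (by positivity) h2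
  exact pos_of_mul_pos_right h4 hC.le

end Recurrent

section Integral

variable {P : Measure Ω} {θ : Ω ≃ᵐ Ω} {ψ : Ω → 𝒜 → SuperOp d}
  {f : Ω → 𝒜 → ℝ}
  (hψm : ∀ (a : 𝒜) (X : Op d) (i j : Fin d), Measurable fun ω => ψ ω a X i j)
  (hf : ∀ a, Measurable fun ω => f ω a)

theorem integrable_supAbs (hf : ∀ a, Measurable fun ω => f ω a)
    (hA3 : ∀ α : ℝ, Integrable (fun ω => Real.exp (α * ⨆ a, |f ω a|)) P) :
    Integrable (supAbs f) P := by
  refine (hA3 1).mono' (measurable_supAbs hf).aestronglyMeasurable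
    (Eventually.of_forall fun ω => ?_)
  rw [Real.norm_eq_abs, abs_of_nonneg (supAbs_nonneg f ω), one_mul]
  exact (le_add_of_nonneg_right zero_le_one).trans (Real.add_one_le_exp (supAbs f ω))

include hψm hf

theorem measurable_pastDir (α : ℝ) (i j : Fin d) :
    Measurable fun ω => pastDir θ ψ f ω α i j :=
  measurable_limDir (fun k X i j => (measurableEntries_deformedChannel hψm hf α X i j).comp
    (θ.symm.measurable.iterate (k + 1))) i j

theorem measurable_futureDir (α : ℝ) (i j : Fin d) :
    Measurable fun ω => futureDir θ ψ f ω α i j :=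
  measurable_limDir (fun k => MeasurableEntries.hsAdjoint fun X i j =>
    (measurableEntries_deformedChannel hψm hf α X i j).comp (θ.measurable.iterate k)) i j

theorem measurable_growth (α : ℝ) : Measurable (growth θ ψ f α) :=
  Real.measurable_log.comp (measurable_reTrace fun i j =>
    (measurableEntries_deformedChannel hψm hf α).apply
      (fun i j => measurable_pastDir hψm hf α i j) i j)

variable (hψ : ∀ ω, IsIrreducibleInstrument (ψ ω)) {N : ℕ} {ε R : ℝ} (hε : 0 < ε)
  (hrec : ∀ᵐ ω ∂P, IsRecurrent θ (regularSet θ ψ f N ε R) ω) (hF : Integrable (supAbs f) P)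
include hψ hε hrec hF

theorem integrable_growth [NeZero d] (α : ℝ) : Integrable (growth θ ψ f α) P := by
  refine (hF.const_mul |α|).mono' (measurable_growth hψm hf α).aestronglyMeasurable ?_
  filter_upwards [hrec] with ω hω using abs_growth_le hψ hε hω α

/-- Along `Z` the logarithm of the trace is exactly a Birkhoff sum, and every other state is
comparable with `Z`. The exceptional set therefore does not depend on `ρ`. -/
theorem ae_tendsto_log_reTrace_cocycle [NeZero d] [IsProbabilityMeasure P] (hθ : Ergodic θ P)
    (α : ℝ) :
    ∀ᵐ ω ∂P, ∀ ρ ∈ densityMatrices d, Tendsto (fun n : ℕ => 1 / (n : ℝ) *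
      Real.log (reTrace (cocycle θ (deformedChannel ψ f α) n ω ρ))) atTop
      (𝓝 (lyapunov P θ ψ f α)) := by
  filter_upwards [hrec, hθ.ae_tendsto_birkhoffSum (integrable_growth hψm hf hψ hε hrec hF α)]
    with ω hω hlim ρ hρ
  obtain ⟨K, hK, n₀, h⟩ := exists_reTrace_cocycle_le hψ hε hω α
  have hnd := isNondegenerate_cocycle (θ := θ) (isNondegenerate_deformedChannel (f := f) hψ α)
  have hZ := pastDir_mem hψ hε hω α
  have hpos : ∀ ρ ∈ densityMatrices d, ∀ n,
      0 < reTrace (cocycle θ (deformedChannel ψ f α) n ω ρ) := fun ρ hρ n =>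
    reTrace_pos ((hnd n ω).pos _ (mem_densityMatrices.1 hρ).1)
      ((hnd n ω).ne_zero _ (mem_densityMatrices.1 hρ).1 (ne_zero_of_mem_densityMatrices hρ))
  refine tendsto_log_of_comparable (hpos _ hZ) (Eventually.of_forall (hpos ρ hρ)) hK
    (eventually_atTop.2 ⟨n₀, fun n hn => h n hn _ hZ _ hρ⟩)
    (eventually_atTop.2 ⟨n₀, fun n hn => h n hn _ hρ _ hZ⟩) ?_
  simpa only [reTrace_cocycle_pastDir hψ hε hω, Real.log_exp, lyapunov] using hlim

theorem ae_tendsto_log_opNorm_cocycle [NeZero d] [IsProbabilityMeasure P] (hθ : Ergodic θ P)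
    (α : ℝ) :
    ∀ᵐ ω ∂P, Tendsto (fun n : ℕ => 1 / (n : ℝ) *
      Real.log (opNorm (cocycle θ (deformedChannel ψ f α) n ω))) atTop
      (𝓝 (lyapunov P θ ψ f α)) := by
  filter_upwards [ae_tendsto_log_reTrace_cocycle hψm hf hψ hε hrec hF hθ α] with ω hω
  have hd : (0 : ℝ) < d := by exact_mod_cast NeZero.pos d
  have hd1 : (1 : ℝ) ≤ d := by exact_mod_cast NeZero.pos d
  have hρ := inv_reTrace_smul_mem one_nonneg' (one_ne_zero (α := Op d))
  have hnd := isNondegenerate_cocycle (θ := θ) (isNondegenerate_deformedChannel (f := f) hψ α)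
  have hpos := fun n => reTrace_pos ((hnd n ω).pos _ (mem_densityMatrices.1 hρ).1)
      ((hnd n ω).ne_zero _ (mem_densityMatrices.1 hρ).1 (ne_zero_of_mem_densityMatrices hρ))
  have key : ∀ n, reTrace (cocycle θ (deformedChannel ψ f α) n ω 1) =
      d * reTrace (cocycle θ (deformedChannel ψ f α) n ω ((reTrace (1 : Op d))⁻¹ • 1)) := by
    intro n
    rw [map_real_smul, reTrace_smul, reTrace_one, mul_inv_cancel_left₀ hd.ne']
  have h1 : ∀ n, reTrace (cocycle θ (deformedChannel ψ f α) n ω ((reTrace (1 : Op d))⁻¹ • 1)) ≤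
      d ^ 2 * opNorm (cocycle θ (deformedChannel ψ f α) n ω) := by
    intro n
    have := (hnd n ω).pos.reTrace_apply_one_le
    rw [key, pow_succ', mul_assoc] at this
    exact le_of_mul_le_mul_left this hd
  have h2 : ∀ n, opNorm (cocycle θ (deformedChannel ψ f α) n ω) ≤ 6 * d ^ 5 *
      reTrace (cocycle θ (deformedChannel ψ f α) n ω ((reTrace (1 : Op d))⁻¹ • 1)) := by
    intro n
    have := (hnd n ω).pos.opNorm_le
    rw [key] at this
    linarith
  have hop : ∀ n, 0 < opNorm (cocycle θ (deformedChannel ψ f α) n ω) := fun n =>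
    pos_of_mul_pos_right ((hpos n).trans_le (h1 n)) (by positivity)
  have hpow : (d : ℝ) ^ 2 ≤ 6 * d ^ 5 := by
    have : (d : ℝ) ^ 2 ≤ d ^ 5 := pow_le_pow_right₀ hd1 (by norm_num)
    have h5 : (0 : ℝ) ≤ d ^ 5 := by positivity
    linarith
  refine tendsto_log_of_comparable (C := 6 * d ^ 5) hpos (Eventually.of_forall hop) (by positivity)
    (Eventually.of_forall fun n => (h1 n).trans ?_) (Eventually.of_forall h2) (hω _ hρ)
  exact mul_le_mul_of_nonneg_right hpow (hop n).le

end Integral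

end QMP

/-! ### Path expansions, tilted means and Jensen's inequality -/

namespace QMP

variable {d : ℕ}

/-- Here `X` is arbitrary, as the weighted cocycle need not produce positive semidefinite matrices.
-/
theorem pair_apply_eq {A : SuperOp d} (hA : IsPos A) {Y : Op d} (hY : 0 ≤ Y) (X : Op d) :
    pair Y (A X) = pair (hsAdjoint A Y) X := by
  have h := trace_conjTranspose_mul_hsAdjoint A X Y
  have hQ := (isHermitian_of_nonneg (hA.hsAdjoint Y hY)).eq
  have h1 : (hsAdjoint A Y * X).trace = star (Xᴴ * hsAdjoint A Y).trace := by
    rw [← Matrix.trace_conjTranspose, Matrix.conjTranspose_mul, hQ,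
      Matrix.conjTranspose_conjTranspose]
  have h2 : (Y * A X).trace = star ((A X)ᴴ * Y).trace := by
    rw [← Matrix.trace_conjTranspose, Matrix.conjTranspose_mul, (isHermitian_of_nonneg hY).eq,
      Matrix.conjTranspose_conjTranspose]
  rw [pair, pair, h1, h2, h]

theorem continuous_pair_apply {T : Type*} [TopologicalSpace T] {X Y : T → Op d}
    (hY : Continuous Y) (hX : Continuous X) : Continuous fun t => pair (Y t) (X t) :=
  Complex.continuous_re.comp (Continuous.matrix_trace (hY.matrix_mul hX))

section Paths

variable {Ω 𝒜 : Type*} {θ : Ω → Ω} {ψ : Ω → 𝒜 → SuperOp d} {f : Ω → 𝒜 → ℝ}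

/-- The sum of the values `f` along a sequence of outcomes. -/
def pathSum (θ : Ω → Ω) (f : Ω → 𝒜 → ℝ) (ω : Ω) (n : ℕ) (a : Fin n → 𝒜) : ℝ :=
  ∑ j : Fin n, f (θ^[(j : ℕ)] ω) (a j)

theorem pathSum_snoc (ω : Ω) (n : ℕ) (a : Fin n → 𝒜) (c : 𝒜) :
    pathSum θ f ω (n + 1) (Fin.snoc (α := fun _ => 𝒜) a c) = pathSum θ f ω n a + f (θ^[n] ω) c := by
  simp [pathSum, Fin.sum_univ_castSucc]

theorem trajectory_snoc (ω : Ω) (n : ℕ) (a : Fin n → 𝒜) (c : 𝒜) :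
    trajectory θ ψ ω (n + 1) (Fin.snoc (α := fun _ => 𝒜) a c) =
      ψ (θ^[n] ω) c ∘ₗ trajectory θ ψ ω n a := by
  simp [trajectory]

theorem isPos_trajectory (h : ∀ ω a, IsPos (ψ ω a)) (ω : Ω) (n : ℕ) (a : Fin n → 𝒜) :
    IsPos (trajectory θ ψ ω n a) := by
  induction n with
  | zero => exact isPos_id
  | succ n ih => exact (h _ _).comp (ih _)

variable [Fintype 𝒜]

theorem sum_fin_succ_snoc {M : Type*} [AddCommMonoid M] (n : ℕ) (g : (Fin (n + 1) → 𝒜) → M) :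
    ∑ a, g a = ∑ a : Fin n → 𝒜, ∑ c, g (Fin.snoc (α := fun _ => 𝒜) a c) := by
  rw [← Fintype.sum_equiv (Fin.snocEquiv fun _ : Fin (n + 1) => 𝒜)
    (fun q => g (Fin.snoc (α := fun _ => 𝒜) q.2 q.1)) g (fun _ => rfl),
    Fintype.sum_prod_type, Finset.sum_comm]

theorem cocycle_deformedChannel_eq_sum (α : ℝ) (ω : Ω) (n : ℕ) (X : Op d) :
    cocycle θ (deformedChannel ψ f α) n ω X =
      ∑ a, Real.exp (-α * pathSum θ f ω n a) • trajectory θ ψ ω n a X := by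
  induction n with
  | zero => simp [cocycle, trajectory, pathSum]
  | succ n ih =>
    rw [cocycle, LinearMap.comp_apply, ih, sum_fin_succ_snoc, map_sum]
    refine Finset.sum_congr rfl fun a _ => ?_
    rw [map_real_smul, deformedChannel_apply, Finset.smul_sum]
    refine Finset.sum_congr rfl fun c _ => ?_
    rw [pathSum_snoc, trajectory_snoc, LinearMap.comp_apply, smul_smul, mul_add, Real.exp_add]

/-- The `f`-weighted deformed channel, i.e. minus the derivative of the deformed channel in `α`. -/
noncomputable def weightedChannel (ψ : Ω → 𝒜 → SuperOp d) (f : Ω → 𝒜 → ℝ) (α : ℝ) (ω : Ω)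
    (X : Op d) : Op d := ∑ a, (f ω a * Real.exp (-α * f ω a)) • ψ ω a X

theorem weightedChannel_smul (α : ℝ) (ω : Ω) (c : ℝ) (X : Op d) :
    weightedChannel ψ f α ω (c • X) = c • weightedChannel ψ f α ω X := by
  simp only [weightedChannel, map_real_smul, Finset.smul_sum]
  exact Finset.sum_congr rfl fun a _ => smul_comm _ _ _

/-- The `pathSum`-weighted sum of the deformed trajectories. -/
noncomputable def weightedCocycle (θ : Ω → Ω) (ψ : Ω → 𝒜 → SuperOp d) (f : Ω → 𝒜 → ℝ) (α : ℝ)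
    (n : ℕ) (ω : Ω) (X : Op d) : Op d :=
  ∑ a, (pathSum θ f ω n a * Real.exp (-α * pathSum θ f ω n a)) • trajectory θ ψ ω n a X

/-- The product rule: the path sum gains its last term, carried by the weighted channel. -/
theorem weightedCocycle_succ (α : ℝ) (ω : Ω) (n : ℕ) (X : Op d) :
    weightedCocycle θ ψ f α (n + 1) ω X =
      deformedChannel ψ f α (θ^[n] ω) (weightedCocycle θ ψ f α n ω X) +
        weightedChannel ψ f α (θ^[n] ω) (cocycle θ (deformedChannel ψ f α) n ω X) := by
  rw [weightedCocycle, sum_fin_succ_snoc, weightedCocycle, map_sum, cocycle_deformedChannel_eq_sum,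
    weightedChannel]
  simp only [map_sum, Finset.smul_sum]
  rw [Finset.sum_comm (s := (Finset.univ : Finset 𝒜)), ← Finset.sum_add_distrib]
  refine Finset.sum_congr rfl fun a _ => ?_
  rw [map_real_smul, deformedChannel_apply, Finset.smul_sum, ← Finset.sum_add_distrib]
  refine Finset.sum_congr rfl fun c _ => ?_
  rw [pathSum_snoc, trajectory_snoc, LinearMap.comp_apply, map_real_smul, smul_smul, smul_smul,
    ← add_smul, mul_add, Real.exp_add]
  congr 1
  ring

theorem abs_pair_weightedChannel_le (hψ : ∀ ω, IsIrreducibleInstrument (ψ ω)) (α : ℝ) (ω : Ω)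
    {X Y : Op d} (hX : 0 ≤ X) (hY : 0 ≤ Y) :
    |pair Y (weightedChannel ψ f α ω X)| ≤ supAbs f ω * pair Y (deformedChannel ψ f α ω X) := by
  rw [weightedChannel, deformedChannel_apply, pair_sum, pair_sum, Finset.mul_sum]
  refine (Finset.abs_sum_le_sum_abs _ _).trans (Finset.sum_le_sum fun a _ => ?_)
  have h1 := mul_nonneg (Real.exp_pos (-α * f ω a)).le
    (pair_nonneg hY (isPos_outcome hψ ω a X hX))
  rw [pair_smul, pair_smul, mul_assoc, abs_mul, abs_of_nonneg h1]
  exact mul_le_mul_of_nonneg_right (abs_le_supAbs f ω a) h1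

theorem continuous_weightedChannel_apply (ψ : Ω → 𝒜 → SuperOp d) (f : Ω → 𝒜 → ℝ) (ω : Ω)
    {X : ℝ → Op d} (hX : Continuous X) : Continuous fun α => weightedChannel ψ f α ω (X α) := by
  refine continuous_finsetSum _ fun a _ => ?_
  have h1 : Continuous fun α : ℝ => f ω a * Real.exp (-α * f ω a) := by fun_prop
  exact h1.smul ((LinearMap.continuous_of_finiteDimensional (ψ ω a)).comp hX)

/-- Jensen's inequality for the deformation parameter. -/
theorem mul_exp_le_pair_cocycle (hψ : ∀ ω, IsIrreducibleInstrument (ψ ω)) (α β : ℝ) (n : ℕ) (ω : Ω)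
    {X Y : Op d} (hX : 0 ≤ X) (hY : 0 ≤ Y) {m : ℝ}
    (hm : pair Y (weightedCocycle θ ψ f α n ω X) =
      pair Y (cocycle θ (deformedChannel ψ f α) n ω X) * m) :
    pair Y (cocycle θ (deformedChannel ψ f α) n ω X) * Real.exp (-(β - α) * m) ≤
      pair Y (cocycle θ (deformedChannel ψ f β) n ω X) := by
  rw [cocycle_deformedChannel_eq_sum] at hm
  rw [cocycle_deformedChannel_eq_sum, cocycle_deformedChannel_eq_sum]
  rw [weightedCocycle] at hm
  simp only [pair_sum, pair_smul] at hm ⊢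
  set w : (Fin n → 𝒜) → ℝ := fun a => pair Y (trajectory θ ψ ω n a X) with hw
  have hw0 : ∀ a, 0 ≤ w a := fun a =>
    pair_nonneg hY (isPos_trajectory (isPos_outcome hψ) ω n a X hX)
  set S := pathSum θ f ω n with hS
  -- The tangent line to `exp` at `-(β - α) m`. Its linear term vanishes after summation because `m`
  -- is the weighted mean of `S`.
  have h1 : ∀ a, Real.exp (-α * S a) * w a * Real.exp (-(β - α) * m) +
      (-(β - α) * Real.exp (-(β - α) * m)) * (S a * Real.exp (-α * S a) * w a -
        Real.exp (-α * S a) * w a * m) ≤ Real.exp (-β * S a) * w a := by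
    intro a
    have h2 := Real.add_one_le_exp (-(β - α) * S a - -(β - α) * m)
    have h3 : Real.exp (-β * S a) = Real.exp (-α * S a) * (Real.exp (-(β - α) * m) *
        Real.exp (-(β - α) * S a - -(β - α) * m)) := by
      rw [← Real.exp_add, ← Real.exp_add]
      ring_nf
    rw [h3]
    have h4 := mul_le_mul_of_nonneg_left h2 (mul_nonneg (mul_nonneg (Real.exp_pos (-α * S a)).le
      (hw0 a)) (Real.exp_pos (-(β - α) * m)).le)
    linarith
  have h5 := Finset.sum_le_sum fun a (_ : a ∈ Finset.univ) => h1 a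
  rw [Finset.sum_add_distrib, ← Finset.sum_mul, ← Finset.mul_sum, Finset.sum_sub_distrib,
    ← Finset.sum_mul, hm, sub_self, mul_zero, add_zero] at h5
  exact h5

end Paths

variable {Ω 𝒜 : Type*} [Fintype 𝒜] [MeasurableSpace Ω]

/-- The mean of `f ω` under the stationary tilted measure. -/
noncomputable def tiltedMean (θ : Ω ≃ᵐ Ω) (ψ : Ω → 𝒜 → SuperOp d) (f : Ω → 𝒜 → ℝ) (α : ℝ)
    (ω : Ω) : ℝ :=
  pair (futureDir θ ψ f (θ ω) α) (weightedChannel ψ f α ω (pastDir θ ψ f ω α)) /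
    pair (futureDir θ ψ f (θ ω) α) (deformedChannel ψ f α ω (pastDir θ ψ f ω α))

section Recurrent

variable {θ : Ω ≃ᵐ Ω} {ψ : Ω → 𝒜 → SuperOp d} {f : Ω → 𝒜 → ℝ}
  (hψ : ∀ ω, IsIrreducibleInstrument (ψ ω)) {N : ℕ} {ε R : ℝ} (hε : 0 < ε) {ω : Ω}
  (hω : IsRecurrent θ (regularSet θ ψ f N ε R) ω)
include hψ hε hω

theorem pair_futureDir_deformedChannel_pos [NeZero d] (α : ℝ) :
    0 < pair (futureDir θ ψ f (θ ω) α) (deformedChannel ψ f α ω (pastDir θ ψ f ω α)) := by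
  rw [deformedChannel_pastDir hψ hε hω, pair_smul]
  exact mul_pos ((Real.exp_pos _).trans_le
    (reTrace_deformedChannel_pastDir_bounds hψ hε hω α).1)
    (pair_futureDir_pastDir_pos hψ hε hω.apply α)

theorem abs_tiltedMean_le [NeZero d] (α : ℝ) : |tiltedMean θ ψ f α ω| ≤ supAbs f ω := by
  have h := pair_futureDir_deformedChannel_pos hψ hε hω α
  rw [tiltedMean, abs_div, abs_of_pos h, div_le_iff₀ h]
  exact abs_pair_weightedChannel_le hψ α ω
    (mem_densityMatrices.1 (pastDir_mem hψ hε hω α)).1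
    (mem_densityMatrices.1 (futureDir_mem hψ hε hω.apply α)).1

theorem continuous_tiltedMean [NeZero d] : Continuous fun α => tiltedMean θ ψ f α ω := by
  have hW := continuous_futureDir hψ hε hω.apply
  have hZ := continuous_pastDir hψ hε hω
  exact (continuous_pair_apply hW (continuous_weightedChannel_apply ψ f ω hZ)).div
    (continuous_pair_apply hW (continuous_deformedChannel_apply ψ f ω hZ))
    fun α => (pair_futureDir_deformedChannel_pos hψ hε hω α).ne'

/-- The expected path sum under the tilted law. Equivariance of `Z` absorbs the steps before a given
time and that of `W` the steps after it, leaving the one-step tilted mean. -/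
theorem pair_weightedCocycle [NeZero d] (α : ℝ) (n : ℕ) :
    pair (futureDir θ ψ f (θ^[n] ω) α) (weightedCocycle θ ψ f α n ω (pastDir θ ψ f ω α)) =
      pair (futureDir θ ψ f (θ^[n] ω) α)
        (cocycle θ (deformedChannel ψ f α) n ω (pastDir θ ψ f ω α)) *
        birkhoffSum θ (tiltedMean θ ψ f α) n ω := by
  induction n with
  | zero => simp [weightedCocycle, pathSum, pair]
  | succ n ih =>
    have hn := hω.iterate n
    have hp := isPos_deformedChannel (f := f) hψ α (θ^[n] ω)
    have hW := (mem_densityMatrices.1 (futureDir_mem hψ hε hn.apply α)).1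
    have h1 := hsAdjoint_futureDir hψ hε hn α
    have h2 := (pair_futureDir_deformedChannel_pos hψ hε hn α).ne'
    have h3 : ∀ X, pair (futureDir θ ψ f (θ (θ^[n] ω)) α) (deformedChannel ψ f α (θ^[n] ω) X) =
        reTrace (hsAdjoint (deformedChannel ψ f α (θ^[n] ω)) (futureDir θ ψ f (θ (θ^[n] ω)) α)) *
          pair (futureDir θ ψ f (θ^[n] ω) α) X := by
      intro X
      conv_lhs => rw [pair_apply_eq hp hW, h1, smul_pair]
    have h4 : pair (futureDir θ ψ f (θ (θ^[n] ω)) α) (weightedChannel ψ f α (θ^[n] ω)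
        (cocycle θ (deformedChannel ψ f α) n ω (pastDir θ ψ f ω α))) =
        pair (futureDir θ ψ f (θ (θ^[n] ω)) α) (deformedChannel ψ f α (θ^[n] ω)
          (cocycle θ (deformedChannel ψ f α) n ω (pastDir θ ψ f ω α))) *
          tiltedMean θ ψ f α (θ^[n] ω) := by
      rw [cocycle_pastDir hψ hε hω, weightedChannel_smul, map_real_smul, pair_smul, pair_smul,
        tiltedMean]
      field_simp
    rw [Function.iterate_succ_apply', weightedCocycle_succ, pair_add, h4, cocycle,
      LinearMap.comp_apply, birkhoffSum_succ, h3, h3, ih]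
    ring

/-- Jensen's inequality tested against `W`, which is then dropped because a matrix in `𝕊` is at most
`1`. -/
theorem exp_mul_pair_le_reTrace_cocycle [NeZero d] (α β : ℝ) (n : ℕ) :
    Real.exp (birkhoffSum θ (growth θ ψ f α) n ω) *
        pair (futureDir θ ψ f (θ^[n] ω) α) (pastDir θ ψ f (θ^[n] ω) α) *
        Real.exp (-(β - α) * birkhoffSum θ (tiltedMean θ ψ f α) n ω) ≤
      reTrace (cocycle θ (deformedChannel ψ f β) n ω (pastDir θ ψ f ω α)) := by
  have hZ := (mem_densityMatrices.1 (pastDir_mem hψ hε hω α)).1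
  have hW := mem_densityMatrices.1 (futureDir_mem hψ hε (hω.iterate n) α)
  have h := mul_exp_le_pair_cocycle hψ α β n ω hZ hW.1 (pair_weightedCocycle hψ hε hω α n)
  rw [cocycle_pastDir hψ hε hω, pair_smul] at h
  refine h.trans ?_
  have hΦ := (isNondegenerate_cocycle (θ := θ) (isNondegenerate_deformedChannel (f := f) hψ β)
    n ω).pos _ hZ
  have h1 := pair_mono hΦ (le_reTrace_smul_one hW.1)
  rwa [hW.2, one_smul, pair_one_right, pair_comm] at h1

end Recurrent

end QMP

/-- The inequalities at `α` and at `β` squeeze `L β - L α` between `(β - α) g α` and `(β - α) g β`.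
-/
theorem hasDerivAt_of_continuous_subgradient {L g : ℝ → ℝ} (hg : Continuous g)
    (h : ∀ α β, (β - α) * g α ≤ L β - L α) (α : ℝ) : HasDerivAt L (g α) α := by
  rw [hasDerivAt_iff_isLittleO, Asymptotics.isLittleO_iff]
  intro c hc
  have h1 : ∀ᶠ β in 𝓝 α, |g β - g α| < c := by
    have := (hg.tendsto α).eventually (Metric.ball_mem_nhds (g α) hc)
    simpa only [Metric.mem_ball, Real.dist_eq] using this
  filter_upwards [h1] with β hβ
  have h2 := h α β
  have h3 := h β α
  rw [smul_eq_mul, Real.norm_eq_abs, Real.norm_eq_abs, abs_of_nonneg (by linarith)]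
  calc L β - L α - (β - α) * g α ≤ (β - α) * (g β - g α) := by linarith
    _ ≤ |β - α| * |g β - g α| := (le_abs_self _).trans (abs_mul _ _).le
    _ ≤ |β - α| * c := mul_le_mul_of_nonneg_left hβ.le (abs_nonneg _)
    _ = c * |β - α| := mul_comm _ _

/-! ### From rational to real tilts -/

section GartnerEllis

variable {A : ℕ → Type*} [∀ n, Fintype (A n)] {p Y : ∀ n, A n → ℝ}

/-- Consequently the normalised logarithmic masses are Lipschitz in the tilt, with a constant
independent of `n`. -/
theorem tiltedMass_univ_le (hp : ∀ n a, 0 ≤ p n a) {C : ℝ} {n : ℕ} (hY : ∀ a, |Y n a| ≤ C)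
    (t t' : ℝ) : tiltedMass p Y n t Set.univ ≤
      Real.exp (n * (C * |t - t'|)) * tiltedMass p Y n t' Set.univ := by
  have h := tiltedMass_le_exp_mul (Y := Y) hp n t (t' - t) (-(C * |t - t'|)) (E := Set.Icc (-C) C)
    fun y hy => by
      have h1 : |y| ≤ C := abs_le.2 hy
      have h2 : |(t' - t) * y| ≤ C * |t - t'| := by
        rw [abs_mul, abs_sub_comm, mul_comm]
        exact mul_le_mul_of_nonneg_right h1 (abs_nonneg _)
      exact (abs_le.1 h2).1
  rw [mul_neg, neg_neg, add_sub_cancel] at h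
  exact (tiltedMass_mono hp n t fun a _ => abs_le.1 (hY a)).trans h

/-- Almost sure convergence holds simultaneously only for countably many tilts. The uniform
Lipschitz bound and continuity of `L` extend it to all of them. -/
theorem tendsto_log_tiltedMass_of_rat (hp : ∀ n a, 0 ≤ p n a)
    (hpos : ∀ n t, 0 < tiltedMass p Y n t Set.univ) {C : ℝ} (hY : ∀ n, 0 < n → ∀ a, |Y n a| ≤ C)
    {L : ℝ → ℝ} (hLc : Continuous L)
    (hL : ∀ q : ℚ, Tendsto (fun n : ℕ => 1 / (n : ℝ) * Real.log (tiltedMass p Y n q Set.univ)) atTop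
      (𝓝 (L q))) (t : ℝ) :
    Tendsto (fun n : ℕ => 1 / (n : ℝ) * Real.log (tiltedMass p Y n t Set.univ)) atTop
      (𝓝 (L t)) := by
  rw [Metric.tendsto_nhds]
  intro ε hε
  have hnear : ∀ᶠ u in 𝓝 t, |L u - L t| < ε / 3 ∧ C * |t - u| < ε / 3 := by
    refine ((hLc.tendsto t).eventually (Metric.ball_mem_nhds _ (by positivity))).and ?_
    have : Tendsto (fun u => C * |t - u|) (𝓝 t) (𝓝 (C * |t - t|)) :=
      Continuous.tendsto (by fun_prop) t
    rw [sub_self, abs_zero, mul_zero] at this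
    exact this.eventually (gt_mem_nhds (by positivity))
  obtain ⟨q, h1, h2⟩ := (Rat.denseRange_cast (𝕜 := ℝ)).exists_mem_open isOpen_interior
    ⟨t, mem_interior_iff_mem_nhds.2 hnear⟩ |>.imp fun q hq => interior_subset hq
  have h3 := Metric.tendsto_nhds.1 (hL q) (ε / 3) (by positivity)
  filter_upwards [h3, eventually_gt_atTop 0] with n h4 hn
  have hn' : (0 : ℝ) < n := by exact_mod_cast hn
  have key : ∀ u v, 1 / (n : ℝ) * Real.log (tiltedMass p Y n u Set.univ) ≤
      C * |u - v| + 1 / (n : ℝ) * Real.log (tiltedMass p Y n v Set.univ) := by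
    intro u v
    have h5 := Real.log_le_log (hpos n u) (tiltedMass_univ_le hp (hY n hn) u v)
    rw [Real.log_mul (Real.exp_pos _).ne' (hpos n v).ne', Real.log_exp] at h5
    have h6 := mul_le_mul_of_nonneg_left h5 (show 0 ≤ 1 / (n : ℝ) by positivity)
    rw [mul_add, ← mul_assoc, one_div, inv_mul_cancel₀ hn'.ne', one_mul] at h6
    rwa [one_div]
  have k1 := key t q
  have k2 := key q t
  rw [abs_sub_comm (q : ℝ) t] at k2
  rw [Real.dist_eq, abs_lt] at h4 ⊢
  rw [abs_lt] at h1
  constructor <;> linarith [h4.1, h4.2, h1.1, h1.2]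

end GartnerEllis

/-! ### Differentiability of the Lyapunov exponent -/

namespace QMP

variable {d : ℕ} {Ω 𝒜 : Type*} [Fintype 𝒜]

section Integral

variable [MeasurableSpace Ω] {P : Measure Ω} {θ : Ω ≃ᵐ Ω} {ψ : Ω → 𝒜 → SuperOp d}
  {f : Ω → 𝒜 → ℝ}
  (hψm : ∀ (a : 𝒜) (X : Op d) (i j : Fin d), Measurable fun ω => ψ ω a X i j)
  (hf : ∀ a, Measurable fun ω => f ω a)
include hψm hf

theorem measurable_tiltedMean (α : ℝ) : Measurable (tiltedMean θ ψ f α) := by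
  have hW : ∀ i j, Measurable fun ω => futureDir θ ψ f (θ ω) α i j := fun i j =>
    (measurable_futureDir hψm hf α i j).comp θ.measurable
  have hZ := fun i j => measurable_pastDir (θ := θ) hψm hf α i j
  refine Measurable.div (measurable_pair (fun i j => ?_) hW)
    (measurable_pair (fun i j => (measurableEntries_deformedChannel hψm hf α).apply hZ i j) hW)
  simp only [weightedChannel, Matrix.sum_apply, Matrix.smul_apply, Complex.real_smul]
  exact Finset.measurable_sum _ fun a _ => (Complex.measurable_ofReal.comp
    ((hf a).mul (Real.measurable_exp.comp ((hf a).const_mul _)))).mul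
    (MeasurableEntries.apply (hψm a) hZ i j)

variable (hψ : ∀ ω, IsIrreducibleInstrument (ψ ω)) {N : ℕ} {ε R : ℝ} (hε : 0 < ε)
  (hrec : ∀ᵐ ω ∂P, IsRecurrent θ (regularSet θ ψ f N ε R) ω) (hF : Integrable (supAbs f) P)
include hψ hε hrec hF

theorem integrable_tiltedMean [NeZero d] (α : ℝ) : Integrable (tiltedMean θ ψ f α) P := by
  refine hF.mono' (measurable_tiltedMean hψm hf α).aestronglyMeasurable ?_
  filter_upwards [hrec] with ω hω using abs_tiltedMean_le hψ hε hω α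

theorem continuous_integral_tiltedMean [NeZero d] :
    Continuous fun α => ∫ ω, tiltedMean θ ψ f α ω ∂P := by
  refine continuous_of_dominated (bound := supAbs f)
    (fun α => (measurable_tiltedMean hψm hf α).aestronglyMeasurable) (fun α => ?_) hF ?_
  · filter_upwards [hrec] with ω hω using abs_tiltedMean_le hψ hε hω α
  · filter_upwards [hrec] with ω hω using continuous_tiltedMean hψ hε hω

-- The pairing of `W` with `Z` is positive almost everywhere but may lack a uniform lower bound.
-- Some level `δ` is exceeded with positive probability, hence infinitely often along the orbit.
omit hF in
theorem ae_frequently_le_pair [NeZero d] [IsProbabilityMeasure P] (hθ : Ergodic θ P) (α : ℝ) :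
    ∃ δ > 0, ∀ᵐ ω ∂P, ∃ᶠ n in atTop,
      δ ≤ pair (futureDir θ ψ f (θ^[n] ω) α) (pastDir θ ψ f (θ^[n] ω) α) := by
  set q : Ω → ℝ := fun ω => pair (futureDir θ ψ f ω α) (pastDir θ ψ f ω α) with hq
  have hqm : Measurable q := measurable_pair (fun i j => measurable_pastDir hψm hf α i j)
    (fun i j => measurable_futureDir hψm hf α i j)
  obtain ⟨k, hk⟩ : ∃ k : ℕ, 0 < P {ω | 1 / ((k : ℝ) + 1) ≤ q ω} := by
    by_contra! h
    have h1 : P (⋃ k : ℕ, {ω | 1 / ((k : ℝ) + 1) ≤ q ω}) = 0 :=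
      measure_iUnion_null fun k => le_antisymm (h k) zero_le
    have h2 : ∀ᵐ ω ∂P, ω ∈ ⋃ k : ℕ, {ω | 1 / ((k : ℝ) + 1) ≤ q ω} := by
      filter_upwards [hrec] with ω hω
      obtain ⟨k, hk⟩ := exists_nat_one_div_lt (pair_futureDir_pastDir_pos hψ hε hω α)
      exact Set.mem_iUnion.2 ⟨k, hk.le⟩
    have h3 : ∀ᵐ ω ∂P, ω ∉ ⋃ k : ℕ, {ω | 1 / ((k : ℝ) + 1) ≤ q ω} :=
        measure_eq_zero_iff_ae_notMem.1 h1
    obtain ⟨ω, h4, h5⟩ := (h2.and h3).exists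
    exact h5 h4
  exact ⟨1 / ((k : ℝ) + 1), by positivity,
    hθ.ae_frequently_mem (measurableSet_le measurable_const hqm) hk⟩

/-- Take logarithms in the Jensen bound and divide by `n`, along the times at which the pairing is
at least `δ`. All the limits exist, so an inequality at infinitely many times suffices. -/
theorem lyapunov_subgradient [NeZero d] [IsProbabilityMeasure P] (hθ : Ergodic θ P) (α β : ℝ) :
    (β - α) * -∫ ω, tiltedMean θ ψ f α ω ∂P ≤ lyapunov P θ ψ f β - lyapunov P θ ψ f α := by
  obtain ⟨δ, hδ, hfreq⟩ := ae_frequently_le_pair hψm hf hψ hε hrec hθ α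
  obtain ⟨ω, hω, h1, h2, h3, h4⟩ := (hrec.and (hfreq.and
    ((ae_tendsto_log_reTrace_cocycle hψm hf hψ hε hrec hF hθ β).and
    ((hθ.ae_tendsto_birkhoffSum (integrable_growth hψm hf hψ hε hrec hF α)).and
    (hθ.ae_tendsto_birkhoffSum (integrable_tiltedMean hψm hf hψ hε hrec hF α)))))).exists
  have h5 : Tendsto (fun n : ℕ => 1 / (n : ℝ) * Real.log δ) atTop (𝓝 0) := by
    simpa using tendsto_one_div_atTop_nhds_zero_nat.mul_const (Real.log δ)
  have h6 := ((h2 _ (pastDir_mem hψ hε hω α)).sub h3).sub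
    ((h4.const_mul (-(β - α))).add h5)
  have h7 := ge_of_tendsto_of_frequently (b := 0) h6 (h1.mono fun n hn => ?_)
  · rw [add_zero] at h7
    rw [lyapunov.eq_1 P θ ψ f α]
    linarith
  · have h8 := exp_mul_pair_le_reTrace_cocycle hψ hε hω α β n
    have h9 : Real.exp (birkhoffSum θ (growth θ ψ f α) n ω) * δ *
        Real.exp (-(β - α) * birkhoffSum θ (tiltedMean θ ψ f α) n ω) ≤
        reTrace (cocycle θ (deformedChannel ψ f β) n ω (pastDir θ ψ f ω α)) :=
      le_trans (by gcongr) h8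
    have h10 := Real.log_le_log (by positivity) h9
    rw [Real.log_mul (by positivity) (Real.exp_pos _).ne',
      Real.log_mul (Real.exp_pos _).ne' hδ.ne', Real.log_exp, Real.log_exp] at h10
    have h11 := mul_le_mul_of_nonneg_left h10 (show 0 ≤ 1 / (n : ℝ) by positivity)
    linarith

theorem hasDerivAt_lyapunov [NeZero d] [IsProbabilityMeasure P] (hθ : Ergodic θ P) (α : ℝ) :
    HasDerivAt (lyapunov P θ ψ f) (-∫ ω, tiltedMean θ ψ f α ω ∂P) α :=
  hasDerivAt_of_continuous_subgradient (g := fun α => -∫ ω, tiltedMean θ ψ f α ω ∂P)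
    (continuous_integral_tiltedMean hψm hf hψ hε hrec hF).neg
    (lyapunov_subgradient hψm hf hψ hε hrec hF hθ) α

end Integral

/-! ### Event probabilities and extended-real rates -/

section Probability

variable {θ : Ω → Ω} {ψ : Ω → 𝒜 → SuperOp d} {f : Ω → 𝒜 → ℝ}

omit [Fintype 𝒜] in
theorem natCast_mul_birkhoffLikeAverage (ω : Ω) (n : ℕ) (a : Fin n → 𝒜) :
    n * birkhoffLikeAverage θ f ω n a = pathSum θ f ω n a := by
  rcases Nat.eq_zero_or_pos n with rfl | hn
  · simp [pathSum]
  · have : (n : ℝ) ≠ 0 := by exact_mod_cast hn.ne'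
    rw [birkhoffLikeAverage, ← mul_assoc, mul_one_div_cancel this, one_mul, pathSum]

theorem abs_birkhoffLikeAverage_le (ω : Ω) (n : ℕ) (a : Fin n → 𝒜) :
    |birkhoffLikeAverage θ f ω n a| ≤ 1 / (n : ℝ) * birkhoffSum θ (supAbs f) n ω := by
  rw [birkhoffLikeAverage, abs_mul, abs_of_nonneg (by positivity), birkhoffSum,
    Finset.sum_range]
  exact mul_le_mul_of_nonneg_left ((Finset.abs_sum_le_sum_abs _ _).trans
    (Finset.sum_le_sum fun j _ => abs_le_supAbs f _ _)) (by positivity)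

theorem outcomeProb_nonneg (hψ : ∀ ω, IsIrreducibleInstrument (ψ ω)) (ω : Ω) {ρ : Op d}
    (hρ : 0 ≤ ρ) (n : ℕ) (a : Fin n → 𝒜) : 0 ≤ outcomeProb θ ψ ω ρ n a :=
  reTrace_nonneg (isPos_trajectory (isPos_outcome hψ) ω n a ρ hρ)

/-- The link between the probabilistic and the dynamical side. The change of sign in the parameter
is the origin of `λ^*(-s)`. -/
theorem tiltedMass_univ_eq (ω : Ω) (ρ : Op d) (n : ℕ) (t : ℝ) :
    tiltedMass (outcomeProb θ ψ ω ρ) (birkhoffLikeAverage θ f ω) n t Set.univ =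
      reTrace (cocycle θ (deformedChannel ψ f (-t)) n ω ρ) := by
  rw [cocycle_deformedChannel_eq_sum, reTrace_sum, tiltedMass]
  refine Finset.sum_congr rfl fun a _ => ?_
  rw [if_pos (Set.mem_univ _), natCast_mul_birkhoffLikeAverage, reTrace_smul, neg_neg, mul_comm]
  rfl

theorem eventProb_eq (hψ : ∀ ω, IsIrreducibleInstrument (ψ ω)) (ω : Ω) {ρ : Op d}
    (hρ : 0 ≤ ρ) (n : ℕ) (E : Set ℝ) :
    eventProb θ ψ ω ρ n {a | birkhoffLikeAverage θ f ω n a ∈ E} =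
      ENNReal.ofReal (tiltedMass (outcomeProb θ ψ ω ρ) (birkhoffLikeAverage θ f ω) n 0 E) := by
  classical
  rw [eventProb, tiltedMass, ENNReal.ofReal_sum_of_nonneg]
  · refine Finset.sum_congr rfl fun a _ => ?_
    by_cases h : birkhoffLikeAverage θ f ω n a ∈ E <;> simp [h]
  · intro a _
    split_ifs
    · exact mul_nonneg (outcomeProb_nonneg hψ ω hρ n a) (Real.exp_pos _).le
    · exact le_rfl

end Probability

theorem log_ofReal_exp (y : ℝ) : ENNReal.log (ENNReal.ofReal (Real.exp y)) = (y : EReal) := by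
  rw [ENNReal.log_ofReal, if_neg (not_le.2 (Real.exp_pos y)), Real.log_exp]

theorem one_div_mul_log_ofReal_exp {n : ℕ} (hn : 0 < n) (x : ℝ) :
    ((1 / (n : ℝ) : ℝ) : EReal) * ENNReal.log (ENNReal.ofReal (Real.exp (-(n * x)))) =
      ((-x : ℝ) : EReal) := by
  have : (n : ℝ) ≠ 0 := by exact_mod_cast hn.ne'
  rw [log_ofReal_exp, ← EReal.coe_mul]
  congr 1
  field_simp

theorem scaledLog_le {q x : ℝ} {n : ℕ} (hn : 0 < n) (h : q ≤ Real.exp (-(n * x))) :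
    ((1 / (n : ℝ) : ℝ) : EReal) * ENNReal.log (ENNReal.ofReal q) ≤ ((-x : ℝ) : EReal) := by
  rw [← one_div_mul_log_ofReal_exp hn]
  exact mul_le_mul_of_nonneg_left (ENNReal.log_monotone (ENNReal.ofReal_le_ofReal h))
    (EReal.coe_nonneg.2 (by positivity))

theorem le_scaledLog {q x : ℝ} {n : ℕ} (hn : 0 < n) (h : Real.exp (-(n * x)) ≤ q) :
    ((-x : ℝ) : EReal) ≤ ((1 / (n : ℝ) : ℝ) : EReal) * ENNReal.log (ENNReal.ofReal q) := by
  rw [← one_div_mul_log_ofReal_exp hn]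
  exact mul_le_mul_of_nonneg_left (ENNReal.log_monotone (ENNReal.ofReal_le_ofReal h))
    (EReal.coe_nonneg.2 (by positivity))

/-- Points with infinite rate give the trivial bound `⊥`. Elsewhere the rate is real, since `α = 0`
keeps it above `⊥`, and it is approximated by real numbers strictly above it. -/
theorem neg_iInf_legendre_le_liminf {u : ℕ → EReal} {lam : ℝ → ℝ} {E : Set ℝ}
    (h : ∀ s ∈ interior E, ∀ x x' : ℝ, x < x' → (∀ t, t * s - lam (-t) ≤ x) →
      ∀ᶠ n in atTop, ((-x' : ℝ) : EReal) ≤ u n) :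
    -(⨅ s ∈ interior E, legendre lam (-s)) ≤ liminf u atTop := by
  rw [EReal.neg_le]
  refine le_iInf₂ fun s hs => ?_
  rw [EReal.neg_le]
  rcases eq_or_ne (legendre lam (-s)) ⊤ with htop | htop
  · rw [htop, EReal.neg_top]
    exact bot_le
  have hle : ∀ t : ℝ, ((t * s - lam (-t) : ℝ) : EReal) ≤ legendre lam (-s) := by
    intro t
    refine le_trans (le_of_eq ?_) (le_iSup (fun α : ℝ => ((-s * α - lam α : ℝ) : EReal)) (-t))
    rw [show -s * -t = t * s by ring]
  have hbot : legendre lam (-s) ≠ ⊥ := ((EReal.bot_lt_coe _).trans_le (hle 0)).ne'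
  lift legendre lam (-s) to ℝ using ⟨htop, hbot⟩ with x
  refine le_of_forall_lt_imp_le_of_dense fun c hc => ?_
  obtain ⟨r, hr1, hr2⟩ := EReal.lt_iff_exists_real_btwn.1 hc
  rw [← EReal.coe_neg, EReal.coe_lt_coe_iff] at hr2
  refine hr1.le.trans (le_liminf_of_le (by isBoundedDefault) ?_)
  have := h s hs x (-r) (by linarith) fun t => EReal.coe_le_coe_iff.1 (hle t)
  simpa using this

/-- Any real number below the infimum is beaten at each `s` by some tilt, by definition of the
supremum; a second one leaves room for the strict inequality. -/
theorem limsup_le_neg_iInf_legendre {u : ℕ → EReal} {lam : ℝ → ℝ} {E : Set ℝ}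
    (h : ∀ x x' : ℝ, x' < x → (∀ s ∈ closure E, ∃ t, x < t * s - lam (-t)) →
      ∀ᶠ n in atTop, u n ≤ ((-x' : ℝ) : EReal)) :
    limsup u atTop ≤ -(⨅ s ∈ closure E, legendre lam (-s)) := by
  refine le_of_forall_gt_imp_ge_of_dense fun c hc => ?_
  rw [EReal.neg_lt_comm] at hc
  obtain ⟨r', h1, h2⟩ := EReal.lt_iff_exists_real_btwn.1 hc
  obtain ⟨r, h3, h4⟩ := EReal.lt_iff_exists_real_btwn.1 h2
  rw [EReal.coe_lt_coe_iff] at h3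
  have h5 : ((-r' : ℝ) : EReal) ≤ c := by
    rw [EReal.coe_neg]
    exact (EReal.neg_lt_comm.1 h1).le
  refine le_trans (limsup_le_of_le (by isBoundedDefault) (h r r' h3 fun s hs => ?_)) h5
  have h6 : (r : EReal) < legendre lam (-s) := h4.trans_le (iInf₂_le s hs)
  obtain ⟨α, hα⟩ := lt_iSup_iff.1 h6
  refine ⟨-α, ?_⟩
  rw [EReal.coe_lt_coe_iff] at hα
  rw [neg_neg]
  linarith

end QMP

/-! ### Assembly -/

theorem theorem1 {Ω : Type*} [MeasurableSpace Ω] (P : Measure Ω) [IsProbabilityMeasure P]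
    (θ : Ω ≃ᵐ Ω) (hθ : Ergodic θ P)
    {d : ℕ} [NeZero d] {𝒜 : Type*} [Fintype 𝒜]
    (ψ : Ω → 𝒜 → QMP.SuperOp d)
    (hψ_meas : ∀ (a : 𝒜) (X : QMP.Op d) (i j : Fin d), Measurable fun ω => ψ ω a X i j)
    (hψ : ∀ ω, QMP.IsIrreducibleInstrument (ψ ω))
    (f : Ω → 𝒜 → ℝ) (hf_meas : ∀ a, Measurable fun ω => f ω a)
    (hA1 : Integrable (fun ω => Real.log (QMP.v (QMP.hsAdjoint (QMP.channel ψ ω)))) P)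
    (hA2 : ∃ N₀ : ℕ, 0 < P {ω | QMP.IsPositivityImproving
      (QMP.cocycle θ (QMP.channel ψ) N₀ ω)})
    (hA3 : ∀ α : ℝ, Integrable (fun ω => Real.exp (α * ⨆ a, |f ω a|)) P) :
    ∃ lam : ℝ → ℝ,
      (∀ α : ℝ, ∀ᵐ ω ∂P, Tendsto
        (fun n : ℕ => (1 / (n : ℝ)) *
          Real.log (QMP.opNorm (QMP.cocycle θ (QMP.deformedChannel ψ f α) n ω)))
        atTop (𝓝 (lam α))) ∧
      ∀ᵐ ω ∂P, ∀ ρ ∈ QMP.densityMatrices d, ∀ E : Set ℝ, MeasurableSet E →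
        -(⨅ s ∈ interior E, QMP.legendre lam (-s)) ≤
            liminf (fun n : ℕ => QMP.scaledLogProb θ ψ f ω ρ E n) atTop ∧
          liminf (fun n : ℕ => QMP.scaledLogProb θ ψ f ω ρ E n) atTop ≤
            limsup (fun n : ℕ => QMP.scaledLogProb θ ψ f ω ρ E n) atTop ∧
          limsup (fun n : ℕ => QMP.scaledLogProb θ ψ f ω ρ E n) atTop ≤
            -(⨅ s ∈ closure E, QMP.legendre lam (-s)) := by
  open QMP in
  obtain ⟨N, ε, R, hε, hrec⟩ := exists_ae_isRecurrent hθ hψ_meas hf_meas hA2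
  have hF : Integrable (supAbs f) P := integrable_supAbs hf_meas hA3
  refine ⟨lyapunov P θ ψ f,
    ae_tendsto_log_opNorm_cocycle hψ_meas hf_meas hψ hε hrec hF hθ, ?_⟩
  have hderiv := hasDerivAt_lyapunov hψ_meas hf_meas hψ hε hrec hF hθ
  have hrat : ∀ᵐ ω ∂P, ∀ q : ℚ, ∀ ρ ∈ densityMatrices d, Tendsto (fun n : ℕ => 1 / (n : ℝ) *
      Real.log (reTrace (cocycle θ (deformedChannel ψ f (-(q : ℝ))) n ω ρ))) atTop
      (𝓝 (lyapunov P θ ψ f (-(q : ℝ)))) := ae_all_iff.2 fun q =>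
    ae_tendsto_log_reTrace_cocycle hψ_meas hf_meas hψ hε hrec hF hθ _
  filter_upwards [hrat, hθ.ae_tendsto_birkhoffSum hF] with ω hω hbdd ρ hρ E _
  -- The averages of `F` along the orbit converge, hence are bounded. This confines the empirical
  -- averages to `[-C, C]`, with `C` depending on `ω`.
  obtain ⟨C, hC⟩ := hbdd.bddAbove_range
  have hρ0 := (mem_densityMatrices.1 hρ).1
  have hp := outcomeProb_nonneg (θ := θ) hψ ω hρ0
  have hY : ∀ n, 0 < n → ∀ a, |birkhoffLikeAverage θ f ω n a| ≤ C := fun n _ a =>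
    (abs_birkhoffLikeAverage_le ω n a).trans (hC ⟨n, rfl⟩)
  have hpos : ∀ n t, 0 < tiltedMass (outcomeProb θ ψ ω ρ) (birkhoffLikeAverage θ f ω) n t
      Set.univ := by
    intro n t
    rw [tiltedMass_univ_eq]
    have hnd := isNondegenerate_cocycle (θ := θ) (isNondegenerate_deformedChannel (f := f) hψ (-t))
      n ω
    exact reTrace_pos (hnd.pos _ hρ0) (hnd.ne_zero _ hρ0 (ne_zero_of_mem_densityMatrices hρ))
  -- The limiting cumulant function is `t ↦ λ(-t)`.
  have hd : ∀ t, HasDerivAt (fun t => lyapunov P θ ψ f (-t))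
      (∫ ω, tiltedMean θ ψ f (-t) ω ∂P) t := by
    intro t
    have := (hderiv (-t)).comp t (hasDerivAt_neg t)
    refine this.congr_deriv ?_
    ring
  have hL := tendsto_log_tiltedMass_of_rat hp hpos hY
    (continuous_iff_continuousAt.2 fun t => (hd t).continuousAt) fun q => by
      simpa only [tiltedMass_univ_eq] using hω q ρ hρ
  refine ⟨neg_iInf_legendre_le_liminf fun s hs x x' hx hsx => ?_, liminf_le_limsup,
    limsup_le_neg_iInf_legendre fun x x' hx hE => ?_⟩
  · filter_upwards [eventually_le_tiltedMass hp hpos hL hd hx hs hsx, eventually_gt_atTop 0]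
      with n h1 h2
    rw [scaledLogProb, eventProb_eq hψ ω hρ0]
    exact le_scaledLog h2 h1
  · filter_upwards [eventually_tiltedMass_le hp hpos hL hY hx hE, eventually_gt_atTop 0]
      with n h1 h2
    rw [scaledLogProb, eventProb_eq hψ ω hρ0]
    exact scaledLog_le h2 h1
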